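/- Let $d\in\mathbb N$. Let $\tau:[0,\infty)\to(0,\infty)$ be a delay with $\tau\in W^{1,\infty}([0,T])$ for every $T>0$ (i.e. $\tau$ is Lipschitz on $[0,T]$), $\tau'\le 0$ a.e., and $\tau(t)\ge\tau_*$ for all $t\ge 0$, for some $\tau_*>0$. Let $\alpha:[0,\tau(0)]\to[0,\infty)$ be integrable with $\int_0^{\tau_*}\alpha(s)\,ds>0$, and put $h(t)=\int_0^{\tau(t)}\alpha(s)\,ds$. Let $\psi:[0,\infty)\to(0,\infty)$ be non-increasing and Lipschitz continuous. For a probability measure $\mu$ with finite first moment let $F[\mu]$ be given by either $$F[\mu](x)=\int_{\mathbb R^d}\psi(|x-y|)(y-x)\,d\mu(y)\qquad\text{or}\qquad F[\mu](x)=\frac{\int_{\mathbb R^d}\psi(|x-y|)(y-x)\,d\mu(y)}{\int_{\mathbb R^d}\psi(|x-y|)\,d\mu(y)} .$$ Let $\mathcal P_1(\mathbb R^d)$ be the space of Borel probability measures on $\mathbb R^d$ with finite first moment, with the 1-Wasserstein distance $d_1$. Consider the delayed transport equation $$\partial_t\mu_t+\operatorname{div}\big(v(t,\cdot)\,\mu_t\big)=0,\quad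 v(t,x)=\frac1{h(t)}\int_{t-\tau(t)}^t\alpha(t-s)F[\mu_s](x)\,ds,\qquad \mu_s=g_s\ \text{ for } s\in[-\tau(0),0],$$ with initial history $g\in C([-\tau(0),0];\mathcal P_1(\mathbb R^d))$. A curve $\mu\in C([0,T);\mathcal P_1(\mathbb R^d))$ is a weak solution on $[0,T)$ if, with $\mu_s=g_s$ for $s<0$ in the definition of $v$, for all $\varphi\in C_c^\infty(\mathbb R^d\times[0,T))$, $$\int_0^T\int_{\mathbb R^d}\big(\partial_t\varphi(x,t)+v(t,x)\cdot\nabla_x\varphi(x,t)\big)\,d\mu_t(x)\,dt+\int_{\mathbb R^d}\varphi(x,0)\,dg_0(x)=0 .$$ **Theorem.** Suppose that there is $R>0$ such that $\operatorname{supp} g_s\subseteq \overline{B}(0,R)$ for all $s\in[-\tau(0),0]$. Then for every $T>0$ there exists a unique weak solution $\mu\in C([0,T);\mathcal P_1(\mathbb R^d))$, and $\mu_0=g_0$. Moreover, there is a compact set $K\subset\mathbb R^d$ with $\operatorname{supp}\mu_t\subseteq K$ for all $t\in[0,T)$, and $$\mu_t=X(t;\cdot)\#\mu_0\qquad\text{for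 all } t\in[0,T),$$ where $X(t;\cdot)$ is measurable and $X$ is the unique solution on $[0,T)$, for every starting point $x\in\mathbb R^d$, of the characteristic system $$\frac{d}{dt}X(t;x)=v(t,X(t;x)),\qquad X(0;x)=x .$$ -/

import Mathlib

open MeasureTheory Set Filter Topology
open scoped NNReal ENNReal ContDiff

noncomputable section

namespace DelayedTransport

/-- The opinion space `ℝ^d` with its Euclidean norm. -/
abbrev E (d : ℕ) : Type := EuclideanSpace ℝ (Fin d)

variable {d : ℕ}

/-- `P₁(ℝ^d)`: Borel probability measures with finite first moment. -/
def IsP1 (μ : Measure (E d)) : Prop :=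
  IsProbabilityMeasure μ ∧ ∫⁻ x, ‖x‖ₑ ∂μ < ⊤

/-- Couplings of `μ` and `ν`: measures on `ℝ^d × ℝ^d` with marginals `μ` and `ν`. -/
def IsCoupling (π : Measure (E d × E d)) (μ ν : Measure (E d)) : Prop :=
  π.map Prod.fst = μ ∧ π.map Prod.snd = ν

/-- The 1-Wasserstein distance, as an extended non-negative number
(it is finite when both measures are in `P₁`). -/
def W1 (μ ν : Measure (E d)) : ℝ≥0∞ :=
  ⨅ (π : Measure (E d × E d)) (_ : IsCoupling π μ ν), ∫⁻ p, edist p.1 p.2 ∂π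

/-- `μ ∈ C(I; P₁(ℝ^d))`: on the time set `I`, the curve `μ` takes values in `P₁` and is continuous
for the distance `W1`. Values of `μ` outside `I` are irrelevant. -/
def ContinuousP1On (μ : ℝ → Measure (E d)) (I : Set ℝ) : Prop :=
  (∀ t ∈ I, IsP1 (μ t)) ∧ ∀ t ∈ I, Tendsto (fun s => W1 (μ s) (μ t)) (𝓝[I] t) (𝓝 0)

/-- `F[μ](x) = ∫ ψ(|x-y|) (y-x) dμ(y)`. -/
def forceSymm (ψ : ℝ → ℝ) (μ : Measure (E d)) (x : E d) : E d :=
  ∫ y, ψ ‖x - y‖ • (y - x) ∂μ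

/-- `F[μ](x) = ∫ ψ(|x-y|) (y-x) dμ(y) / ∫ ψ(|x-y|) dμ(y)`. -/
def forceNonsymm (ψ : ℝ → ℝ) (μ : Measure (E d)) (x : E d) : E d :=
  (∫ y, ψ ‖x - y‖ ∂μ)⁻¹ • ∫ y, ψ ‖x - y‖ • (y - x) ∂μ

/-- `h(t) = ∫_0^{τ(t)} α(s) ds`. -/
def h (α τ : ℝ → ℝ) (t : ℝ) : ℝ := ∫ s in (0 : ℝ)..τ t, α s

/-- The curve equal to the history `g` at negative times and to `μ` at non-negative times. -/
def withHistory (g μ : ℝ → Measure (E d)) (s : ℝ) : Measure (E d) :=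
  if s < 0 then g s else μ s

/-- The velocity field `(t, x) ↦ h(t)⁻¹ ∫_{t-τ(t)}^t α(t-s) F[μ_s](x) ds`, where `μ_s = g_s` for
`s < 0`. -/
def velocity (α τ : ℝ → ℝ) (F : Measure (E d) → E d → E d) (g μ : ℝ → Measure (E d))
    (t : ℝ) (x : E d) : E d :=
  (h α τ t)⁻¹ • ∫ s in (t - τ t)..t, α (t - s) • F (withHistory g μ s) x

/-- `φ ∈ C_c^∞(ℝ^d × [0,T))`: the restriction to `t ≥ 0` of a smooth function on `ℝ^d × ℝ` with
compact support in `ℝ^d × (-∞,T)`; so `φ` need not vanish at `t = 0`. -/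
def IsTestFunction (T : ℝ) (φ : E d × ℝ → ℝ) : Prop :=
  ContDiff ℝ ∞ φ ∧ HasCompactSupport φ ∧ tsupport φ ⊆ univ ×ˢ Iio T

/-- `μ ∈ C([0,T); P₁)` is a weak solution on `[0,T)` of
`∂_t μ + div (velocity · μ) = 0` with history `g`. The term `fderiv ℝ (φ(·,t)) x v` is
`∇ₓφ(x,t) · v`. -/
def IsWeakSolution (α τ : ℝ → ℝ) (F : Measure (E d) → E d → E d) (g : ℝ → Measure (E d))
    (T : ℝ) (μ : ℝ → Measure (E d)) : Prop :=
  ContinuousP1On μ (Ico 0 T) ∧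
  ∀ φ : E d × ℝ → ℝ, IsTestFunction T φ →
    (∫ t in (0 : ℝ)..T, ∫ x, (deriv (fun r => φ (x, r)) t
        + fderiv ℝ (fun y => φ (y, t)) x (velocity α τ F g μ t x)) ∂(μ t))
      + ∫ x, φ (x, 0) ∂(g 0) = 0

/-- `X(t;x)` solves, on `[0,T)`, the characteristic system
`dX(t;x)/dt = v(t, X(t;x))`, `X(0;x) = x`, for every `x ∈ ℝ^d` (one-sided derivative at `0`). -/
def IsCharacteristicFlow (v : ℝ → E d → E d) (T : ℝ) (X : ℝ → E d → E d) : Prop :=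
  ∀ x, X 0 x = x ∧
    ∀ t ∈ Ico 0 T, HasDerivWithinAt (fun r => X r x) (v t (X t x)) (Ico 0 T) t

end DelayedTransport

end

/-!
The characteristics of the equation start from the support of `g 0`, so a solution is the
push-forward of `g 0` along a flow `u`, and the velocity field at time `t` is a function of `u` up
to time `t`. Of the interaction only three properties matter (`IsForce`): linear growth, continuity
along `W1`-continuous curves, and a Lipschitz estimate in the map that transports a fixed measure.
The normalized force has them because its denominator is bounded below in terms of the first moment
(`half_le_integral_weight`), and because it is a weighted mean of `y - x` whose weights favour small
distances (`norm_forceNonsymm_le`).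

*Existence.* The nonlinear characteristic system is a fixed-point problem for the flow. The linear
growth of the force gives an exponential bound that Picard's iteration preserves, the Lipschitz
estimate makes the iteration a contraction in an exponentially weighted supremum norm, and its limit
is a flow whose velocity is generated by its own transport of the initial measure (`exists_flow`).
The fundamental theorem of calculus along characteristics turns it into a weak solution
(`IsFlowMap.isWeakTransport`).

*Uniqueness.* A weak solution `ν` solves the linear transport equation of its own velocity field,
which is continuous, of linear growth, and Lipschitz on balls (`isField_velocity`). Linear
uniqueness holds by duality: for a smooth terminal value `η`, the function that sends `(x, t)` to
the value of `η` at the terminal point of the characteristic through `(x, t)` is Lipschitz and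
constant along characteristics. Its mollifications are admissible test functions, and the transport
operator is uniformly small on them (`abs_fderiv_mollify_le`), so the integral of this function
against `ν t` does not depend on `t`. Hence `ν` is the push-forward of `g 0` along its
characteristics (`IsWeakTransport.eq_map`), that is, along another solution of the nonlinear
characteristic system (`IsWeakSolution.exists_flow`), and two such flows agree by the contraction
estimate (`IsFlowMap.eq_of_isSolutionOn`).
-/

noncomputable section

namespace DelayedTransport

variable {d : ℕ}

/-! ### Wasserstein convergence of measures -/

section

theorem IsP1.integrable_norm {μ : Measure (E d)} (h : IsP1 μ) : Integrable (fun x => ‖x‖) μ := by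
  refine ⟨by fun_prop, ?_⟩
  simpa [HasFiniteIntegral] using h.2

theorem IsP1.integrable_of_le {μ : Measure (E d)} (h : IsP1 μ) {G : Type*} [NormedAddCommGroup G]
    {f : E d → G} (hf : AEStronglyMeasurable f μ) {A B : ℝ} (hA : ∀ y, ‖f y‖ ≤ A + B * ‖y‖) :
    Integrable f μ := by
  have := h.1
  exact ((integrable_const A).add (h.integrable_norm.const_mul B)).mono' hf (ae_of_all _ hA)

theorem isP1_map {Ω : Type*} [MeasurableSpace Ω] {P : Measure Ω} [IsProbabilityMeasure P]
    {X : Ω → E d} (hX : Measurable X) (hi : Integrable (fun w => ‖X w‖) P) : IsP1 (P.map X) := by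
  refine ⟨Measure.isProbabilityMeasure_map hX.aemeasurable, ?_⟩
  rw [lintegral_map (by fun_prop) hX]
  simpa [HasFiniteIntegral] using hi.2

theorem W1_map_le {Ω : Type*} [MeasurableSpace Ω] (P : Measure Ω)
    {X Y : Ω → E d} (hX : Measurable X) (hY : Measurable Y) :
    W1 (P.map X) (P.map Y) ≤ ∫⁻ w, edist (X w) (Y w) ∂P := by
  have hπ : IsCoupling (P.map fun w => (X w, Y w)) (P.map X) (P.map Y) := by
    constructor <;> (rw [Measure.map_map (by fun_prop) (by fun_prop)]; rfl)
  calc W1 (P.map X) (P.map Y)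
      ≤ ∫⁻ p, edist p.1 p.2 ∂(P.map fun w => (X w, Y w)) :=
        iInf₂_le (f := fun π (_ : IsCoupling π (P.map X) (P.map Y)) => ∫⁻ p, edist p.1 p.2 ∂π) _ hπ
    _ = _ := lintegral_map (by fun_prop) (by fun_prop)

/-- The pointwise estimate behind weak convergence from `W1`-convergence: a jointly continuous
integrand of linear growth varies by at most `ε`, up to a multiple of the distance and a tail. -/
theorem exists_dist_le_of_linearGrowth {P G : Type*} [TopologicalSpace P] [NormedAddCommGroup G]
    {Ψ : P → E d → G} (hΨ : Continuous (Function.uncurry Ψ)) {p₀ : P} {A : ℝ} (hA0 : 0 ≤ A)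
    (hA : ∀ᶠ p in 𝓝 p₀, ∀ y, ‖Ψ p y‖ ≤ A * (1 + ‖y‖)) {ε k : ℝ} (hε : 0 < ε) (hk : 0 ≤ k) :
    ∃ C, 0 ≤ C ∧ ∀ᶠ p in 𝓝 p₀, ∀ y' y, ‖Ψ p y' - Ψ p₀ y‖ ≤
      ε + C * ‖y' - y‖ + (Metric.closedBall (0 : E d) k)ᶜ.indicator
        (fun y => A * (2 + 2 * ‖y‖)) y := by
  set K : Set (E d × E d) := (fun y => (y, y)) '' Metric.closedBall (0 : E d) k with hK
  have hKc : IsCompact K := (isCompact_closedBall _ _).image (by fun_prop)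
  let D : P × (E d × E d) → ℝ := fun q => ‖Ψ q.1 q.2.1 - Ψ p₀ q.2.2‖
  have hD : Continuous D := by
    have h1 : Continuous fun q : P × (E d × E d) => Ψ q.1 q.2.1 :=
      hΨ.comp (by fun_prop : Continuous fun q : P × (E d × E d) => (q.1, q.2.1))
    have h2 : Continuous fun q : P × (E d × E d) => Ψ p₀ q.2.2 :=
      hΨ.comp (by fun_prop : Continuous fun q : P × (E d × E d) => (p₀, q.2.2))
    exact (h1.sub h2).norm
  -- near the diagonal over the ball the difference is small by compactness; away from the diagonal
  -- the term `C ‖y' - y‖` dominates, and off the ball the indicator does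
  obtain ⟨u, V, hu, hV, hpu, hKV, huV⟩ := generalized_tube_lemma (s := {p₀}) (t := K)
    isCompact_singleton hKc (isOpen_lt hD continuous_const : IsOpen {q | D q < ε}) (by
      rintro ⟨p, z⟩ ⟨hp, y, hy, rfl⟩
      obtain rfl : p = p₀ := hp
      simpa [D] using hε)
  obtain ⟨δ, hδ, hδV⟩ := hKc.exists_thickening_subset_open hV hKV
  refine ⟨A * (2 + 2 * k) / δ + A, by positivity, ?_⟩
  filter_upwards [hA, hu.mem_nhds (hpu rfl)] with p hp hpu' y' y
  have hb : ‖Ψ p y' - Ψ p₀ y‖ ≤ A * (2 + 2 * ‖y‖) + A * ‖y' - y‖ := by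
    have h1 := hp y'
    have h2 := hA.self_of_nhds y
    have h3 : ‖y'‖ ≤ ‖y' - y‖ + ‖y‖ := by simpa using norm_add_le (y' - y) y
    calc _ ≤ ‖Ψ p y'‖ + ‖Ψ p₀ y‖ := norm_sub_le _ _
      _ ≤ A * (1 + (‖y' - y‖ + ‖y‖)) + A * (1 + ‖y‖) := by gcongr; exact h1.trans (by gcongr)
      _ = _ := by ring
  by_cases hy : ‖y‖ ≤ k
  · rw [indicator_of_notMem (by simpa using hy)]
    by_cases hd : ‖y' - y‖ < δ
    · have hm : ((y', y) : E d × E d) ∈ V := by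
        refine hδV (Metric.mem_thickening_iff.2 ⟨(y, y), ⟨y, by simpa using hy, rfl⟩, ?_⟩)
        simpa [Prod.dist_eq, dist_eq_norm] using hd
      have := huV (mk_mem_prod hpu' hm)
      have h2 : ‖Ψ p y' - Ψ p₀ y‖ < ε := this
      have : 0 ≤ (A * (2 + 2 * k) / δ + A) * ‖y' - y‖ := by positivity
      linarith
    · push Not at hd
      have : A * (2 + 2 * k) ≤ A * (2 + 2 * k) / δ * ‖y' - y‖ := by
        rw [div_mul_eq_mul_div, le_div_iff₀ hδ]; gcongr
      have h3 : A * (2 + 2 * ‖y‖) ≤ A * (2 + 2 * k) := by gcongr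
      rw [add_mul]; linarith
  · rw [indicator_of_mem (by simpa using hy)]
    have : 0 ≤ A * (2 + 2 * k) / δ * ‖y' - y‖ := by positivity
    rw [add_mul]; linarith

/-- Convergence in `W1` implies convergence of the integrals of jointly continuous integrands of
linear growth, also when the integrand depends on a convergent parameter. -/
theorem tendsto_integral_of_tendsto_W1 {ι P G : Type*} [TopologicalSpace P] [NormedAddCommGroup G]
    [NormedSpace ℝ G] {l : Filter ι} {m : ι → Measure (E d)} {m₀ : Measure (E d)}
    (hm : ∀ᶠ i in l, IsP1 (m i)) (hm₀ : IsP1 m₀) (hW : Tendsto (fun i => W1 (m i) m₀) l (𝓝 0))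
    {p : ι → P} {p₀ : P} (hp : Tendsto p l (𝓝 p₀))
    {Ψ : P → E d → G} (hΨ : Continuous (Function.uncurry Ψ)) {A : ℝ}
    (hA : ∀ᶠ p in 𝓝 p₀, ∀ y, ‖Ψ p y‖ ≤ A * (1 + ‖y‖)) :
    Tendsto (fun i => ∫ y, Ψ (p i) y ∂(m i)) l (𝓝 (∫ y, Ψ p₀ y ∂m₀)) := by
  have hA0 : 0 ≤ A := by
    have := (norm_nonneg _).trans (hA.self_of_nhds 0)
    simpa using this
  have hm0 := hm₀.1
  have hcont : ∀ q, Continuous (Ψ q) := fun q =>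
    hΨ.comp (by fun_prop : Continuous fun y : E d => (q, y))
  rw [Metric.tendsto_nhds]
  intro ε hε
  -- the radius `k` beyond which the first moment of `m₀` is negligible
  obtain ⟨k, hk0, hk⟩ : ∃ k : ℕ, (0 : ℝ) ≤ k ∧
      ∫ y, (Metric.closedBall (0 : E d) k)ᶜ.indicator (fun y => A * (2 + 2 * ‖y‖)) y ∂m₀
        < ε / 3 := by
    have hlim : Tendsto (fun k : ℕ => ∫ y, (Metric.closedBall (0 : E d) k)ᶜ.indicator
        (fun y => A * (2 + 2 * ‖y‖)) y ∂m₀) atTop (𝓝 (∫ _, (0 : ℝ) ∂m₀)) := by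
      refine tendsto_integral_of_dominated_convergence (fun y => A * (2 + 2 * ‖y‖)) ?_ ?_ ?_ ?_
      · exact fun k => (by fun_prop : Measurable fun y : E d => A * (2 + 2 * ‖y‖)).indicator
          Metric.isClosed_closedBall.measurableSet.compl |>.aestronglyMeasurable
      · exact ((integrable_const _).add (hm₀.integrable_norm.const_mul 2)).const_mul A
      · refine fun k => ae_of_all _ fun y => (norm_indicator_le_norm_self _ _).trans ?_
        rw [Real.norm_of_nonneg (by positivity)]
      · refine ae_of_all _ fun y => tendsto_const_nhds.congr' ?_
        filter_upwards [eventually_ge_atTop ⌈‖y‖⌉₊] with k hk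
        rw [indicator_of_notMem]
        simpa using (Nat.le_ceil _).trans (Nat.cast_le.2 hk)
    simp only [integral_zero] at hlim
    obtain ⟨k, hk⟩ := (hlim.eventually (gt_mem_nhds (by positivity : 0 < ε / 3))).exists
    exact ⟨k, by positivity, hk⟩
  obtain ⟨C, hC0, hC⟩ := exists_dist_le_of_linearGrowth hΨ hA0 hA (by positivity : 0 < ε / 3) hk0
  have hη : 0 < ε / (3 * (C + 1)) := by positivity
  filter_upwards [hm, hp.eventually hC, hp.eventually hA,
    hW.eventually (gt_mem_nhds (ENNReal.ofReal_pos.2 hη))] with i hi hCi hAi hWi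
  have hmi := hi.1
  -- both integrals are compared under a nearly optimal coupling `π`
  simp only [W1, iInf_lt_iff] at hWi
  obtain ⟨π, ⟨h1, h2⟩, hπ⟩ := hWi
  have hπp : IsProbabilityMeasure π := by
    constructor
    rw [← preimage_univ (f := Prod.fst), ← Measure.map_apply measurable_fst .univ, h1]
    exact measure_univ
  have hdist : Integrable (fun z : E d × E d => ‖z.1 - z.2‖) π := by
    refine ⟨by fun_prop, ?_⟩
    simp only [HasFiniteIntegral, enorm_norm, ← edist_eq_enorm_sub]
    exact hπ.trans ENNReal.ofReal_lt_top
  have hdist' : ∫ z, ‖z.1 - z.2‖ ∂π ≤ ε / (3 * (C + 1)) := by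
    rw [integral_eq_lintegral_of_nonneg_ae (ae_of_all _ fun _ => norm_nonneg _) (by fun_prop)]
    refine ENNReal.toReal_le_of_le_ofReal hη.le ?_
    simp only [ofReal_norm, ← edist_eq_enorm_sub]
    exact hπ.le
  have hI1 : Integrable (fun z : E d × E d => Ψ (p i) z.1) π := by
    have : Integrable (Ψ (p i)) (π.map Prod.fst) := h1 ▸ hi.integrable_of_le
      (hcont _).aestronglyMeasurable (A := A) (B := A) (fun y => (hAi y).trans (by linarith))
    exact this.comp_measurable measurable_fst
  have hI2 : Integrable (fun z : E d × E d => Ψ p₀ z.2) π := by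
    have : Integrable (Ψ p₀) (π.map Prod.snd) := h2 ▸ hm₀.integrable_of_le
      (hcont _).aestronglyMeasurable (A := A) (B := A)
      (fun y => (hA.self_of_nhds y).trans (by linarith))
    exact this.comp_measurable measurable_snd
  have e1 : ∫ y, Ψ (p i) y ∂(m i) = ∫ z, Ψ (p i) z.1 ∂π := by
    rw [← h1, integral_map measurable_fst.aemeasurable (hcont _).aestronglyMeasurable]
  have e2 : ∫ y, Ψ p₀ y ∂m₀ = ∫ z, Ψ p₀ z.2 ∂π := by
    rw [← h2, integral_map measurable_snd.aemeasurable (hcont _).aestronglyMeasurable]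
  set T : E d → ℝ := (Metric.closedBall (0 : E d) k)ᶜ.indicator (fun y => A * (2 + 2 * ‖y‖))
  have hTm : Measurable T := (by fun_prop : Measurable fun y : E d => A * (2 + 2 * ‖y‖)).indicator
          Metric.isClosed_closedBall.measurableSet.compl
  have hTi : Integrable T m₀ := by
    refine hm₀.integrable_of_le hTm.aestronglyMeasurable (A := A * 2) (B := A * 2) fun y => ?_
    refine (norm_indicator_le_norm_self _ _).trans ?_
    rw [Real.norm_of_nonneg (by positivity)]
    linarith
  have hI3 : Integrable (fun z : E d × E d => T z.2) π := by
    have : Integrable T (π.map Prod.snd) := h2 ▸ hTi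
    exact this.comp_measurable measurable_snd
  have e3 : ∫ z, T z.2 ∂π = ∫ y, T y ∂m₀ := by
    rw [← h2, integral_map measurable_snd.aemeasurable hTm.aestronglyMeasurable]
  rw [dist_eq_norm, e1, e2, ← integral_sub hI1 hI2]
  calc _ ≤ ∫ z, (ε / 3 + C * ‖z.1 - z.2‖ + T z.2) ∂π := by
        refine norm_integral_le_of_norm_le ?_ (ae_of_all _ fun z => hCi z.1 z.2)
        exact ((integrable_const _).add (hdist.const_mul C)).add hI3
    _ = ε / 3 + C * ∫ z, ‖z.1 - z.2‖ ∂π + ∫ y, T y ∂m₀ := by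
        have hi : Integrable (fun z : E d × E d => ε / 3 + C * ‖z.1 - z.2‖) π :=
          (integrable_const _).add (hdist.const_mul C)
        rw [integral_add hi hI3, integral_add (integrable_const _) (hdist.const_mul C), e3,
          integral_const_mul]
        simp
    _ < ε := by
        have : C * ∫ z, ‖z.1 - z.2‖ ∂π ≤ C * (ε / (3 * (C + 1))) := by gcongr
        have h4 : C * (ε / (3 * (C + 1))) ≤ ε / 3 := by
          rw [← mul_div_assoc, div_le_div_iff₀ (by positivity) (by positivity)]
          nlinarith
        linarith

theorem ContinuousP1On.mono {μ : ℝ → Measure (E d)} {I J : Set ℝ} (h : ContinuousP1On μ I)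
    (hJ : J ⊆ I) : ContinuousP1On μ J :=
  ⟨fun t ht => h.1 t (hJ ht), fun t ht => (h.2 t (hJ ht)).mono_left (nhdsWithin_mono _ hJ)⟩

/-- Integrals of a jointly continuous integrand of locally uniform linear growth against a
`W1`-continuous curve depend continuously on time and on the parameter. -/
theorem ContinuousP1On.continuousOn_integral {μ : ℝ → Measure (E d)} {I : Set ℝ}
    (h : ContinuousP1On μ I) {P G : Type*} [TopologicalSpace P] [NormedAddCommGroup G]
    [NormedSpace ℝ G] {Ψ : P → E d → G} (hΨ : Continuous (Function.uncurry Ψ))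
    (hA : ∀ p₀, ∃ A, ∀ᶠ p in 𝓝 p₀, ∀ y, ‖Ψ p y‖ ≤ A * (1 + ‖y‖)) :
    ContinuousOn (fun q : ℝ × P => ∫ y, Ψ q.2 y ∂(μ q.1)) (I ×ˢ univ) := by
  rintro ⟨t, p⟩ ⟨ht, -⟩
  obtain ⟨A, hA⟩ := hA p
  have h1 : Tendsto Prod.fst (𝓝[I ×ˢ univ] (t, p)) (𝓝[I] t) :=
    tendsto_nhdsWithin_iff.2 ⟨tendsto_fst.mono_left ((nhdsWithin_le_nhds).trans
      (nhds_prod_eq (x := t) (y := p)).le),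
      by filter_upwards [self_mem_nhdsWithin] with q hq using hq.1⟩
  have h2 : Tendsto Prod.snd (𝓝[I ×ˢ univ] (t, p)) (𝓝 p) :=
    (continuous_snd.tendsto (t, p)).mono_left nhdsWithin_le_nhds
  refine tendsto_integral_of_tendsto_W1 (m := fun q : ℝ × P => μ q.1) ?_ (h.1 t ht)
    ((h.2 t ht).comp h1) h2 hΨ hA
  filter_upwards [self_mem_nhdsWithin] with q hq using h.1 _ hq.1

theorem ContinuousP1On.continuousOn_moment {μ : ℝ → Measure (E d)} {I : Set ℝ}
    (h : ContinuousP1On μ I) : ContinuousOn (fun t => ∫ y, ‖y‖ ∂(μ t)) I := by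
  have := h.continuousOn_integral (P := Unit) (Ψ := fun _ y => ‖y‖) (by fun_prop)
    (fun _ => ⟨1, Eventually.of_forall fun _ y => by simp⟩)
  exact this.comp (f := fun t => (t, ())) (by fun_prop) (fun t ht => ⟨ht, trivial⟩)

theorem ContinuousP1On.exists_moment_le {μ : ℝ → Measure (E d)} {a b : ℝ}
    (h : ContinuousP1On μ (Icc a b)) : ∃ M, 0 ≤ M ∧ ∀ t ∈ Icc a b, ∫ y, ‖y‖ ∂(μ t) ≤ M := by
  obtain ⟨M, hM⟩ := isCompact_Icc.bddAbove_image h.continuousOn_moment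
  exact ⟨max M 0, le_max_right _ _, fun t ht => (hM ⟨t, ht, rfl⟩).trans (le_max_left _ _)⟩

/-- The push-forwards of one probability measure along a continuous family of maps with a common
bound form a `W1`-continuous curve. -/
theorem continuousP1On_map {Ω : Type*} [MeasurableSpace Ω] (P : Measure Ω) [IsProbabilityMeasure P]
    {u : ℝ → Ω → E d} (hm : ∀ t, Measurable (u t)) (hc : ∀ w, Continuous fun t => u t w) {ρ : ℝ}
    (hb : ∀ t w, ‖u t w‖ ≤ ρ) (I : Set ℝ) : ContinuousP1On (fun t => P.map (u t)) I := by
  refine ⟨fun t _ => isP1_map (hm t) ((integrable_const ρ).mono' (by fun_prop)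
    (ae_of_all _ fun w => by simpa using hb t w)), fun t _ => ?_⟩
  have hlim : Tendsto (fun s => ∫⁻ w, edist (u s w) (u t w) ∂P) (𝓝[I] t) (𝓝 (∫⁻ _, 0 ∂P)) := by
    refine tendsto_lintegral_filter_of_dominated_convergence
      (fun _ => ENNReal.ofReal (2 * ρ)) (Eventually.of_forall fun s => by fun_prop) ?_ ?_ ?_
    · refine Eventually.of_forall fun s => ae_of_all _ fun w => ?_
      rw [edist_dist]
      gcongr
      rw [dist_eq_norm]
      linarith [norm_sub_le (u s w) (u t w), hb s w, hb t w]
    · rw [lintegral_const, measure_univ, mul_one]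
      exact ENNReal.ofReal_ne_top
    · refine ae_of_all _ fun w => ?_
      have : Tendsto (fun s => edist (u s w) (u t w)) (𝓝 t) (𝓝 (edist (u t w) (u t w))) :=
        ((hc w).edist continuous_const).tendsto t
      simpa using this.mono_left nhdsWithin_le_nhds
  simp only [lintegral_zero] at hlim
  exact tendsto_of_tendsto_of_tendsto_of_le_of_le tendsto_const_nhds hlim (fun _ => zero_le)
    fun s => W1_map_le P (hm s) (hm t)

end

/-! ### The interaction forces -/

section

/-- The three properties of the interaction that the well-posedness proof uses: linear growth,
joint continuity along `W1`-continuous curves, and a Lipschitz estimate, on bounded sets, in the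
position and in the map transporting a fixed reference measure. -/
structure IsForce (F : Measure (E d) → E d → E d) : Prop where
  growth : ∃ C, 0 < C ∧ ∀ μ, IsP1 μ → ∀ x, ‖F μ x‖ ≤ C * (‖x‖ + ∫ y, ‖y‖ ∂μ)
  continuousOn : ∀ (μ : ℝ → Measure (E d)) (I : Set ℝ), ContinuousP1On μ I →
    ContinuousOn (fun q : ℝ × E d => F (μ q.1) q.2) (I ×ˢ univ)
  lipschitz : ∀ ρ M : ℝ, ∃ K, 0 ≤ K ∧ ∀ (P : Measure (E d)) (X Y : E d → E d) (δ : ℝ) (x x' : E d),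
    IsProbabilityMeasure P → Measurable X → Measurable Y →
    Integrable (fun w => ‖X w‖) P → Integrable (fun w => ‖Y w‖) P →
    ∫ w, ‖X w‖ ∂P ≤ M → ∫ w, ‖Y w‖ ∂P ≤ M → (∀ᵐ w ∂P, ‖X w - Y w‖ ≤ δ) →
    ‖x‖ ≤ ρ → ‖x'‖ ≤ ρ → ‖F (P.map X) x - F (P.map Y) x'‖ ≤ K * (‖x - x'‖ + δ)

section Kernel

variable {ψ : ℝ → ℝ} {L : ℝ≥0}

theorem continuous_weight (hψ : LipschitzOnWith L ψ (Ici 0)) :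
    Continuous fun p : E d × E d => ψ ‖p.1 - p.2‖ :=
  hψ.continuousOn.comp_continuous (by fun_prop) fun _ => norm_nonneg _

theorem continuous_kernel (hψ : LipschitzOnWith L ψ (Ici 0)) :
    Continuous (Function.uncurry fun x y : E d => ψ ‖x - y‖ • (y - x)) :=
  (continuous_weight hψ).smul (by fun_prop)

theorem norm_weight_le (hψ_pos : ∀ r, 0 ≤ r → 0 < ψ r) (hψ_anti : AntitoneOn ψ (Ici 0))
    (x y : E d) : ‖ψ ‖x - y‖‖ ≤ ψ 0 := by
  rw [Real.norm_of_nonneg (hψ_pos _ (norm_nonneg _)).le]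
  exact hψ_anti (mem_Ici.2 le_rfl) (norm_nonneg _) (norm_nonneg _)

theorem norm_kernel_le (hψ_pos : ∀ r, 0 ≤ r → 0 < ψ r) (hψ_anti : AntitoneOn ψ (Ici 0))
    (x y : E d) : ‖ψ ‖x - y‖ • (y - x)‖ ≤ ψ 0 * (‖x‖ + ‖y‖) := by
  rw [norm_smul]
  gcongr
  · exact (hψ_pos 0 le_rfl).le
  · exact norm_weight_le hψ_pos hψ_anti x y
  · linarith [norm_sub_le y x]

theorem abs_weight_sub_le (hψ : LipschitzOnWith L ψ (Ici 0)) (x y x' y' : E d) :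
    |ψ ‖x - y‖ - ψ ‖x' - y'‖| ≤ L * (‖x - x'‖ + ‖y - y'‖) := by
  have h1 := hψ.dist_le_mul _ (norm_nonneg (x - y)) _ (norm_nonneg (x' - y'))
  rw [Real.dist_eq, Real.dist_eq] at h1
  refine h1.trans ?_
  gcongr
  refine (abs_norm_sub_norm_le _ _).trans ?_
  rw [show x - y - (x' - y') = (x - x') - (y - y') by abel]
  exact norm_sub_le _ _

theorem norm_kernel_sub_le (hψ_pos : ∀ r, 0 ≤ r → 0 < ψ r) (hψ_anti : AntitoneOn ψ (Ici 0))
    (hψ : LipschitzOnWith L ψ (Ici 0)) (x y x' y' : E d) :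
    ‖ψ ‖x - y‖ • (y - x) - ψ ‖x' - y'‖ • (y' - x')‖ ≤
      (ψ 0 + L * (‖x'‖ + ‖y'‖)) * (‖x - x'‖ + ‖y - y'‖) := by
  have e : ψ ‖x - y‖ • (y - x) - ψ ‖x' - y'‖ • (y' - x') =
      ψ ‖x - y‖ • ((y - y') - (x - x')) + (ψ ‖x - y‖ - ψ ‖x' - y'‖) • (y' - x') := by
    module
  have h1 : ‖(y - y') - (x - x')‖ ≤ ‖x - x'‖ + ‖y - y'‖ := by
    linarith [norm_sub_le (y - y') (x - x')]
  have h2 : ‖y' - x'‖ ≤ ‖x'‖ + ‖y'‖ := by linarith [norm_sub_le y' x']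
  have hψ0 := (hψ_pos 0 le_rfl).le
  calc _ ≤ ‖ψ ‖x - y‖ • ((y - y') - (x - x'))‖ + ‖(ψ ‖x - y‖ - ψ ‖x' - y'‖) • (y' - x')‖ := by
        rw [e]; exact norm_add_le _ _
    _ ≤ ψ 0 * (‖x - x'‖ + ‖y - y'‖) +
        (L * (‖x - x'‖ + ‖y - y'‖)) * (‖x'‖ + ‖y'‖) := by
        rw [norm_smul, norm_smul]
        gcongr
        · exact norm_weight_le hψ_pos hψ_anti x y
        · exact abs_weight_sub_le hψ x y x' y'
    _ = _ := by ring

theorem kernel_linearGrowth (hψ_pos : ∀ r, 0 ≤ r → 0 < ψ r) (hψ_anti : AntitoneOn ψ (Ici 0))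
    (x₀ : E d) : ∃ A, ∀ᶠ x in 𝓝 x₀, ∀ y, ‖ψ ‖x - y‖ • (y - x)‖ ≤ A * (1 + ‖y‖) := by
  refine ⟨ψ 0 * (‖x₀‖ + 1), ?_⟩
  have hψ0 := (hψ_pos 0 le_rfl).le
  filter_upwards [continuous_norm.continuousAt.eventually (gt_mem_nhds (lt_add_one ‖x₀‖))]
    with x hx y
  refine (norm_kernel_le hψ_pos hψ_anti x y).trans ?_
  rw [mul_assoc]
  gcongr
  nlinarith [norm_nonneg y, norm_nonneg x₀, mul_nonneg (norm_nonneg x₀) (norm_nonneg y)]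

theorem integrable_weight (hψ_pos : ∀ r, 0 ≤ r → 0 < ψ r) (hψ_anti : AntitoneOn ψ (Ici 0))
    (hψ : LipschitzOnWith L ψ (Ici 0)) {μ : Measure (E d)} (hμ : IsP1 μ) (x : E d) :
    Integrable (fun y => ψ ‖x - y‖) μ :=
  hμ.integrable_of_le (A := ψ 0) (B := 0)
    ((continuous_weight hψ).comp (by fun_prop : Continuous fun y : E d => (x, y))
      ).aestronglyMeasurable fun y => by simpa using norm_weight_le hψ_pos hψ_anti x y

theorem integrable_kernel (hψ_pos : ∀ r, 0 ≤ r → 0 < ψ r) (hψ_anti : AntitoneOn ψ (Ici 0))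
    (hψ : LipschitzOnWith L ψ (Ici 0)) {μ : Measure (E d)} (hμ : IsP1 μ) (x : E d) :
    Integrable (fun y => ψ ‖x - y‖ • (y - x)) μ :=
  hμ.integrable_of_le (A := ψ 0 * ‖x‖) (B := ψ 0)
    ((continuous_kernel hψ).comp (by fun_prop : Continuous fun y : E d => (x, y))
      ).aestronglyMeasurable
    fun y => (norm_kernel_le hψ_pos hψ_anti x y).trans_eq (mul_add _ _ _)

theorem norm_forceSymm_le (hψ_pos : ∀ r, 0 ≤ r → 0 < ψ r) (hψ_anti : AntitoneOn ψ (Ici 0))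
    {μ : Measure (E d)} (hμ : IsP1 μ) (x : E d) :
    ‖forceSymm ψ μ x‖ ≤ ψ 0 * (‖x‖ + ∫ y, ‖y‖ ∂μ) := by
  have := hμ.1
  refine (norm_integral_le_of_norm_le (((integrable_const _).add hμ.integrable_norm).const_mul _)
    (ae_of_all _ (norm_kernel_le hψ_pos hψ_anti x))).trans_eq ?_
  rw [integral_const_mul, integral_add' (integrable_const _) hμ.integrable_norm]
  simp

/-- The mass seen from `x` is bounded below: by Markov's inequality at least half of the mass of `μ`
lies in a ball whose radius is controlled by the first moment. -/
theorem half_le_integral_weight (hψ_pos : ∀ r, 0 ≤ r → 0 < ψ r) (hψ_anti : AntitoneOn ψ (Ici 0))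
    (hψ : LipschitzOnWith L ψ (Ici 0)) {μ : Measure (E d)} (hμ : IsP1 μ) {M ρ : ℝ}
    (hM : ∫ y, ‖y‖ ∂μ ≤ M) {x : E d} (hx : ‖x‖ ≤ ρ) :
    ψ (ρ + 2 * (M + 1)) / 2 ≤ ∫ y, ψ ‖x - y‖ ∂μ := by
  have := hμ.1
  have hM0 : 0 ≤ M := (integral_nonneg fun _ => norm_nonneg _).trans hM
  have hρ0 : 0 ≤ ρ := (norm_nonneg _).trans hx
  set r := ρ + 2 * (M + 1) with hr
  have hr0 : 0 ≤ r := by positivity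
  -- pointwise, `ψ ‖x - y‖ ≥ ψ r (1 - ‖y‖ / (2 (M + 1)))`
  have hpt : ∀ y : E d, ψ r * (1 - ‖y‖ / (2 * (M + 1))) ≤ ψ ‖x - y‖ := by
    intro y
    by_cases hy : ‖y‖ ≤ 2 * (M + 1)
    · have h1 : ψ r ≤ ψ ‖x - y‖ := hψ_anti (norm_nonneg _) hr0 (by linarith [norm_sub_le x y])
      have h2 : 0 ≤ ‖y‖ / (2 * (M + 1)) := by positivity
      nlinarith [hψ_pos r hr0]
    · push Not at hy
      have h2 : 1 ≤ ‖y‖ / (2 * (M + 1)) := by rw [one_le_div (by positivity)]; exact hy.le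
      nlinarith [hψ_pos r hr0, hψ_pos ‖x - y‖ (norm_nonneg _)]
  have hi : Integrable (fun y : E d => ‖y‖ / (2 * (M + 1))) μ := hμ.integrable_norm.div_const _
  have h := integral_mono (((integrable_const (1 : ℝ)).sub hi).const_mul (ψ r))
    (integrable_weight hψ_pos hψ_anti hψ hμ x) hpt
  rw [integral_const_mul, integral_sub' (integrable_const _) hi, integral_div, integral_const,
    probReal_univ, one_smul] at h
  refine le_trans ?_ h
  have h3 : (∫ y, ‖y‖ ∂μ) / (2 * (M + 1)) ≤ 1 / 2 := by
    rw [div_le_div_iff₀ (by positivity) (by positivity)]; linarith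
  nlinarith [hψ_pos r hr0]

theorem integral_weight_pos (hψ_pos : ∀ r, 0 ≤ r → 0 < ψ r) (hψ_anti : AntitoneOn ψ (Ici 0))
    (hψ : LipschitzOnWith L ψ (Ici 0)) {μ : Measure (E d)} (hμ : IsP1 μ) (x : E d) :
    0 < ∫ y, ψ ‖x - y‖ ∂μ := by
  refine lt_of_lt_of_le ?_ (half_le_integral_weight hψ_pos hψ_anti hψ hμ le_rfl (le_refl ‖x‖))
  have := hψ_pos (‖x‖ + 2 * (∫ y, ‖y‖ ∂μ + 1))
    (by have : 0 ≤ ∫ y, ‖y‖ ∂μ := integral_nonneg fun _ => norm_nonneg _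
        positivity)
  linarith

/-- Chebyshev's association inequality: the weights `ψ ‖x - y‖` decrease in `‖x - y‖`, so the
weighted mean distance to `x` is at most the unweighted one. -/
theorem norm_forceNonsymm_le (hψ_pos : ∀ r, 0 ≤ r → 0 < ψ r) (hψ_anti : AntitoneOn ψ (Ici 0))
    (hψ : LipschitzOnWith L ψ (Ici 0)) {μ : Measure (E d)} (hμ : IsP1 μ) (x : E d) :
    ‖forceNonsymm ψ μ x‖ ≤ ‖x‖ + ∫ y, ‖y‖ ∂μ := by
  have := hμ.1
  have hD := integral_weight_pos hψ_pos hψ_anti hψ hμ x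
  have hi : Integrable (fun y => ‖x - y‖) μ := hμ.integrable_of_le (A := ‖x‖) (B := 1)
    (by fun_prop) fun y => by simpa using norm_sub_le x y
  have hwi := integrable_weight hψ_pos hψ_anti hψ hμ x
  have hki : Integrable (fun y => ψ ‖x - y‖ * ‖x - y‖) μ := by
    refine (integrable_kernel hψ_pos hψ_anti hψ hμ x).norm.congr (ae_of_all _ fun y => ?_)
    simp only [norm_smul]
    rw [Real.norm_of_nonneg (hψ_pos _ (norm_nonneg _)).le, norm_sub_rev]
  set r₀ := ∫ y, ‖x - y‖ ∂μ with hr₀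
  have hr₀0 : 0 ≤ r₀ := integral_nonneg fun _ => norm_nonneg _
  -- this rearranges to `(ψ ‖x - y‖ - ψ r₀) (‖x - y‖ - r₀) ≤ 0`
  have hpt : ∀ y : E d, ψ ‖x - y‖ * ‖x - y‖ ≤
      r₀ * ψ ‖x - y‖ + ψ r₀ * (‖x - y‖ - r₀) := by
    intro y
    rcases le_total ‖x - y‖ r₀ with h | h
    · have := hψ_anti (norm_nonneg (x - y)) hr₀0 h
      nlinarith
    · have := hψ_anti hr₀0 (norm_nonneg (x - y)) h
      nlinarith
  have h := integral_mono hki ((hwi.const_mul r₀).add ((hi.sub (integrable_const r₀)).const_mul _))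
    hpt
  rw [integral_add' (hwi.const_mul r₀) ((hi.sub (integrable_const r₀)).const_mul _),
    integral_const_mul, integral_const_mul, integral_sub' hi (integrable_const r₀), integral_const,
    probReal_univ, one_smul, ← hr₀, sub_self, mul_zero, add_zero] at h
  have h2 : ‖∫ y, ψ ‖x - y‖ • (y - x) ∂μ‖ ≤ r₀ * ∫ y, ψ ‖x - y‖ ∂μ := by
    refine (norm_integral_le_of_norm_le hki (ae_of_all _ fun y => ?_)).trans h
    rw [norm_smul, Real.norm_of_nonneg (hψ_pos _ (norm_nonneg _)).le, norm_sub_rev]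
  have h3 : r₀ ≤ ‖x‖ + ∫ y, ‖y‖ ∂μ := by
    have := integral_mono hi ((integrable_const ‖x‖).add hμ.integrable_norm)
      (fun y => norm_sub_le x y)
    rw [integral_add' (integrable_const _) hμ.integrable_norm] at this
    simpa using this
  rw [forceNonsymm, norm_smul, norm_inv, Real.norm_of_nonneg hD.le, inv_mul_le_iff₀ hD]
  calc _ ≤ _ := h2
    _ ≤ _ := by rw [mul_comm]; gcongr

/-- Lipschitz dependence of the unnormalized force on the position and on the transport map. -/
theorem norm_forceSymm_map_sub_le (hψ_pos : ∀ r, 0 ≤ r → 0 < ψ r)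
    (hψ_anti : AntitoneOn ψ (Ici 0)) (hψ : LipschitzOnWith L ψ (Ici 0)) {ρ M : ℝ}
    {P : Measure (E d)} [IsProbabilityMeasure P] {X Y : E d → E d} {δ : ℝ} {x x' : E d}
    (hX : Measurable X) (hY : Measurable Y) (hXi : Integrable (fun w => ‖X w‖) P)
    (hYi : Integrable (fun w => ‖Y w‖) P) (hYM : ∫ w, ‖Y w‖ ∂P ≤ M)
    (hd : ∀ᵐ w ∂P, ‖X w - Y w‖ ≤ δ) (hx' : ‖x'‖ ≤ ρ) :
    ‖forceSymm ψ (P.map X) x - forceSymm ψ (P.map Y) x'‖ ≤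
      (ψ 0 + L * (ρ + M)) * (‖x - x'‖ + δ) := by
  have hc : ∀ x : E d, Continuous fun y : E d => ψ ‖x - y‖ • (y - x) := fun x =>
    (hψ.continuousOn.comp_continuous (by fun_prop) fun _ => norm_nonneg _).smul (by fun_prop)
  have hψ0 := (hψ_pos 0 le_rfl).le
  have hδ : 0 ≤ δ := by
    obtain ⟨w, hw⟩ := hd.exists
    exact (norm_nonneg _).trans hw
  unfold forceSymm
  have j1 := integrable_kernel hψ_pos hψ_anti hψ (isP1_map hX hXi) x
  have j2 := integrable_kernel hψ_pos hψ_anti hψ (isP1_map hY hYi) x'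
  have i1 : Integrable (fun w => ψ ‖x - X w‖ • (X w - x)) P :=
    j1.comp_measurable hX
  have i2 : Integrable (fun w => ψ ‖x' - Y w‖ • (Y w - x')) P :=
    j2.comp_measurable hY
  rw [integral_map hX.aemeasurable (hc x).aestronglyMeasurable,
    integral_map hY.aemeasurable (hc x').aestronglyMeasurable, ← integral_sub i1 i2]
  have hi : Integrable (fun w => (ψ 0 + L * (ρ + ‖Y w‖)) * (‖x - x'‖ + δ)) P :=
    ((integrable_const _).add (((integrable_const _).add hYi).const_mul _)).mul_const _
  refine (norm_integral_le_of_norm_le hi ?_).trans ?_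
  · filter_upwards [hd] with w hw
    have hρ : 0 ≤ ρ := (norm_nonneg _).trans hx'
    have h0 : 0 ≤ ψ 0 + L * (ρ + ‖Y w‖) := by positivity
    refine (norm_kernel_sub_le hψ_pos hψ_anti hψ x (X w) x' (Y w)).trans ?_
    gcongr
  · rw [integral_mul_const]
    gcongr
    have h1 : Integrable (fun w => (L : ℝ) * (ρ + ‖Y w‖)) P :=
      ((integrable_const _).add hYi).const_mul _
    rw [integral_add (integrable_const _) h1, integral_const_mul,
      integral_add (integrable_const _) hYi]
    simp only [integral_const, probReal_univ, smul_eq_mul, one_mul]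
    gcongr

/-- The normalizing factor is Lipschitz in the position and in the transport map. -/
theorem abs_integral_weight_map_sub_le (hψ_pos : ∀ r, 0 ≤ r → 0 < ψ r)
    (hψ_anti : AntitoneOn ψ (Ici 0)) (hψ : LipschitzOnWith L ψ (Ici 0))
    {P : Measure (E d)} [IsProbabilityMeasure P] {X Y : E d → E d} {δ : ℝ} {x x' : E d}
    (hX : Measurable X) (hY : Measurable Y) (hXi : Integrable (fun w => ‖X w‖) P)
    (hYi : Integrable (fun w => ‖Y w‖) P) (hd : ∀ᵐ w ∂P, ‖X w - Y w‖ ≤ δ) :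
    |(∫ y, ψ ‖x - y‖ ∂(P.map X)) - ∫ y, ψ ‖x' - y‖ ∂(P.map Y)| ≤ L * (‖x - x'‖ + δ) := by
  have hc : ∀ x : E d, Continuous fun y : E d => ψ ‖x - y‖ := fun x =>
    hψ.continuousOn.comp_continuous (by fun_prop) fun _ => norm_nonneg _
  have j1 := integrable_weight hψ_pos hψ_anti hψ (isP1_map hX hXi) x
  have j2 := integrable_weight hψ_pos hψ_anti hψ (isP1_map hY hYi) x'
  have i1 : Integrable (fun w => ψ ‖x - X w‖) P :=
    j1.comp_measurable hX
  have i2 : Integrable (fun w => ψ ‖x' - Y w‖) P :=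
    j2.comp_measurable hY
  rw [integral_map hX.aemeasurable (hc x).aestronglyMeasurable,
    integral_map hY.aemeasurable (hc x').aestronglyMeasurable, ← integral_sub i1 i2,
    ← Real.norm_eq_abs]
  refine (norm_integral_le_of_norm_le (integrable_const (L * (‖x - x'‖ + δ))) ?_).trans_eq
    (by simp)
  filter_upwards [hd] with w hw
  refine (abs_weight_sub_le hψ x (X w) x' (Y w)).trans ?_
  gcongr

theorem isForce_forceSymm (hψ_pos : ∀ r, 0 ≤ r → 0 < ψ r) (hψ_anti : AntitoneOn ψ (Ici 0))
    (hψ : LipschitzOnWith L ψ (Ici 0)) : IsForce (d := d) (forceSymm ψ) where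
  growth := ⟨ψ 0, hψ_pos 0 le_rfl, fun _ hμ x => norm_forceSymm_le hψ_pos hψ_anti hμ x⟩
  continuousOn _ _ h :=
    h.continuousOn_integral (continuous_kernel hψ) (kernel_linearGrowth hψ_pos hψ_anti)
  lipschitz ρ M := by
    refine ⟨ψ 0 + L * (|ρ| + |M|), by have := hψ_pos 0 le_rfl; positivity,
      fun P X Y δ x x' hP hX hY hXi hYi _ hYM hd _ hx' => ?_⟩
    exact norm_forceSymm_map_sub_le hψ_pos hψ_anti hψ hX hY hXi hYi (hYM.trans (le_abs_self M))
      hd (hx'.trans (le_abs_self ρ))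

theorem isForce_forceNonsymm (hψ_pos : ∀ r, 0 ≤ r → 0 < ψ r) (hψ_anti : AntitoneOn ψ (Ici 0))
    (hψ : LipschitzOnWith L ψ (Ici 0)) : IsForce (d := d) (forceNonsymm ψ) where
  growth := ⟨1, one_pos, fun _ hμ x => by
    simpa using norm_forceNonsymm_le hψ_pos hψ_anti hψ hμ x⟩
  continuousOn μ I h := by
    refine ContinuousOn.smul (ContinuousOn.inv₀ ?_ fun q hq =>
      (integral_weight_pos hψ_pos hψ_anti hψ (h.1 _ hq.1) q.2).ne')
      (h.continuousOn_integral (continuous_kernel hψ) (kernel_linearGrowth hψ_pos hψ_anti))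
    refine h.continuousOn_integral (Ψ := fun x y : E d => ψ ‖x - y‖) (continuous_weight hψ)
      fun _ => ⟨ψ 0, Eventually.of_forall fun x y => ?_⟩
    refine (norm_weight_le hψ_pos hψ_anti x y).trans ?_
    nlinarith [hψ_pos 0 le_rfl, mul_nonneg (hψ_pos 0 le_rfl).le (norm_nonneg y)]
  lipschitz ρ' M' := by
    set ρ := |ρ'|
    set M := |M'|
    have hρ : 0 ≤ ρ := abs_nonneg _
    have hM : 0 ≤ M := abs_nonneg _
    set c := ψ (ρ + 2 * (M + 1)) / 2 with hc
    have hc0 : 0 < c := by have := hψ_pos (ρ + 2 * (M + 1)) (by positivity); positivity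
    have hψ0 := hψ_pos 0 le_rfl
    refine ⟨c⁻¹ * (ψ 0 + L * (ρ + M) + L * (ρ + M)), by positivity,
      fun P X Y δ x x' hP hX hY hXi hYi hXM hYM hd hx hx' => ?_⟩
    replace hx := hx.trans (le_abs_self ρ')
    replace hx' := hx'.trans (le_abs_self ρ')
    replace hXM := hXM.trans (le_abs_self M')
    replace hYM := hYM.trans (le_abs_self M')
    have hδ : 0 ≤ δ := by
      obtain ⟨w, hw⟩ := hd.exists
      exact (norm_nonneg _).trans hw
    have hmX := isP1_map hX hXi
    have hmY := isP1_map hY hYi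
    have eY : ∫ y, ‖y‖ ∂(P.map Y) = ∫ w, ‖Y w‖ ∂P :=
      integral_map hY.aemeasurable (by fun_prop)
    have eX : ∫ y, ‖y‖ ∂(P.map X) = ∫ w, ‖X w‖ ∂P :=
      integral_map hX.aemeasurable (by fun_prop)
    have hD : c ≤ ∫ y, ψ ‖x - y‖ ∂(P.map X) :=
      half_le_integral_weight hψ_pos hψ_anti hψ hmX (eX.trans_le hXM) hx
    have hD' : 0 < ∫ y, ψ ‖x' - y‖ ∂(P.map Y) := integral_weight_pos hψ_pos hψ_anti hψ hmY x'
    have hN := norm_forceSymm_map_sub_le (x := x) hψ_pos hψ_anti hψ hX hY hXi hYi hYM hd hx'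
    have hW := abs_integral_weight_map_sub_le (x := x) (x' := x') hψ_pos hψ_anti hψ hX hY hXi hYi hd
    have hG := norm_forceNonsymm_le hψ_pos hψ_anti hψ hmY x'
    rw [eY] at hG
    unfold forceNonsymm at hG ⊢
    unfold forceSymm at hN
    set D := ∫ y, ψ ‖x - y‖ ∂(P.map X)
    set D' := ∫ y, ψ ‖x' - y‖ ∂(P.map Y)
    set N := ∫ y, ψ ‖x - y‖ • (y - x) ∂(P.map X)
    set N' := ∫ y, ψ ‖x' - y‖ • (y - x') ∂(P.map Y)
    have hD0 : 0 < D := hc0.trans_le hD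
    -- the quotient `N' / D'` has a bound without `ψ`, so a lower bound on `D` alone suffices
    have e : D⁻¹ • N - D'⁻¹ • N' = D⁻¹ • ((N - N') - (D - D') • (D'⁻¹ • N')) := by
      rw [smul_sub, smul_sub, sub_smul, smul_sub, smul_inv_smul₀ hD'.ne', inv_smul_smul₀ hD0.ne']
      abel
    rw [e, norm_smul, norm_inv, Real.norm_of_nonneg hD0.le, mul_assoc]
    have h1 : ‖(N - N') - (D - D') • (D'⁻¹ • N')‖ ≤
        (ψ 0 + L * (ρ + M)) * (‖x - x'‖ + δ) + (L * (‖x - x'‖ + δ)) * (ρ + M) := by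
      refine (norm_sub_le _ _).trans (add_le_add hN ?_)
      rw [norm_smul, Real.norm_eq_abs]
      gcongr
      exact hG.trans (by gcongr)
    calc _ ≤ c⁻¹ * ((ψ 0 + L * (ρ + M)) * (‖x - x'‖ + δ) + (L * (‖x - x'‖ + δ)) * (ρ + M)) := by
          gcongr
      _ = _ := by ring

end Kernel

end

/-! ### The delay and the velocity field -/

section

/-- A locally Lipschitz function on `[0, ∞)` with non-positive derivative a.e. is non-increasing. -/
theorem antitoneOn_of_ae_deriv_nonpos {τ : ℝ → ℝ}
    (hτ_lip : ∀ T : ℝ, 0 < T → ∃ K : ℝ≥0, LipschitzOnWith K τ (Icc 0 T))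
    (hτ_deriv : ∀ᵐ t ∂(volume.restrict (Ici (0 : ℝ))), deriv τ t ≤ 0) : AntitoneOn τ (Ici 0) := by
  intro a ha b hb hab
  -- the derivative of a Lipschitz function integrates back to its increments
  obtain ⟨K, hK⟩ := hτ_lip (b + 1) (by linarith [mem_Ici.1 hb])
  have hsub : uIcc a b ⊆ Icc 0 (b + 1) := by
    rw [uIcc_of_le hab]
    exact Icc_subset_Icc ha (by linarith)
  have hac := (hK.mono hsub).absolutelyContinuousOnInterval
  have h1 := hac.integral_deriv_eq_sub
  have h2 : ∫ t in a..b, deriv τ t ≤ 0 := by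
    rw [intervalIntegral.integral_of_le hab]
    refine integral_nonpos_of_ae ?_
    exact ae_restrict_of_ae_restrict_of_subset (fun t ht => (mem_Ici.1 ha).trans ht.1.le) hτ_deriv
  linarith

/-- The properties of the delay `τ` and the weight `α` that the well-posedness proof uses. -/
structure IsDelay (α τ : ℝ → ℝ) : Prop where
  continuousOn : ContinuousOn τ (Ici 0)
  pos : ∀ t, 0 ≤ t → 0 < τ t
  le : ∀ t, 0 ≤ t → τ t ≤ τ 0
  nonneg : ∀ s ∈ Icc 0 (τ 0), 0 ≤ α s
  integrableOn : IntegrableOn α (Icc 0 (τ 0))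
  h_pos : ∀ t, 0 ≤ t → 0 < h α τ t

variable {α τ : ℝ → ℝ} {F : Measure (E d) → E d → E d} {g μ ν : ℝ → Measure (E d)}

/-- The velocity field as an integral over the age `r = t - s`. -/
theorem velocity_eq (t : ℝ) (x : E d) : velocity α τ F g μ t x =
    (h α τ t)⁻¹ • ∫ r in (0 : ℝ)..τ t, α r • F (withHistory g μ (t - r)) x := by
  rw [velocity]
  congr 1
  have := intervalIntegral.integral_comp_sub_left
    (fun s => α (t - s) • F (withHistory g μ s) x) t (a := 0) (b := τ t)
  simpa using this.symm

theorem IsDelay.integrableOn_Ioc (hD : IsDelay α τ) {t : ℝ} (ht : 0 ≤ t) :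
    IntegrableOn α (Ioc 0 (τ t)) :=
  hD.integrableOn.mono_set (Ioc_subset_Icc_self.trans (Icc_subset_Icc_right (hD.le t ht)))

/-- A weighted average of vectors of norm at most `B` has norm at most `B`. -/
theorem IsDelay.norm_average_le (hD : IsDelay α τ) {t : ℝ} (ht : 0 ≤ t) {f : ℝ → E d} {B : ℝ}
    (hf : ∀ r ∈ Ioc 0 (τ t), ‖f r‖ ≤ B) :
    ‖(h α τ t)⁻¹ • ∫ r in (0 : ℝ)..τ t, α r • f r‖ ≤ B := by
  have hh := hD.h_pos t ht
  rw [norm_smul, norm_inv, Real.norm_of_nonneg hh.le, inv_mul_le_iff₀ hh, h,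
    intervalIntegral.integral_of_le (hD.pos t ht).le, intervalIntegral.integral_of_le
    (hD.pos t ht).le, ← integral_mul_const]
  refine norm_integral_le_of_norm_le ((hD.integrableOn_Ioc ht).mul_const B) ?_
  filter_upwards [ae_restrict_mem measurableSet_Ioc] with r hr
  have hα := hD.nonneg r ⟨hr.1.le, hr.2.trans (hD.le t ht)⟩
  rw [norm_smul, Real.norm_of_nonneg hα]
  gcongr
  exact hf r hr

theorem norm_velocity_le (hD : IsDelay α τ) {t : ℝ} (ht : 0 ≤ t) {x : E d} {B : ℝ}
    (hB : ∀ s ∈ Ico (t - τ t) t, ‖F (withHistory g μ s) x‖ ≤ B) :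
    ‖velocity α τ F g μ t x‖ ≤ B := by
  rw [velocity_eq]
  exact hD.norm_average_le ht fun r hr => hB _ ⟨by linarith [hr.2], by linarith [hr.1]⟩

theorem withHistory_of_neg {s : ℝ} (hs : s < 0) : withHistory g μ s = g s := if_pos hs

theorem withHistory_of_nonneg {s : ℝ} (hs : 0 ≤ s) : withHistory g μ s = μ s := if_neg hs.not_gt

theorem isP1_withHistory {S : ℝ} (hg : ContinuousP1On g (Icc (-τ 0) 0))
    (hμ : ContinuousP1On μ (Icc 0 S)) {s : ℝ} (hs : s ∈ Icc (-τ 0) S) :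
    IsP1 (withHistory g μ s) := by
  rcases lt_or_ge s 0 with h | h
  · rw [withHistory_of_neg h]; exact hg.1 _ ⟨hs.1, h.le⟩
  · rw [withHistory_of_nonneg h]; exact hμ.1 _ ⟨h, hs.2⟩

theorem exists_moment_withHistory_le {S : ℝ} (hg : ContinuousP1On g (Icc (-τ 0) 0))
    (hμ : ContinuousP1On μ (Icc 0 S)) :
    ∃ M, 0 ≤ M ∧ ∀ s ∈ Icc (-τ 0) S, ∫ y, ‖y‖ ∂(withHistory g μ s) ≤ M := by
  obtain ⟨M₁, h₁, hM₁⟩ := hg.exists_moment_le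
  obtain ⟨M₂, -, hM₂⟩ := hμ.exists_moment_le
  refine ⟨max M₁ M₂, h₁.trans (le_max_left _ _), fun s hs => ?_⟩
  rcases lt_or_ge s 0 with h | h
  · rw [withHistory_of_neg h]; exact (hM₁ _ ⟨hs.1, h.le⟩).trans (le_max_left _ _)
  · rw [withHistory_of_nonneg h]; exact (hM₂ _ ⟨h, hs.2⟩).trans (le_max_right _ _)

theorem IsDelay.sub_mem (hD : IsDelay α τ) {S t : ℝ} (ht : t ∈ Icc 0 S) {s : ℝ}
    (hs : s ∈ Ico (t - τ t) t) : s ∈ Icc (-τ 0) S :=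
  ⟨by linarith [hs.1, hD.le t ht.1, ht.1], hs.2.le.trans ht.2⟩

theorem aestronglyMeasurable_force (hF : IsForce F) (hD : IsDelay α τ) {S : ℝ}
    (hg : ContinuousP1On g (Icc (-τ 0) 0)) (hμ : ContinuousP1On μ (Icc 0 S)) {t : ℝ}
    (ht : t ∈ Icc 0 S) (x : E d) :
    AEStronglyMeasurable (fun r => F (withHistory g μ (t - r)) x)
      (volume.restrict (Ioc 0 (τ t))) := by
  have hu : Ioc 0 (τ t) = (Ioc 0 (τ t) ∩ Ioi t) ∪ (Ioc 0 (τ t) ∩ Iic t) := by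
    rw [← inter_union_distrib_left, Ioi_union_Iic, inter_univ]
  rw [hu, aestronglyMeasurable_union_iff]
  constructor
  · refine ContinuousOn.aestronglyMeasurable ?_ (measurableSet_Ioc.inter measurableSet_Ioi)
    have h1 := (hF.continuousOn g _ hg).comp (f := fun r : ℝ => (t - r, x))
      (s := Ioc 0 (τ t) ∩ Ioi t) (by fun_prop) (fun r hr => ⟨⟨by
        linarith [hr.1.2, hD.le t ht.1, ht.1], by linarith [mem_Ioi.1 hr.2]⟩, trivial⟩)
    refine h1.congr fun r hr => ?_
    simp only [Function.comp]
    rw [withHistory_of_neg (by linarith [mem_Ioi.1 hr.2])]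
  · refine ContinuousOn.aestronglyMeasurable ?_ (measurableSet_Ioc.inter measurableSet_Iic)
    have h1 := (hF.continuousOn μ _ hμ).comp (f := fun r : ℝ => (t - r, x))
      (s := Ioc 0 (τ t) ∩ Iic t) (by fun_prop) (fun r hr => ⟨⟨by
        linarith [mem_Iic.1 hr.2], by linarith [hr.1.1, ht.2]⟩, trivial⟩)
    refine h1.congr fun r hr => ?_
    simp only [Function.comp]
    rw [withHistory_of_nonneg (by linarith [mem_Iic.1 hr.2])]

theorem integrableOn_force (hF : IsForce F) (hD : IsDelay α τ) {S : ℝ}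
    (hg : ContinuousP1On g (Icc (-τ 0) 0)) (hμ : ContinuousP1On μ (Icc 0 S)) {t : ℝ}
    (ht : t ∈ Icc 0 S) (x : E d) :
    IntegrableOn (fun r => α r • F (withHistory g μ (t - r)) x) (Ioc 0 (τ t)) := by
  obtain ⟨C, hC, hgr⟩ := hF.growth
  obtain ⟨M, hM0, hM⟩ := exists_moment_withHistory_le hg hμ
  have hα := hD.integrableOn_Ioc ht.1
  refine (hα.norm.mul_const (C * (‖x‖ + M))).mono'
    (hα.aestronglyMeasurable.smul (aestronglyMeasurable_force hF hD hg hμ ht x)) ?_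
  filter_upwards [ae_restrict_mem measurableSet_Ioc] with r hr
  have hs := hD.sub_mem (s := t - r) ht ⟨by linarith [hr.2], by linarith [hr.1]⟩
  rw [norm_smul]
  gcongr
  exact (hgr _ (isP1_withHistory hg hμ hs) x).trans (by gcongr; exact hM _ hs)

/-- Since the weights `α / h` have total mass one, a bound on the difference of the forces at each
earlier time bounds the difference of the velocities. -/
theorem norm_velocity_sub_le (hF : IsForce F) (hD : IsDelay α τ) {S : ℝ}
    (hg : ContinuousP1On g (Icc (-τ 0) 0)) (hμ : ContinuousP1On μ (Icc 0 S))
    (hν : ContinuousP1On ν (Icc 0 S)) {t : ℝ} (ht : t ∈ Icc 0 S) {x x' : E d} {B : ℝ}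
    (hB : ∀ s ∈ Ico (t - τ t) t, ‖F (withHistory g μ s) x - F (withHistory g ν s) x'‖ ≤ B) :
    ‖velocity α τ F g μ t x - velocity α τ F g ν t x'‖ ≤ B := by
  have hle := (hD.pos t ht.1).le
  have i1 : IntervalIntegrable (fun r => α r • F (withHistory g μ (t - r)) x) volume 0 (τ t) :=
    (intervalIntegrable_iff_integrableOn_Ioc_of_le hle).2 (integrableOn_force hF hD hg hμ ht x)
  have i2 : IntervalIntegrable (fun r => α r • F (withHistory g ν (t - r)) x') volume 0 (τ t) :=
    (intervalIntegrable_iff_integrableOn_Ioc_of_le hle).2 (integrableOn_force hF hD hg hν ht x')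
  rw [velocity_eq, velocity_eq, ← smul_sub, ← intervalIntegral.integral_sub i1 i2]
  simp only [← smul_sub]
  exact hD.norm_average_le ht.1 fun r hr => hB _ ⟨by linarith [hr.2], by linarith [hr.1]⟩

/-- Linear growth of the velocity field at time `t`, with a constant that involves the moments
before time `t` only. -/
theorem norm_velocity_le_of_moment_le (hD : IsDelay α τ) {S : ℝ}
    (hg : ContinuousP1On g (Icc (-τ 0) 0)) (hμ : ContinuousP1On μ (Icc 0 S)) {C : ℝ}
    (hC : 0 < C) (hgr : ∀ μ, IsP1 μ → ∀ x : E d, ‖F μ x‖ ≤ C * (‖x‖ + ∫ y, ‖y‖ ∂μ)) {M t : ℝ}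
    (ht : t ∈ Icc 0 S) (hM : ∀ s ∈ Ico (-τ 0) t, ∫ y, ‖y‖ ∂(withHistory g μ s) ≤ M) (x : E d) :
    ‖velocity α τ F g μ t x‖ ≤ C * (‖x‖ + M) := by
  refine norm_velocity_le hD ht.1 fun s hs => ?_
  have hs' := hD.sub_mem ht hs
  exact (hgr _ (isP1_withHistory hg hμ hs') x).trans (by gcongr; exact hM _ ⟨hs'.1, hs.2⟩)

theorem exists_norm_velocity_le (hF : IsForce F) (hD : IsDelay α τ) {S : ℝ}
    (hg : ContinuousP1On g (Icc (-τ 0) 0)) (hμ : ContinuousP1On μ (Icc 0 S)) :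
    ∃ A, 0 < A ∧ ∀ t ∈ Icc 0 S, ∀ x, ‖velocity α τ F g μ t x‖ ≤ A * (1 + ‖x‖) := by
  obtain ⟨C, hC, hgr⟩ := hF.growth
  obtain ⟨M, hM0, hM⟩ := exists_moment_withHistory_le hg hμ
  refine ⟨C * (1 + M), by positivity, fun t ht x => ?_⟩
  refine (norm_velocity_le_of_moment_le hD hg hμ hC hgr ht
    (fun s hs => hM s ⟨hs.1, hs.2.le.trans ht.2⟩) x).trans ?_
  rw [mul_assoc]
  gcongr
  nlinarith [norm_nonneg x, mul_nonneg hM0 (norm_nonneg x)]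

theorem exists_lipschitzOnWith_velocity (hF : IsForce F) (hD : IsDelay α τ) {S : ℝ}
    (hg : ContinuousP1On g (Icc (-τ 0) 0)) (hμ : ContinuousP1On μ (Icc 0 S)) (ρ : ℝ) :
    ∃ K : ℝ≥0, ∀ t ∈ Icc 0 S,
      LipschitzOnWith K (velocity α τ F g μ t) (Metric.closedBall 0 ρ) := by
  obtain ⟨M, hM0, hM⟩ := exists_moment_withHistory_le hg hμ
  obtain ⟨K, hK, hlip⟩ := hF.lipschitz ρ M
  refine ⟨⟨K, hK⟩, fun t ht => LipschitzOnWith.of_dist_le_mul fun x hx x' hx' => ?_⟩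
  change _ ≤ K * _
  rw [dist_eq_norm, dist_eq_norm]
  refine norm_velocity_sub_le hF hD hg hμ hμ ht fun s hs => ?_
  have hs' := hD.sub_mem ht hs
  have h1 := isP1_withHistory hg hμ hs'
  have := h1.1
  have := hlip (withHistory g μ s) id id 0 x x' h1.1 measurable_id measurable_id
    h1.integrable_norm h1.integrable_norm (hM s hs') (hM s hs') (by simp)
    (by simpa using hx) (by simpa using hx')
  simpa using this

theorem IsDelay.continuousOn_h (hD : IsDelay α τ) : ContinuousOn (h α τ) (Ici 0) := by
  have h0 := (hD.pos 0 le_rfl).le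
  have h1 := intervalIntegral.continuousOn_primitive_interval (f := α) (a := 0) (b := τ 0)
    (μ := volume) (by rw [uIcc_of_le h0]; exact hD.integrableOn)
  rw [uIcc_of_le h0] at h1
  exact h1.comp hD.continuousOn fun t ht => ⟨(hD.pos t ht).le, hD.le t ht⟩

/-- Joint continuity of the velocity field. The curve extended by the history may jump at time `0`,
and the end point of the integral moves with `τ`; each affects a single value of the integration
variable. -/
theorem continuousOn_velocity (hF : IsForce F) (hD : IsDelay α τ) {S : ℝ}
    (hg : ContinuousP1On g (Icc (-τ 0) 0)) (hμ : ContinuousP1On μ (Icc 0 S)) :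
    ContinuousOn (fun q : ℝ × E d => velocity α τ F g μ q.1 q.2) (Icc 0 S ×ˢ univ) := by
  simp only [velocity_eq]
  refine ContinuousOn.smul (ContinuousOn.inv₀ (hD.continuousOn_h.comp continuousOn_fst
    fun q hq => hq.1.1) fun q hq => (hD.h_pos _ hq.1.1).ne') ?_
  obtain ⟨C, hC, hgr⟩ := hF.growth
  obtain ⟨M, hM0, hM⟩ := exists_moment_withHistory_le hg hμ
  have e : ∀ q ∈ Icc 0 S ×ˢ (univ : Set (E d)),
      ∫ r in (0 : ℝ)..τ q.1, α r • F (withHistory g μ (q.1 - r)) q.2 =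
      ∫ r, (Ioc 0 (τ q.1)).indicator (fun r => α r • F (withHistory g μ (q.1 - r)) q.2) r := by
    intro q hq
    rw [intervalIntegral.integral_of_le (hD.pos _ hq.1.1).le, integral_indicator measurableSet_Ioc]
  refine ContinuousOn.congr ?_ e
  rintro ⟨t₀, x₀⟩ ⟨ht₀, -⟩
  set l := 𝓝[Icc 0 S ×ˢ univ] (t₀, x₀)
  have hmem : ∀ᶠ q in l, q ∈ Icc 0 S ×ˢ (univ : Set (E d)) := self_mem_nhdsWithin
  have hl1 : Tendsto Prod.fst l (𝓝 t₀) :=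
    (continuous_fst.tendsto (t₀, x₀)).mono_left nhdsWithin_le_nhds
  have hl2 : Tendsto Prod.snd l (𝓝 x₀) :=
    (continuous_snd.tendsto (t₀, x₀)).mono_left nhdsWithin_le_nhds
  have hτl : Tendsto (fun q => τ q.1) l (𝓝 (τ t₀)) :=
    (hD.continuousOn t₀ ht₀.1).tendsto.comp (tendsto_nhdsWithin_iff.2 ⟨hl1, by
      filter_upwards [hmem] with q hq using hq.1.1⟩)
  refine tendsto_integral_filter_of_dominated_convergence
    ((Icc 0 (τ 0)).indicator fun r => ‖α r‖ * (C * (‖x₀‖ + 1 + M))) ?_ ?_ ?_ ?_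
  · filter_upwards [hmem] with q hq
    rw [aestronglyMeasurable_indicator_iff measurableSet_Ioc]
    exact (integrableOn_force hF hD hg hμ hq.1 q.2).aestronglyMeasurable
  · filter_upwards [hmem, hl2.norm.eventually (gt_mem_nhds (lt_add_one ‖x₀‖))] with q hq hq2
    refine ae_of_all _ fun r => ?_
    by_cases hr : r ∈ Ioc 0 (τ q.1)
    · rw [indicator_of_mem hr, indicator_of_mem (show r ∈ Icc 0 (τ 0) from
        ⟨hr.1.le, hr.2.trans (hD.le _ hq.1.1)⟩), norm_smul]
      have hs := hD.sub_mem (s := q.1 - r) hq.1 ⟨by linarith [hr.2], by linarith [hr.1]⟩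
      gcongr
      exact (hgr _ (isP1_withHistory hg hμ hs) _).trans (by gcongr; exact hM _ hs)
    · rw [indicator_of_notMem hr, norm_zero]
      exact indicator_nonneg (fun _ _ => by positivity) _
  · rw [integrable_indicator_iff measurableSet_Icc]
    exact hD.integrableOn.norm.mul_const _
  -- pointwise convergence away from the exceptional values `r = τ t₀` and `r = t₀`
  · have hne : ∀ a : ℝ, ∀ᵐ r : ℝ, r ≠ a := fun a => by
      simp [ae_iff]
    filter_upwards [hne (τ t₀), hne t₀] with r hr1 hr2
    rcases le_or_gt r 0 with hr0 | hr0
    · refine tendsto_const_nhds.congr' (Eventually.of_forall fun q => ?_)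
      have h0 : ∀ a, r ∉ Ioc 0 a := fun a h => hr0.not_gt h.1
      simp only [indicator_of_notMem (h0 _)]
    rcases lt_or_gt_of_ne hr1 with h1 | h1
    · have hin : ∀ᶠ q in l, r ∈ Ioc 0 (τ q.1) := by
        filter_upwards [hτl.eventually (lt_mem_nhds h1)] with q hq using ⟨hr0, hq.le⟩
      have hgoal : Tendsto (fun q : ℝ × E d => α r • F (withHistory g μ (q.1 - r)) q.2) l
          (𝓝 (α r • F (withHistory g μ (t₀ - r)) x₀)) := by
        refine tendsto_const_nhds.smul ?_
        have hsub : Tendsto (fun q : ℝ × E d => (q.1 - r, q.2)) l (𝓝 (t₀ - r, x₀)) :=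
          (hl1.sub_const r).prodMk_nhds hl2
        rcases lt_or_gt_of_ne hr2 with h2 | h2
        · rw [withHistory_of_nonneg (by linarith)]
          have hc := hF.continuousOn μ _ hμ (t₀ - r, x₀)
            ⟨⟨by linarith, by linarith [ht₀.2]⟩, trivial⟩
          have := hc.tendsto.comp (tendsto_nhdsWithin_iff.2 ⟨hsub, by
            filter_upwards [hmem, hl1.eventually (lt_mem_nhds h2)] with q hq hq2
            exact ⟨⟨by linarith, by linarith [hq.1.2]⟩, trivial⟩⟩)
          refine this.congr' ?_
          filter_upwards [hl1.eventually (lt_mem_nhds h2)] with q hq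
          simp only [Function.comp]
          rw [withHistory_of_nonneg (by linarith)]
        · rw [withHistory_of_neg (by linarith)]
          have hc := hF.continuousOn g _ hg (t₀ - r, x₀)
            ⟨⟨by linarith [ht₀.1, hD.le t₀ ht₀.1], by linarith⟩, trivial⟩
          have := hc.tendsto.comp (tendsto_nhdsWithin_iff.2 ⟨hsub, by
            filter_upwards [hmem, hl1.eventually (gt_mem_nhds h2), hin] with q hq hq2 hq3
            exact ⟨⟨by linarith [hq.1.1, hq3.2, hD.le _ hq.1.1], by linarith⟩, trivial⟩⟩)
          refine this.congr' ?_
          filter_upwards [hl1.eventually (gt_mem_nhds h2)] with q hq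
          simp only [Function.comp]
          rw [withHistory_of_neg (by linarith)]
      rw [indicator_of_mem (show r ∈ Ioc 0 (τ t₀) from ⟨hr0, h1.le⟩)]
      refine hgoal.congr' ?_
      filter_upwards [hin] with q hq
      rw [indicator_of_mem hq]
    · rw [indicator_of_notMem (fun h => h1.not_ge h.2)]
      refine tendsto_const_nhds.congr' ?_
      filter_upwards [hτl.eventually (gt_mem_nhds h1)] with q hq
      rw [indicator_of_notMem (fun h => hq.not_ge h.2)]

/-- The velocity field at time `t` sees the curve only at times up to `t`. -/
theorem velocity_congr (hD : IsDelay α τ) {S t : ℝ} (ht : t ∈ Icc 0 S) (h : EqOn μ ν (Icc 0 S))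
    (x : E d) : velocity α τ F g μ t x = velocity α τ F g ν t x := by
  rw [velocity_eq, velocity_eq]
  congr 1
  refine intervalIntegral.integral_congr fun r hr => ?_
  rw [uIcc_of_le (hD.pos t ht.1).le] at hr
  rcases lt_or_ge (t - r) 0 with h' | h'
  · simp only [withHistory_of_neg h']
  · simp only [withHistory_of_nonneg h', h ⟨h', (by linarith [hr.1, ht.2] : t - r ≤ S)⟩]

end

/-! ### Ordinary differential equations -/

section

section ODE

theorem clamp_mem {S : ℝ} (hS : 0 ≤ S) (t : ℝ) : max 0 (min S t) ∈ Icc 0 S :=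
  ⟨le_max_left _ _, max_le hS (min_le_left _ _)⟩

theorem clamp_eq {S t : ℝ} (ht : t ∈ Icc 0 S) : max 0 (min S t) = t := by
  rw [min_eq_right ht.2, max_eq_right ht.1]

variable {V : Type*} [NormedAddCommGroup V]

/-- Time-dependent vector fields on `[0, S]` that are continuous, of linear growth, and Lipschitz
on balls, uniformly in time. -/
structure IsField (v : ℝ → V → V) (S : ℝ) : Prop where
  continuousOn : ContinuousOn (fun q : ℝ × V => v q.1 q.2) (Icc 0 S ×ˢ univ)
  growth : ∃ A, 0 < A ∧ ∀ t ∈ Icc 0 S, ∀ x, ‖v t x‖ ≤ A * (1 + ‖x‖)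
  lipschitz : ∀ ρ, ∃ K : ℝ≥0, ∀ t ∈ Icc 0 S, LipschitzOnWith K (v t) (Metric.closedBall 0 ρ)

theorem IsField.mono {v : ℝ → V → V} {S S' : ℝ} (hv : IsField v S) (h : S' ≤ S) :
    IsField v S' where
  continuousOn := hv.continuousOn.mono (prod_mono (Icc_subset_Icc_right h) subset_rfl)
  growth := let ⟨A, hA, hA'⟩ := hv.growth; ⟨A, hA, fun t ht => hA' t ⟨ht.1, ht.2.trans h⟩⟩
  lipschitz ρ := let ⟨K, hK⟩ := hv.lipschitz ρ; ⟨K, fun t ht => hK t ⟨ht.1, ht.2.trans h⟩⟩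

/-- A Lipschitz cutoff equal to `1` on the ball of radius `ρ` and to `0` off the ball of radius
`ρ + 1`. -/
def cutoff (ρ : ℝ) (x : V) : ℝ := max 0 (min 1 (ρ + 1 - ‖x‖))

theorem cutoff_nonneg (ρ : ℝ) (x : V) : 0 ≤ cutoff ρ x := le_max_left _ _

theorem cutoff_le_one (ρ : ℝ) (x : V) : cutoff ρ x ≤ 1 := max_le zero_le_one (min_le_left _ _)

theorem cutoff_eq_one {ρ : ℝ} {x : V} (h : ‖x‖ ≤ ρ) : cutoff ρ x = 1 := by
  rw [cutoff, min_eq_left (by linarith), max_eq_right zero_le_one]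

theorem cutoff_eq_zero {ρ : ℝ} {x : V} (h : ρ + 1 ≤ ‖x‖) : cutoff ρ x = 0 :=
  max_eq_left ((min_le_right _ _).trans (by linarith))

theorem continuous_cutoff (ρ : ℝ) : Continuous (cutoff ρ : V → ℝ) := by
  unfold cutoff; fun_prop

theorem abs_cutoff_sub_le (ρ : ℝ) (x y : V) : |cutoff ρ x - cutoff ρ y| ≤ ‖x - y‖ := by
  have h1 : |cutoff ρ x - cutoff ρ y| ≤ |(ρ + 1 - ‖x‖) - (ρ + 1 - ‖y‖)| := by
    refine (abs_max_sub_max_le_max _ _ _ _).trans (max_le (by simp) ?_)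
    exact (abs_min_sub_min_le_max _ _ _ _).trans (max_le (by simp) le_rfl)
  refine h1.trans ?_
  rw [sub_sub_sub_cancel_left, ← norm_sub_rev y x]
  exact abs_norm_sub_norm_le y x

variable [NormedSpace ℝ V]

/-- `f` solves `f' = v(t, f)` on `[a, b]`, with one-sided derivatives at the end points. -/
def IsSolutionOn (v : ℝ → V → V) (a b : ℝ) (f : ℝ → V) : Prop :=
  ∀ t ∈ Icc a b, HasDerivWithinAt f (v t (f t)) (Icc a b) t

variable {v w : ℝ → V → V} {a b : ℝ} {f f' : ℝ → V}

theorem IsSolutionOn.continuousOn (h : IsSolutionOn v a b f) : ContinuousOn f (Icc a b) :=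
  fun t ht => (h t ht).continuousWithinAt

theorem IsSolutionOn.mono (h : IsSolutionOn v a b f) {a' b' : ℝ} (ha : a ≤ a') (hb : b' ≤ b) :
    IsSolutionOn v a' b' f := fun t ht =>
  (h t ⟨ha.trans ht.1, ht.2.trans hb⟩).mono (Icc_subset_Icc ha hb)

theorem IsSolutionOn.congr_field (h : IsSolutionOn v a b f)
    (hw : ∀ t ∈ Icc a b, v t (f t) = w t (f t)) : IsSolutionOn w a b f := fun t ht =>
  hw t ht ▸ h t ht

theorem hasDerivWithinAt_Ici_of_Icc {c : V} {t : ℝ} (h : HasDerivWithinAt f c (Icc a b) t)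
    (ht : t ∈ Ico a b) : HasDerivWithinAt f c (Ici t) t :=
  h.mono_of_mem_nhdsWithin (mem_of_superset (Icc_mem_nhdsGE ht.2) (Icc_subset_Icc_left ht.1))

theorem IsSolutionOn.hasDerivWithinAt_Ici (h : IsSolutionOn v a b f) {t : ℝ} (ht : t ∈ Ico a b) :
    HasDerivWithinAt f (v t (f t)) (Ici t) t :=
  hasDerivWithinAt_Ici_of_Icc (h t ⟨ht.1, ht.2.le⟩) ht

/-- Solutions for bounded, globally Lipschitz fields. -/
theorem exists_isSolutionOn [CompleteSpace V] (hc : Continuous fun q : ℝ × V => w q.1 q.2)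
    {K : ℝ≥0} (hK : ∀ t, LipschitzWith K (w t)) {B : ℝ} (hB : ∀ t x, ‖w t x‖ ≤ B) {t₀ : ℝ}
    (ht₀ : t₀ ∈ Icc a b) (x₀ : V) : ∃ f, f t₀ = x₀ ∧ IsSolutionOn w a b f := by
  have hB0 : 0 ≤ B := (norm_nonneg _).trans (hB 0 0)
  have hm : 0 ≤ max (b - t₀) (t₀ - a) := le_max_of_le_left (by linarith [ht₀.2])
  have hp : IsPicardLindelof w (tmin := a) (tmax := b) ⟨t₀, ht₀⟩ x₀
      ⟨B * max (b - t₀) (t₀ - a), by positivity⟩ 0 ⟨B, hB0⟩ K :=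
    { lipschitzOnWith := fun t _ => (hK t).lipschitzOnWith
      continuousOn := fun x _ =>
        (hc.comp (by fun_prop : Continuous fun t : ℝ => (t, x))).continuousOn
      norm_le := fun t _ x _ => hB t x
      mul_max_le := by rw [NNReal.coe_zero, sub_zero]; exact le_rfl }
  exact hp.exists_eq_forall_mem_Icc_hasDerivWithinAt₀

theorem one_add_norm_le_of_le {A : ℝ} (hA : 0 < A)
    (hf : ∀ t ∈ Icc a b, HasDerivWithinAt f (f' t) (Icc a b) t)
    (hb : ∀ t ∈ Icc a b, ‖f' t‖ ≤ A * (1 + ‖f t‖)) (hab : a ≤ b) :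
    1 + ‖f b‖ ≤ (1 + ‖f a‖) * Real.exp (A * (b - a)) := by
  have := norm_le_gronwallBound_of_norm_deriv_right_le (f' := f') (δ := ‖f a‖) (K := A) (ε := A)
    (fun t ht => (hf t ht).continuousWithinAt)
    (fun t ht => hasDerivWithinAt_Ici_of_Icc (hf t ⟨ht.1, ht.2.le⟩) ht) le_rfl
    (fun t ht => (hb t ⟨ht.1, ht.2.le⟩).trans_eq (by ring)) b ⟨hab, le_rfl⟩
  rw [gronwallBound_of_K_ne_0 hA.ne', div_self hA.ne'] at this
  linarith

/-- Grönwall's inequality in both time directions: linear growth of the field bounds a solution at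
any time by its value at any other time. -/
theorem IsSolutionOn.one_add_norm_le (h : IsSolutionOn v a b f) {A : ℝ} (hA : 0 < A)
    (hv : ∀ t ∈ Icc a b, ∀ x, ‖v t x‖ ≤ A * (1 + ‖x‖)) {s t : ℝ} (hs : s ∈ Icc a b)
    (ht : t ∈ Icc a b) : 1 + ‖f t‖ ≤ (1 + ‖f s‖) * Real.exp (A * (b - a)) := by
  rcases le_total s t with hst | hst
  · refine (one_add_norm_le_of_le hA (h.mono hs.1 ht.2)
      (fun r hr => hv r ⟨hs.1.trans hr.1, hr.2.trans ht.2⟩ _) hst).trans ?_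
    gcongr
    exacts [ht.2, hs.1]
  -- backward in time: the reflected curve satisfies the same differential inequality
  · have h1 : ∀ r ∈ Icc (-s) (-t), HasDerivWithinAt (fun r => f (-r)) (-v (-r) (f (-r)))
        (Icc (-s) (-t)) r := by
      intro r hr
      have hr' : -r ∈ Icc t s := ⟨by linarith [hr.2], by linarith [hr.1]⟩
      have := HasDerivWithinAt.scomp r (h.mono ht.1 hs.2 (-r) hr')
        (hasDerivWithinAt_neg r (Icc (-s) (-t)))
        (fun r hr => ⟨by linarith [hr.2], by linarith [hr.1]⟩)
      simp only [neg_smul, one_smul] at this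
      exact this
    have := one_add_norm_le_of_le hA h1 (fun r hr => by
      rw [norm_neg]
      exact hv (-r) ⟨by linarith [hr.2, ht.1], by linarith [hr.1, hs.2]⟩ _) (by linarith)
    simp only [neg_neg] at this
    have hle : -t - -s ≤ b - a := by linarith [hs.2, ht.1]
    exact this.trans (by gcongr)

theorem IsSolutionOn.dist_le (h : IsSolutionOn w a b f) (h' : IsSolutionOn w a b f')
    {K : ℝ≥0} {s : Set V} (hK : ∀ t ∈ Icc a b, LipschitzOnWith K (w t) s)
    (hs : ∀ t ∈ Icc a b, f t ∈ s) (hs' : ∀ t ∈ Icc a b, f' t ∈ s) {t : ℝ} (ht : t ∈ Icc a b) :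
    dist (f t) (f' t) ≤ dist (f a) (f' a) * Real.exp (K * (t - a)) :=
  dist_le_of_trajectories_ODE_of_mem (s := fun _ => s) (fun t ht => hK t ⟨ht.1, ht.2.le⟩)
    h.continuousOn (fun _ ht => h.hasDerivWithinAt_Ici ht) (fun t ht => hs t ⟨ht.1, ht.2.le⟩)
    h'.continuousOn (fun _ ht => h'.hasDerivWithinAt_Ici ht) (fun t ht => hs' t ⟨ht.1, ht.2.le⟩)
    le_rfl t ht

theorem IsField.eqOn {S : ℝ} (hv : IsField v S) (h : IsSolutionOn v 0 S f)
    (h' : IsSolutionOn v 0 S f') (h0 : f 0 = f' 0) : EqOn f f' (Icc 0 S) := by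
  intro t ht
  obtain ⟨A, hA, hgr⟩ := hv.growth
  have h0m : (0 : ℝ) ∈ Icc 0 S := ⟨le_rfl, ht.1.trans ht.2⟩
  obtain ⟨K, hK⟩ := hv.lipschitz ((1 + ‖f 0‖) * Real.exp (A * (S - 0)))
  have := h.dist_le h' hK
    (fun r hr => by
      have := h.one_add_norm_le hA hgr h0m hr
      rw [mem_closedBall_zero_iff]; linarith)
    (fun r hr => by
      have := h'.one_add_norm_le hA hgr h0m hr
      rw [mem_closedBall_zero_iff, h0]; linarith) ht
  rw [h0, dist_self, zero_mul] at this
  exact dist_le_zero.1 this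

/-- The field `v` on `[0, S]`, cut off outside the ball of radius `ρ + 1` and frozen in time outside
`[0, S]`. -/
def truncField (v : ℝ → V → V) (S ρ : ℝ) (t : ℝ) (x : V) : V :=
  cutoff ρ x • v (max 0 (min S t)) x

theorem truncField_eq {S ρ t : ℝ} {x : V} (ht : t ∈ Icc 0 S) (hx : ‖x‖ ≤ ρ) :
    truncField v S ρ t x = v t x := by
  rw [truncField, clamp_eq ht, cutoff_eq_one hx, one_smul]

theorem IsField.continuous_truncField {S : ℝ} (hS : 0 ≤ S) (hv : IsField v S) (ρ : ℝ) :
    Continuous fun q : ℝ × V => truncField v S ρ q.1 q.2 :=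
  ((continuous_cutoff ρ).comp continuous_snd).smul
    (hv.continuousOn.comp_continuous (f := fun q : ℝ × V => (max 0 (min S q.1), q.2))
      (by fun_prop) fun q => ⟨clamp_mem hS q.1, trivial⟩)

theorem norm_truncField_le {S : ℝ} (hS : 0 ≤ S) {A : ℝ}
    (hgr : ∀ t ∈ Icc 0 S, ∀ x, ‖v t x‖ ≤ A * (1 + ‖x‖)) (ρ t : ℝ) (x : V) :
    ‖truncField v S ρ t x‖ ≤ A * (1 + ‖x‖) := by
  rw [truncField, norm_smul, Real.norm_of_nonneg (cutoff_nonneg _ _)]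
  exact (mul_le_of_le_one_left (norm_nonneg _) (cutoff_le_one _ _)).trans
    (hgr _ (clamp_mem hS t) x)

theorem norm_truncField_le' {S : ℝ} (hS : 0 ≤ S) {A : ℝ} (hA : 0 < A)
    (hgr : ∀ t ∈ Icc 0 S, ∀ x, ‖v t x‖ ≤ A * (1 + ‖x‖)) {ρ : ℝ} (hρ : 0 ≤ ρ) (t : ℝ) (x : V) :
    ‖truncField v S ρ t x‖ ≤ A * (1 + (ρ + 1)) := by
  rcases le_total ‖x‖ (ρ + 1) with h | h
  · exact (norm_truncField_le hS hgr ρ t x).trans (by gcongr)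
  · rw [truncField, cutoff_eq_zero h, zero_smul, norm_zero]; positivity

theorem IsField.exists_lipschitzWith_truncField {S : ℝ} (hS : 0 ≤ S) (hv : IsField v S) {ρ : ℝ}
    (hρ : 0 ≤ ρ) : ∃ K : ℝ≥0, ∀ t, LipschitzWith K (truncField v S ρ t) := by
  obtain ⟨A, hA, hgr⟩ := hv.growth
  obtain ⟨K, hK⟩ := hv.lipschitz (ρ + 1)
  have hB0 : 0 ≤ A * (1 + (ρ + 1)) := by positivity
  refine ⟨K + ⟨A * (1 + (ρ + 1)), hB0⟩, fun t => LipschitzWith.of_dist_le_mul ?_⟩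
  have hct := clamp_mem hS t
  have hb : ∀ x : V, ‖x‖ ≤ ρ + 1 → ‖v (max 0 (min S t)) x‖ ≤ A * (1 + (ρ + 1)) := fun x hx =>
    (hgr _ hct x).trans (by gcongr)
  -- the estimate when the second point lies in the larger ball
  have key : ∀ x y : V, ‖y‖ ≤ ρ + 1 → dist (truncField v S ρ t x) (truncField v S ρ t y) ≤
      (K + A * (1 + (ρ + 1))) * dist x y := by
    intro x y hy
    have h2 : ‖(cutoff ρ x - cutoff ρ y) • v (max 0 (min S t)) y‖ ≤
        ‖x - y‖ * (A * (1 + (ρ + 1))) := by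
      rw [norm_smul, Real.norm_eq_abs]
      exact mul_le_mul (abs_cutoff_sub_le ρ x y) (hb y hy) (norm_nonneg _) (norm_nonneg _)
    have h1 : ‖cutoff ρ x • (v (max 0 (min S t)) x - v (max 0 (min S t)) y)‖ ≤ K * ‖x - y‖ := by
      rcases le_total ‖x‖ (ρ + 1) with hx | hx
      · have := (hK _ hct).dist_le_mul x (by simpa using hx) y (by simpa using hy)
        rw [dist_eq_norm, dist_eq_norm] at this
        rw [norm_smul, Real.norm_of_nonneg (cutoff_nonneg _ _)]
        exact (mul_le_of_le_one_left (norm_nonneg _) (cutoff_le_one _ _)).trans this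
      · rw [cutoff_eq_zero hx, zero_smul, norm_zero]; positivity
    have e : truncField v S ρ t x - truncField v S ρ t y =
        cutoff ρ x • (v (max 0 (min S t)) x - v (max 0 (min S t)) y) +
        (cutoff ρ x - cutoff ρ y) • v (max 0 (min S t)) y := by
      simp only [truncField]; module
    rw [dist_eq_norm, dist_eq_norm, e]
    refine (norm_add_le _ _).trans ((add_le_add h1 h2).trans_eq (by ring))
  intro x y
  change _ ≤ ((K : ℝ) + A * (1 + (ρ + 1))) * dist x y
  rcases le_total ‖y‖ (ρ + 1) with hy | hy
  · exact key x y hy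
  rcases le_total ‖x‖ (ρ + 1) with hx | hx
  · rw [dist_comm, dist_comm x]; exact key y x hx
  · simp only [truncField, cutoff_eq_zero hx, cutoff_eq_zero hy, zero_smul, dist_self]
    positivity

theorem IsField.exists_isSolutionOn [CompleteSpace V] {S : ℝ} (hS : 0 ≤ S) (hv : IsField v S)
    (x : V) : ∃ f, f 0 = x ∧ IsSolutionOn v 0 S f := by
  obtain ⟨A, hA, hgr⟩ := hv.growth
  -- by the a priori bound, the solution for the field cut off at `ρ` does not feel the cutoff
  set ρ := (1 + ‖x‖) * Real.exp (A * (S - 0))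
  have hρ : 0 ≤ ρ := by positivity
  obtain ⟨K, hK⟩ := hv.exists_lipschitzWith_truncField hS hρ
  have h0 : (0 : ℝ) ∈ Icc 0 S := ⟨le_rfl, hS⟩
  obtain ⟨f, hf0, hf⟩ := DelayedTransport.exists_isSolutionOn (hv.continuous_truncField hS ρ) hK
    (norm_truncField_le' hS hA hgr hρ) h0 x
  refine ⟨f, hf0, hf.congr_field fun t ht => truncField_eq ht ?_⟩
  have := hf.one_add_norm_le hA (fun t _ => norm_truncField_le hS hgr ρ t) h0 ht
  rw [hf0] at this
  linarith

/-- Continuous dependence on the initial value. -/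
theorem IsField.continuous_flow {S : ℝ} (hv : IsField v S) {X : ℝ → V → V}
    (hX0 : ∀ x, X 0 x = x) (hX : ∀ x, IsSolutionOn v 0 S fun t => X t x) {t : ℝ}
    (ht : t ∈ Icc 0 S) : Continuous (X t) := by
  obtain ⟨A, hA, hgr⟩ := hv.growth
  have h0 : (0 : ℝ) ∈ Icc 0 S := ⟨le_rfl, ht.1.trans ht.2⟩
  rw [continuous_iff_continuousAt]
  intro x₀
  obtain ⟨K, hK⟩ := hv.lipschitz ((1 + (‖x₀‖ + 1)) * Real.exp (A * (S - 0)))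
  have hb : ∀ x ∈ Metric.ball x₀ 1, ∀ r ∈ Icc 0 S,
      X r x ∈ Metric.closedBall 0 ((1 + (‖x₀‖ + 1)) * Real.exp (A * (S - 0))) := by
    intro x hx r hr
    have h1 := (hX x).one_add_norm_le hA hgr h0 hr
    have h2 : ‖x‖ ≤ ‖x₀‖ + 1 := by
      have h3 : ‖x - x₀‖ < 1 := by simpa [dist_eq_norm] using hx
      have := norm_add_le (x - x₀) x₀
      rw [sub_add_cancel] at this
      linarith
    have h3 : (1 + ‖X 0 x‖) * Real.exp (A * (S - 0)) ≤
      (1 + (‖x₀‖ + 1)) * Real.exp (A * (S - 0)) := by rw [hX0]; gcongr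
    rw [mem_closedBall_zero_iff]
    linarith
  have hl : LipschitzOnWith (K := ⟨Real.exp (K * (t - 0)), (Real.exp_pos _).le⟩) (X t)
      (Metric.ball x₀ 1) := by
    refine LipschitzOnWith.of_dist_le_mul fun x hx y hy => ?_
    have := (hX x).dist_le (hX y) hK (hb x hx) (hb y hy) ht
    simp only [hX0] at this
    rw [mul_comm] at this
    exact this
  exact hl.continuousOn.continuousAt (Metric.ball_mem_nhds _ one_pos)

end ODE

/-- The velocity field of a `W1`-continuous curve is continuous, of linear growth, and Lipschitz on
balls. -/
theorem isField_velocity {α τ : ℝ → ℝ} {F : Measure (E d) → E d → E d} {g μ : ℝ → Measure (E d)}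
    (hF : IsForce F) (hD : IsDelay α τ) {S : ℝ} (hg : ContinuousP1On g (Icc (-τ 0) 0))
    (hμ : ContinuousP1On μ (Icc 0 S)) : IsField (velocity α τ F g μ) S where
  continuousOn := continuousOn_velocity hF hD hg hμ
  growth := exists_norm_velocity_le hF hD hg hμ
  lipschitz := exists_lipschitzOnWith_velocity hF hD hg hμ

end

/-! ### Terminal maps and mollification -/

section

section Terminal

variable {V : Type*} [NormedAddCommGroup V] [NormedSpace ℝ V] {w : ℝ → V → V}

theorem IsSolutionOn.norm_sub_le {a b : ℝ} {f : ℝ → V} (h : IsSolutionOn w a b f) {B : ℝ}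
    (hB : ∀ t x, ‖w t x‖ ≤ B) {s t : ℝ} (hs : s ∈ Icc a b) (ht : t ∈ Icc a b) (hst : s ≤ t) :
    ‖f t - f s‖ ≤ B * (t - s) :=
  norm_image_sub_le_of_norm_deriv_le_segment' (h.mono hs.1 ht.2) (fun r _ => hB r _) t
    ⟨hst, le_rfl⟩

/-- The map sending `(x, s)` to the value at the terminal time `S` of the solution through `x` at
time `s`. It is Lipschitz in both variables and constant along solutions. Starting times outside
`[a, S]` are moved to the nearest end point. -/
theorem exists_terminalMap [CompleteSpace V] (hc : Continuous fun q : ℝ × V => w q.1 q.2)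
    {K : ℝ≥0} (hK : ∀ t, LipschitzWith K (w t)) {B : ℝ} (hB : ∀ t x, ‖w t x‖ ≤ B) {a S : ℝ}
    (haS : a ≤ S) : ∃ (Z : V × ℝ → V) (Λ : ℝ≥0), LipschitzWith Λ Z ∧
      (∀ x s, ∃ f, f (max a (min S s)) = x ∧ IsSolutionOn w a S f ∧ Z (x, s) = f S) ∧
      ∀ f s, s ∈ Icc a S → IsSolutionOn w s S f → Z (f s, s) = f S := by
  have hcl : ∀ s, max a (min S s) ∈ Icc a S := fun s =>
    ⟨le_max_left _ _, max_le haS (min_le_left _ _)⟩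
  choose f hf0 hf using fun (x : V) (s : ℝ) => exists_isSolutionOn hc hK hB (hcl s) x
  have hB0 : 0 ≤ B := (norm_nonneg _).trans (hB 0 0)
  have hunif : ∀ (f₁ f₂ : ℝ → V) (s : ℝ), s ∈ Icc a S → IsSolutionOn w s S f₁ →
      IsSolutionOn w s S f₂ → dist (f₁ S) (f₂ S) ≤ dist (f₁ s) (f₂ s) * Real.exp (K * (S - a)) := by
    intro f₁ f₂ s hs h₁ h₂
    refine (h₁.dist_le h₂ (s := univ) (fun t _ => (hK t).lipschitzOnWith) (fun _ _ => trivial)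
      (fun _ _ => trivial) (right_mem_Icc.2 hs.2)).trans ?_
    gcongr
    exact hs.1
  have hle : ∀ (x x' : V) (s s' : ℝ), max a (min S s) ≤ max a (min S s') →
      dist (f x s S) (f x' s' S) ≤ Real.exp (K * (S - a)) * (1 + B) * dist (x, s) (x', s') := by
    intro x x' s s' hss
    have h1 := hunif _ _ _ (hcl s') ((hf x s).mono (hcl s').1 le_rfl)
      ((hf x' s').mono (hcl s').1 le_rfl)
    have h2 := (hf x s).norm_sub_le hB (hcl s) (hcl s') hss
    rw [hf0, ← dist_eq_norm] at h2
    rw [hf0] at h1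
    have h3 : max a (min S s') - max a (min S s) ≤ dist s s' := by
      have h4 : LipschitzWith 1 fun s : ℝ => max a (min S s) :=
        (LipschitzWith.id.const_min S).const_max a
      have := h4.dist_le_mul s' s
      rw [Real.dist_eq, NNReal.coe_one, one_mul, dist_comm s' s] at this
      exact (le_abs_self _).trans this
    have h5 : dist x x' ≤ dist (x, s) (x', s') := le_max_left _ _
    have h6 : dist s s' ≤ dist (x, s) (x', s') := le_max_right _ _
    calc _ ≤ dist (f x s (max a (min S s'))) x' * Real.exp (K * (S - a)) := h1
      _ ≤ (B * dist s s' + dist x x') * Real.exp (K * (S - a)) := by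
          gcongr
          exact (dist_triangle _ x _).trans (add_le_add (h2.trans (by gcongr)) le_rfl)
      _ ≤ (B * dist (x, s) (x', s') + dist (x, s) (x', s')) * Real.exp (K * (S - a)) := by gcongr
      _ = _ := by ring
  refine ⟨fun p => f p.1 p.2 S, ⟨Real.exp (K * (S - a)) * (1 + B), by positivity⟩,
    LipschitzWith.of_dist_le_mul ?_, fun x s => ⟨f x s, hf0 x s, hf x s, rfl⟩, ?_⟩
  · rintro ⟨x, s⟩ ⟨x', s'⟩
    rcases le_total (max a (min S s)) (max a (min S s')) with h | h
    · exact hle x x' s s' h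
    · rw [dist_comm, dist_comm (x, s)]
      exact hle x' x s' s h
  · intro f₁ s hs h₁
    have hs' : max a (min S s) = s := by rw [min_eq_right hs.2, max_eq_right hs.1]
    have h0 := hf0 (f₁ s) s
    rw [hs'] at h0
    have := hunif (f (f₁ s) s) f₁ s hs ((hf _ _).mono hs.1 le_rfl) h₁
    rw [h0, dist_self, zero_mul] at this
    exact dist_le_zero.1 this

/-- A Lipschitz function constant along the solutions of `w` changes little along a short segment in
the direction `(u, 1)`, if `w` is close to `u` nearby. -/
theorem abs_sub_le_of_constant_along {φ : V × ℝ → ℝ} {Λ : ℝ≥0} (hφ : LipschitzWith Λ φ) {a S : ℝ}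
    (hchar : ∀ x s, s ∈ Ico a S → ∃ f, f s = x ∧ IsSolutionOn w s S f ∧
      ∀ t ∈ Icc s S, φ (f t, t) = φ (x, s))
    {B : ℝ} (hB : ∀ t x, ‖w t x‖ ≤ B) {z : V × ℝ} {u : V} {κ δ : ℝ}
    (hκ : ∀ y r, dist (y, r) z < δ → ‖w r y - u‖ ≤ κ) {p : V × ℝ} (hp : dist p z < δ / 2)
    (hpa : a ≤ p.2) {e : ℝ} (he : 0 < e) (heS : p.2 + e ≤ S) (heδ : (1 + B) * e < δ / 2) :
    |φ (p + e • (u, 1)) - φ p| ≤ Λ * (κ * e) := by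
  obtain ⟨x, s⟩ := p
  simp only at hpa heS
  have hB0 : 0 ≤ B := (norm_nonneg _).trans (hB 0 0)
  obtain ⟨f, hfs, hf, hφf⟩ := hchar x s ⟨hpa, by linarith⟩
  have hse : s + e ∈ Icc s S := ⟨by linarith, heS⟩
  have hf' := hf.mono le_rfl heS
  have hd : ∀ r ∈ Icc s (s + e), HasDerivWithinAt (fun r => f r - (r - s) • u) (w r (f r) - u)
      (Icc s (s + e)) r := by
    intro r hr
    have := (hf' r hr).sub (((hasDerivWithinAt_id r (Icc s (s + e))).sub_const s).smul_const u)
    rw [one_smul] at this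
    exact this
  have hb : ∀ r ∈ Ico s (s + e), ‖w r (f r) - u‖ ≤ κ := by
    intro r hr
    refine hκ _ _ ?_
    have h1 := hf.norm_sub_le hB (left_mem_Icc.2 (by linarith)) ⟨hr.1, hr.2.le.trans heS⟩ hr.1
    rw [hfs] at h1
    have h2 : dist (f r, r) (x, s) ≤ (1 + B) * e := by
      rw [Prod.dist_eq]
      refine max_le ?_ ?_
      · simp only [dist_eq_norm]
        refine h1.trans ?_
        have : B * (r - s) ≤ B * e := by gcongr; linarith [hr.2]
        linarith
      · simp only [Real.dist_eq]
        rw [abs_of_nonneg (by linarith [hr.1])]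
        nlinarith [hr.2]
    linarith [dist_triangle (f r, r) (x, s) z]
  have key := norm_image_sub_le_of_norm_deriv_le_segment' hd hb (s + e) ⟨by linarith, le_rfl⟩
  simp only [add_sub_cancel_left, sub_self, zero_smul, sub_zero, hfs] at key
  rw [← hφf _ hse, ← Real.dist_eq]
  refine (hφ.dist_le_mul _ _).trans ?_
  gcongr
  rw [Prod.dist_eq]
  refine max_le ?_ ?_
  · simp only [Prod.fst_add, Prod.smul_fst, dist_eq_norm]
    rw [show x + e • u - f (s + e) = -(f (s + e) - e • u - x) by abel, norm_neg]
    exact key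
  · simp only [Prod.snd_add, Prod.smul_snd, smul_eq_mul, mul_one, dist_self]
    exact (norm_nonneg _).trans key

end Terminal

/-- One-sided difference quotients bound a directional derivative. -/
theorem norm_fderiv_apply_le {V W : Type*} [NormedAddCommGroup V] [NormedSpace ℝ V]
    [NormedAddCommGroup W] [NormedSpace ℝ W] {f : V → W} {z e : V} (hf : DifferentiableAt ℝ f z)
    {C : ℝ} (h : ∀ᶠ r : ℝ in 𝓝[>] 0, ‖f (z + r • e) - f z‖ ≤ C * r) : ‖fderiv ℝ f z e‖ ≤ C := by
  have h1 : HasDerivAt (fun r : ℝ => f (z + r • e)) (fderiv ℝ f z e) 0 := by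
    have h2 : HasDerivAt (fun r : ℝ => z + r • e) e 0 := by
      simpa using ((hasDerivAt_id (0 : ℝ)).smul_const e).const_add z
    have h3 : HasFDerivAt f (fderiv ℝ f z) (z + (0 : ℝ) • e) := by
      rw [zero_smul, add_zero]; exact hf.hasFDerivAt
    exact h3.comp_hasDerivAt 0 h2
  have h4 := h1.tendsto_slope_zero_right.norm
  refine le_of_tendsto h4 ?_
  filter_upwards [h, self_mem_nhdsWithin] with r hr hr0
  have hr0 : (0 : ℝ) < r := hr0
  rw [norm_smul, norm_inv, Real.norm_of_nonneg hr0.le, inv_mul_le_iff₀ hr0, zero_add, zero_smul,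
    add_zero, mul_comm]
  exact hr

open scoped Convolution in
/-- The mollification of a function on space-time by a normalized bump function. -/
def mollify (b : ContDiffBump (0 : E d × ℝ)) (φ : E d × ℝ → ℝ) : E d × ℝ → ℝ :=
  b.normed Measure.addHaar ⋆[ContinuousLinearMap.lsmul ℝ ℝ, Measure.addHaar] φ

section Mollify

variable (b : ContDiffBump (0 : E d × ℝ)) {φ : E d × ℝ → ℝ}

theorem contDiff_mollify (hφ : Continuous φ) : ContDiff ℝ ∞ (mollify b φ) :=
  b.hasCompactSupport_normed.contDiff_convolution_left _ b.contDiff_normed hφ.locallyIntegrable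

theorem abs_mollify_sub_le {Λ : ℝ≥0} (hφ : LipschitzWith Λ φ) (z : E d × ℝ) :
    |mollify b φ z - φ z| ≤ Λ * b.rOut := by
  rw [← Real.dist_eq]
  refine ContDiffBump.dist_normed_convolution_le hφ.continuous.aestronglyMeasurable fun y hy => ?_
  refine (hφ.dist_le_mul _ _).trans ?_
  gcongr
  exact (Metric.mem_ball.1 hy).le

theorem mollify_eq_zero {z : E d × ℝ} (hz : ∀ y ∈ Metric.ball z b.rOut, φ y = 0) :
    mollify b φ z = 0 := by
  have h0 := hz z (Metric.mem_ball_self b.rOut_pos)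
  rw [mollify, ContDiffBump.normed_convolution_eq_right (fun y hy => by rw [hz y hy, h0]), h0]

/-- Mollification averages increments, so it preserves bounds on them. -/
theorem abs_mollify_add_sub_le (hφ : Continuous φ) {z v : E d × ℝ} {C : ℝ}
    (h : ∀ p, dist p z < b.rOut → |φ (p + v) - φ p| ≤ C) :
    |mollify b φ (z + v) - mollify b φ z| ≤ C := by
  have hi : ∀ z, Integrable (fun y => b.normed Measure.addHaar y • φ (z - y)) Measure.addHaar :=
    fun z =>
    (b.continuous_normed.smul (hφ.comp (by fun_prop))).integrable_of_hasCompactSupport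
      b.hasCompactSupport_normed.smul_right
  simp only [mollify, MeasureTheory.convolution_def, ContinuousLinearMap.lsmul_apply]
  rw [← integral_sub (hi _) (hi _), ← Real.norm_eq_abs]
  have hint : ∫ y, b.normed Measure.addHaar y * C ∂Measure.addHaar = C := by
    rw [integral_mul_const, b.integral_normed, one_mul]
  rw [← hint]
  refine norm_integral_le_of_norm_le (b.integrable_normed.mul_const C) (ae_of_all _ fun y => ?_)
  rw [← smul_sub, norm_smul, Real.norm_of_nonneg (b.nonneg_normed y)]
  by_cases hy : y ∈ Metric.ball (0 : E d × ℝ) b.rOut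
  · refine mul_le_mul_of_nonneg_left ?_ (b.nonneg_normed y)
    rw [Real.norm_eq_abs, show z + v - y = z - y + v by abel]
    exact h _ (by simpa [dist_eq_norm] using hy)
  · have : b.normed Measure.addHaar y = 0 := by
      rw [← Function.notMem_support, b.support_normed_eq]; exact hy
    simp [this]

end Mollify

end

/-! ### Lipschitz test functions in the weak formulation -/

section

/-- The transport operator in the weak formulation is a directional derivative in space-time. -/
theorem deriv_add_fderiv_eq {φ : E d × ℝ → ℝ} (hφ : Differentiable ℝ φ) (x : E d) (t : ℝ)
    (u : E d) : deriv (fun r => φ (x, r)) t + fderiv ℝ (fun y => φ (y, t)) x u =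
      fderiv ℝ φ (x, t) (u, 1) := by
  have h1 : HasDerivAt (fun r => φ (x, r)) (fderiv ℝ φ (x, t) (0, 1)) t :=
    (hφ (x, t)).hasFDerivAt.comp_hasDerivAt t ((hasDerivAt_const t x).prodMk (hasDerivAt_id t))
  have h2 : HasFDerivAt (fun y => φ (y, t))
      ((fderiv ℝ φ (x, t)).comp (ContinuousLinearMap.inl ℝ (E d) ℝ)) x :=
    (hφ (x, t)).hasFDerivAt.comp x ((hasFDerivAt_id x).prodMk (hasFDerivAt_const t x))
  rw [h1.deriv, h2.fderiv, ContinuousLinearMap.comp_apply, ContinuousLinearMap.inl_apply, add_comm,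
    ← map_add]
  simp

theorem fderiv_eq_zero_of_notMem_tsupport {φ : E d × ℝ → ℝ} {p : E d × ℝ} (hp : p ∉ tsupport φ) :
    fderiv ℝ φ p = 0 := by
  by_contra h
  exact hp (support_fderiv_subset ℝ h)

/-- The weak formulation of the linear transport equation with velocity `v`, initial value `m₀`. -/
def IsWeakTransport (v : ℝ → E d → E d) (T : ℝ) (ν : ℝ → Measure (E d)) (m₀ : Measure (E d)) :
    Prop :=
  ∀ φ : E d × ℝ → ℝ, IsTestFunction T φ →
    (∫ t in (0 : ℝ)..T, ∫ x, (deriv (fun r => φ (x, r)) t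
        + fderiv ℝ (fun y => φ (y, t)) x (v t x)) ∂(ν t)) + ∫ x, φ (x, 0) ∂m₀ = 0

/-- The commutator estimate: on a mollified Lipschitz function that is constant along
characteristics, the transport operator is small, because the field oscillates little on the scale
of the mollification. -/
theorem abs_fderiv_mollify_le {w : ℝ → E d → E d} {φ : E d × ℝ → ℝ} {Λ : ℝ≥0}
    (hφ : LipschitzWith Λ φ) {a S : ℝ}
    (hchar : ∀ x s, s ∈ Ico a S → ∃ f, f s = x ∧ IsSolutionOn w s S f ∧
      ∀ t ∈ Icc s S, φ (f t, t) = φ (x, s))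
    {B : ℝ} (hB : ∀ t x, ‖w t x‖ ≤ B) (b : ContDiffBump (0 : E d × ℝ)) {z : E d × ℝ} {κ δ : ℝ}
    (hκ : ∀ y r, dist (y, r) z < δ → ‖w r y - w z.2 z.1‖ ≤ κ) (hb : b.rOut < δ / 2)
    (hz1 : a ≤ z.2 - b.rOut) (hz2 : z.2 + b.rOut < S) :
    |fderiv ℝ (mollify b φ) z (w z.2 z.1, 1)| ≤ Λ * κ := by
  have hb0 := b.rOut_pos
  have hB0 : 0 ≤ B := (norm_nonneg _).trans (hB 0 0)
  rw [← Real.norm_eq_abs]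
  refine norm_fderiv_apply_le ((contDiff_mollify b hφ.continuous).differentiable (by simp) z) ?_
  have hm : 0 < min (S - (z.2 + b.rOut)) (δ / 2 / (1 + B)) :=
    lt_min (by linarith) (by have : 0 < δ := by linarith
                             positivity)
  filter_upwards [Ioo_mem_nhdsGT hm] with e he
  have h1 : e < S - (z.2 + b.rOut) := he.2.trans_le (min_le_left _ _)
  have h2 : e < δ / 2 / (1 + B) := he.2.trans_le (min_le_right _ _)
  rw [lt_div_iff₀ (by positivity), mul_comm] at h2
  rw [mul_assoc]
  refine abs_mollify_add_sub_le b hφ.continuous fun p hp => ?_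
  have hp2 : |p.2 - z.2| < b.rOut := lt_of_le_of_lt (le_max_right _ _) hp
  rw [abs_lt] at hp2
  exact abs_sub_le_of_constant_along hφ hchar hB hκ (hp.trans hb) (by linarith) he.1
    (by linarith) h2

/-- A cutoff supported before `S` vanishes on a left neighbourhood of `S`; this leaves room for the
mollification in time. -/
theorem exists_gap {χ : ℝ → ℝ} (hχ : HasCompactSupport χ) {S : ℝ} (hS : tsupport χ ⊆ Iio S) :
    ∃ γ, 0 < γ ∧ ∀ t, S - γ < t → t ∉ tsupport χ := by
  rcases (tsupport χ).eq_empty_or_nonempty with h | h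
  · exact ⟨1, one_pos, fun t _ => by simp [h]⟩
  · have hm := hχ.sSup_mem h
    refine ⟨S - sSup (tsupport χ), sub_pos.2 (hS hm), fun t ht hmem => ?_⟩
    have := le_csSup hχ.bddAbove hmem
    linarith

/-- Test functions need to be smooth, but a Lipschitz function `φ` that is constant along
characteristics may be used as a test function, up to a cutoff `χ` in time. Its mollifications are
smooth, and on them the transport operator is uniformly small: this commutator estimate needs only
the continuity of the velocity field and the Lipschitz bound on `φ`. Constancy along characteristics
is asked from a negative time on, since mollification at times near `0` looks back in time. -/
theorem IsWeakTransport.integral_eq {v w : ℝ → E d → E d} {T S : ℝ} (hS : 0 < S) (hST : S < T)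
    {ν : ℝ → Measure (E d)} {m₀ : Measure (E d)} [IsProbabilityMeasure m₀]
    (hν : ContinuousP1On ν (Icc 0 S)) (hweak : IsWeakTransport v T ν m₀)
    (hw : Continuous fun q : ℝ × E d => w q.1 q.2) {B : ℝ} (hB : ∀ t x, ‖w t x‖ ≤ B)
    {φ : E d × ℝ → ℝ} {Λ : ℝ≥0} (hφ : LipschitzWith Λ φ)
    (hchar : ∀ x s, s ∈ Ico (-1) S → ∃ f, f s = x ∧ IsSolutionOn w s S f ∧
      ∀ t ∈ Icc s S, φ (f t, t) = φ (x, s))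
    {ρ : ℝ} (hφρ : ∀ x s, ρ < ‖x‖ → φ (x, s) = 0)
    (hvw : ∀ t ∈ Icc 0 S, ∀ x, ‖x‖ ≤ ρ + 1 → v t x = w t x)
    {χ : ℝ → ℝ} (hχ : ContDiff ℝ ∞ χ) (hχc : HasCompactSupport χ) (hχS : tsupport χ ⊆ Iio S) :
    (∫ t in (0 : ℝ)..S, deriv χ t * ∫ x, φ (x, t) ∂(ν t)) + χ 0 * ∫ x, φ (x, 0) ∂m₀ = 0 := by
  obtain ⟨γ, hγ, hχγ⟩ := exists_gap hχc hχS
  obtain ⟨C₀, hC₀⟩ := hχ.continuous.bounded_above_of_compact_support hχc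
  obtain ⟨C₁, hC₁⟩ := (hχ.continuous_deriv (by simp)).bounded_above_of_compact_support hχc.deriv
  have hC₀0 : 0 ≤ C₀ := (norm_nonneg _).trans (hC₀ 0)
  have hC₁0 : 0 ≤ C₁ := (norm_nonneg _).trans (hC₁ 0)
  have hφc := hφ.continuous
  have hφint : ∀ (m : Measure (E d)) [IsProbabilityMeasure m] (t : ℝ),
      Integrable (fun x => φ (x, t)) m := by
    intro m _ t
    refine Integrable.of_bound (C := Λ * (2 * (|ρ| + 1)) + |φ (0, t)|) (by fun_prop)
      (ae_of_all _ fun x => ?_)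
    by_cases hx : ρ < ‖x‖
    · rw [hφρ x t hx, norm_zero]; positivity
    · have h1 := hφ.dist_le_mul (x, t) (0, t)
      have h2 : dist (x, t) ((0 : E d), t) ≤ 2 * (|ρ| + 1) := by
        simp only [Prod.dist_eq, dist_zero_right, dist_self]
        exact max_le (by linarith [le_abs_self ρ, abs_nonneg ρ]) (by positivity)
      rw [Real.dist_eq] at h1
      have h3 : |φ (x, t) - φ (0, t)| ≤ Λ * (2 * (|ρ| + 1)) := h1.trans (by gcongr)
      rw [Real.norm_eq_abs]
      have := abs_sub_abs_le_abs_sub (φ (x, t)) (φ (0, t))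
      linarith
  have hmcont : ContinuousOn (fun t => ∫ x, φ (x, t) ∂(ν t)) (Icc 0 S) := by
    have := hν.continuousOn_integral (P := ℝ) (Ψ := fun t x => φ (x, t)) (by
      exact hφc.comp (by fun_prop : Continuous fun p : ℝ × E d => (p.2, p.1))) (fun t₀ => by
      refine ⟨Λ + (Λ + |φ (0, t₀)|), ?_⟩
      filter_upwards [Metric.ball_mem_nhds t₀ one_pos] with t ht x
      have h1 := hφ.dist_le_mul (x, t) (0, t₀)
      have h2 : dist (x, t) ((0 : E d), t₀) ≤ ‖x‖ + 1 := by
        simp only [Prod.dist_eq, dist_zero_right]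
        exact max_le (by linarith) (by linarith [Metric.mem_ball.1 ht, norm_nonneg x])
      rw [Real.dist_eq] at h1
      have h3 : |φ (x, t) - φ (0, t₀)| ≤ Λ * (‖x‖ + 1) := h1.trans (by gcongr)
      rw [Real.norm_eq_abs]
      have := abs_sub_abs_le_abs_sub (φ (x, t)) (φ (0, t₀))
      have h4 : 0 ≤ (Λ + |φ (0, t₀)|) * ‖x‖ := by positivity
      have h5 : (0 : ℝ) ≤ Λ := Λ.2
      nlinarith)
    exact this.comp (f := fun t => (t, t)) (by fun_prop) (fun t ht => ⟨ht, trivial⟩)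
  set c := ∫ x, φ (x, 0) ∂m₀ with hc
  set D := S * (C₁ * Λ + C₀ * Λ) + C₀ * Λ with hD
  have hD0 : 0 ≤ D := by positivity
  -- it suffices to bound the left hand side by multiples of every small `κ`
  suffices H : ∀ κ : ℝ, 0 < κ →
      |(∫ t in (0 : ℝ)..S, deriv χ t * ∫ x, φ (x, t) ∂(ν t)) + χ 0 * c| ≤ D * κ by
    have hlim : Tendsto (fun κ : ℝ => D * κ) (𝓝[>] 0) (𝓝 0) := by
      have : Tendsto (fun κ : ℝ => D * κ) (𝓝 0) (𝓝 (D * 0)) :=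
        tendsto_const_nhds.mul tendsto_id
      rw [mul_zero] at this
      exact this.mono_left nhdsWithin_le_nhds
    have := ge_of_tendsto hlim (by
      filter_upwards [self_mem_nhdsWithin] with κ hκ using H κ hκ)
    exact abs_eq_zero.1 (le_antisymm this (abs_nonneg _))
  intro κ hκ
  -- uniform continuity of the field on a compact set yields the mollification radius
  obtain ⟨δ, hδ, hδw⟩ : ∃ δ, 0 < δ ∧ ∀ z ∈ Metric.closedBall (0 : E d) (ρ + 1) ×ˢ Icc 0 S,
      ∀ y r, dist (y, r) z < δ → ‖w r y - w z.2 z.1‖ ≤ κ := by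
    have hK : IsCompact (Metric.closedBall (0 : E d) (ρ + 1) ×ˢ Icc 0 S) :=
      (isCompact_closedBall _ _).prod isCompact_Icc
    have hw' : Continuous fun z : E d × ℝ => w z.2 z.1 := hw.comp continuous_swap
    obtain ⟨δ, hδ, h⟩ := Metric.mem_uniformity_dist.1 (hK.uniformContinuousAt_of_continuousAt
      (fun z : E d × ℝ => w z.2 z.1) (fun z _ => hw'.continuousAt)
      (Metric.dist_mem_uniformity hκ))
    refine ⟨δ, hδ, fun z hz y r hyr => ?_⟩
    have := h (a := z) (b := (y, r)) (by rwa [dist_comm]) hz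
    rw [← dist_eq_norm, dist_comm]
    exact (show dist (w z.2 z.1) (w r y) < κ from this).le
  set r := min (min (δ / 4) (γ / 2)) (min (1 / 2) κ) with hr
  have hr0 : 0 < r := by positivity
  have hr1 : r ≤ δ / 4 := (min_le_left _ _).trans (min_le_left _ _)
  have hr2 : r ≤ γ / 2 := (min_le_left _ _).trans (min_le_right _ _)
  have hr3 : r ≤ 1 / 2 := (min_le_right _ _).trans (min_le_left _ _)
  have hr4 : r ≤ κ := (min_le_right _ _).trans (min_le_right _ _)
  let b : ContDiffBump (0 : E d × ℝ) := ⟨r / 2, r, by positivity, by linarith⟩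
  have hbr : b.rOut = r := rfl
  set φr := mollify b φ with hφr
  have hφr_smooth : ContDiff ℝ ∞ φr := contDiff_mollify b hφc
  have hφr_close : ∀ z, |φr z - φ z| ≤ Λ * κ := fun z =>
    (abs_mollify_sub_le b hφ z).trans (by rw [hbr]; gcongr)
  have hφr_zero : ∀ x t, ρ + r < ‖x‖ → φr (x, t) = 0 := by
    intro x t hx
    refine mollify_eq_zero b fun y hy => hφρ _ _ ?_
    have h1 : ‖x - y.1‖ < r := by
      rw [← dist_eq_norm, dist_comm]
      exact lt_of_le_of_lt (le_max_left _ _) hy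
    have := norm_sub_norm_le x y.1
    linarith
  have hφr_fderiv : ∀ x t, t ∈ Icc 0 (S - γ) → |fderiv ℝ φr (x, t) (w t x, 1)| ≤ Λ * κ := by
    intro x t ht
    by_cases hx : ‖x‖ ≤ ρ + 1
    · exact abs_fderiv_mollify_le (z := (x, t)) hφ hchar hB b
        (hδw (x, t) ⟨by simpa using hx, ht.1, by linarith [ht.2]⟩) (by rw [hbr]; linarith)
        (by rw [hbr]; simp only; linarith [ht.1]) (by rw [hbr]; simp only; linarith [ht.2])
    · have h0 : φr =ᶠ[𝓝 (x, t)] fun _ => 0 := by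
        have hx' : ρ + r < ‖((x, t) : E d × ℝ).1‖ := by
          simp only; linarith [not_le.1 hx]
        filter_upwards [(continuous_fst.norm.isOpen_preimage _ isOpen_Ioi).mem_nhds
          (show ((x, t) : E d × ℝ) ∈ (fun p : E d × ℝ => ‖p.1‖) ⁻¹' Ioi (ρ + r) from hx')] with p hp
        exact hφr_zero p.1 p.2 hp
      rw [h0.fderiv_eq]
      simp only [fderiv_fun_const, Pi.zero_apply, zero_apply, abs_zero]
      positivity
  set Φ : E d × ℝ → ℝ := fun p => χ p.2 * φr p with hΦ
  have hΦ_smooth : ContDiff ℝ ∞ Φ := (hχ.comp contDiff_snd).mul hφr_smooth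
  have hsub : tsupport Φ ⊆ Metric.closedBall (0 : E d) (ρ + 1) ×ˢ tsupport χ := by
    refine closure_minimal ?_ (Metric.isClosed_closedBall.prod (isClosed_tsupport χ))
    intro p hp
    have hp' : χ p.2 * φr p ≠ 0 := hp
    refine ⟨?_, subset_tsupport χ (left_ne_zero_of_mul hp')⟩
    rw [mem_closedBall_zero_iff]
    by_contra hcon
    exact right_ne_zero_of_mul hp' (hφr_zero p.1 p.2 (by linarith [not_le.1 hcon]))
  have hΦc : HasCompactSupport Φ :=
    ((isCompact_closedBall _ _).prod hχc).of_isClosed_subset (isClosed_tsupport Φ) hsub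
  have hΦtest : IsTestFunction T Φ := ⟨hΦ_smooth, hΦc, fun p hp =>
    ⟨trivial, (hχS (hsub hp).2).trans hST⟩⟩
  have hΦfd : ∀ x t u, fderiv ℝ Φ (x, t) (u, 1) =
      deriv χ t * φr (x, t) + χ t * fderiv ℝ φr (x, t) (u, 1) := by
    intro x t u
    have h1 : HasFDerivAt (fun p : E d × ℝ => χ p.2)
        (deriv χ t • ContinuousLinearMap.snd ℝ (E d) ℝ) (x, t) :=
      ((hχ.differentiable (by simp) t).hasDerivAt).comp_hasFDerivAt (x, t) hasFDerivAt_snd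
    have h2 := h1.mul (hφr_smooth.differentiable (by simp) (x, t)).hasFDerivAt
    rw [show fderiv ℝ Φ (x, t) = _ from h2.fderiv]
    simp only [add_apply, smul_apply, ContinuousLinearMap.coe_snd', smul_eq_mul]
    ring
  -- the transport operator of `v` and of `w` agree on `Φ`
  set Ψ : ℝ → E d → ℝ := fun t x => fderiv ℝ Φ (x, t) (w t x, 1) with hΨ
  have hΨv : ∀ t, 0 ≤ t → ∀ x, fderiv ℝ Φ (x, t) (v t x, 1) = Ψ t x := by
    intro t ht x
    by_cases hm : (x, t) ∈ tsupport Φ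
    · have h := hsub hm
      rw [hvw t ⟨ht, (hχS h.2).le⟩ x (by simpa using h.1)]
    · have : fderiv ℝ Φ (x, t) = 0 := fderiv_eq_zero_of_notMem_tsupport hm
      simp [hΨ, this]
  have hΨ0 : ∀ t, S ≤ t → ∀ x, Ψ t x = 0 := by
    intro t ht x
    have : fderiv ℝ Φ (x, t) = 0 := fderiv_eq_zero_of_notMem_tsupport fun hm =>
      (hχS (hsub hm).2).not_ge ht
    simp [hΨ, this]
  have hΨc : Continuous (Function.uncurry Ψ) := by
    have h1 : Continuous (fderiv ℝ Φ) := hΦ_smooth.continuous_fderiv (by simp)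
    exact (h1.comp (by fun_prop : Continuous fun p : ℝ × E d => (p.2, p.1))).clm_apply
      (hw.prodMk continuous_const)
  obtain ⟨CΨ, hCΨ⟩ : ∃ C, ∀ t x, ‖Ψ t x‖ ≤ C := by
    have hcs : HasCompactSupport fun p : E d × ℝ => Ψ p.2 p.1 := by
      refine hΦc.of_isClosed_subset (isClosed_tsupport _) (closure_minimal ?_ (isClosed_tsupport _))
      intro p hp
      by_contra hm
      have : fderiv ℝ Φ p = 0 := fderiv_eq_zero_of_notMem_tsupport hm
      exact hp (by simp [hΨ, this])
    obtain ⟨C, hC⟩ := (hΨc.comp continuous_swap).bounded_above_of_compact_support hcs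
    exact ⟨C, fun t x => hC (x, t)⟩
  have hCΨ0 : 0 ≤ CΨ := (norm_nonneg _).trans (hCΨ 0 0)
  have hIcont : ContinuousOn (fun t => ∫ x, Ψ t x ∂(ν t)) (Icc 0 S) := by
    have := hν.continuousOn_integral (P := ℝ) hΨc (fun t₀ => ⟨CΨ, Eventually.of_forall fun t x =>
      (hCΨ t x).trans (by nlinarith [mul_nonneg hCΨ0 (norm_nonneg x)])⟩)
    exact this.comp (f := fun t => (t, t)) (by fun_prop) (fun t ht => ⟨ht, trivial⟩)
  have hweakΦ := hweak Φ hΦtest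
  have e1 : (∫ t in (0 : ℝ)..T, ∫ x, (deriv (fun r => Φ (x, r)) t
        + fderiv ℝ (fun y => Φ (y, t)) x (v t x)) ∂(ν t)) =
      ∫ t in (0 : ℝ)..S, ∫ x, Ψ t x ∂(ν t) := by
    rw [intervalIntegral.integral_of_le (hS.trans hST).le, intervalIntegral.integral_of_le hS.le]
    have h1 : ∀ t ∈ Ioc 0 T, ∫ x, (deriv (fun r => Φ (x, r)) t
        + fderiv ℝ (fun y => Φ (y, t)) x (v t x)) ∂(ν t) = ∫ x, Ψ t x ∂(ν t) := by
      intro t ht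
      refine integral_congr_ae (ae_of_all _ fun x => ?_)
      simp only
      rw [deriv_add_fderiv_eq (hΦ_smooth.differentiable (by simp)), hΨv t ht.1.le]
    rw [setIntegral_congr_fun measurableSet_Ioc h1]
    refine (setIntegral_eq_of_subset_of_forall_sdiff_eq_zero measurableSet_Ioc
      (Ioc_subset_Ioc_right hST.le) fun t ht => ?_)
    have : S ≤ t := by
      by_contra hcon
      exact ht.2 ⟨ht.1.1, (not_le.1 hcon).le⟩
    simp [hΨ0 t this]
  have e2 : ∫ x, Φ (x, 0) ∂m₀ = χ 0 * ∫ x, φr (x, 0) ∂m₀ :=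
    integral_const_mul (χ 0) fun x => φr (x, 0)
  rw [e1, e2] at hweakΦ
  -- comparison of the two identities
  have hdiff : ∀ t ∈ Icc 0 S, |deriv χ t * (∫ x, φ (x, t) ∂(ν t)) - ∫ x, Ψ t x ∂(ν t)| ≤
      (C₁ * Λ + C₀ * Λ) * κ := by
    intro t ht
    have := (hν.1 t ht).1
    have hΨi : Integrable (Ψ t) (ν t) := Integrable.of_bound (C := CΨ)
      (hΨc.comp (by fun_prop : Continuous fun x : E d => (t, x))).aestronglyMeasurable
      (ae_of_all _ fun x => hCΨ t x)
    rw [← integral_const_mul, ← integral_sub ((hφint _ t).const_mul _) hΨi, ← Real.norm_eq_abs]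
    refine (norm_integral_le_of_norm_le (integrable_const ((C₁ * Λ + C₀ * Λ) * κ))
      (ae_of_all _ fun x => ?_)).trans_eq (by simp)
    simp only [hΨ]
    rw [hΦfd, ← sub_sub, ← mul_sub]
    refine (norm_sub_le _ _).trans ?_
    rw [norm_mul, norm_mul, add_mul, mul_assoc, mul_assoc]
    have h1 : ‖φ (x, t) - φr (x, t)‖ ≤ Λ * κ := by
      rw [norm_sub_rev]; exact hφr_close _
    have h2 : ‖χ t‖ * ‖fderiv ℝ φr (x, t) (w t x, 1)‖ ≤ C₀ * (Λ * κ) := by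
      by_cases htγ : t ≤ S - γ
      · exact mul_le_mul (hC₀ t) (hφr_fderiv x t ⟨ht.1, htγ⟩) (norm_nonneg _) hC₀0
      · rw [image_eq_zero_of_notMem_tsupport (hχγ t (not_le.1 htγ)), norm_zero, zero_mul]
        positivity
    exact add_le_add (mul_le_mul (hC₁ t) h1 (norm_nonneg _) hC₁0) h2
  have hcdiff : |c - ∫ x, φr (x, 0) ∂m₀| ≤ Λ * κ := by
    have hφri : Integrable (fun x => φr (x, 0)) m₀ := by
      refine ((hφint m₀ 0).norm.add (integrable_const (Λ * κ))).mono'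
        (hφr_smooth.continuous.comp (by fun_prop)).aestronglyMeasurable (ae_of_all _ fun x => ?_)
      have h1 := hφr_close (x, 0)
      have h2 := abs_sub_abs_le_abs_sub (φr (x, 0)) (φ (x, 0))
      simp only [Real.norm_eq_abs, Pi.add_apply]
      linarith
    rw [hc, ← integral_sub (hφint _ 0) hφri, ← Real.norm_eq_abs]
    refine (norm_integral_le_of_norm_le (integrable_const (Λ * κ))
      (ae_of_all _ fun x => ?_)).trans_eq (by simp)
    rw [norm_sub_rev]
    exact hφr_close _
  have i1 : IntervalIntegrable (fun t => deriv χ t * ∫ x, φ (x, t) ∂(ν t)) volume 0 S := by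
    refine ContinuousOn.intervalIntegrable ?_
    rw [uIcc_of_le hS.le]
    exact (hχ.continuous_deriv (by simp)).continuousOn.mul hmcont
  have i2 : IntervalIntegrable (fun t => ∫ x, Ψ t x ∂(ν t)) volume 0 S := by
    refine ContinuousOn.intervalIntegrable ?_
    rw [uIcc_of_le hS.le]
    exact hIcont
  have e3 : (∫ t in (0 : ℝ)..S, deriv χ t * ∫ x, φ (x, t) ∂(ν t)) + χ 0 * c =
      (∫ t in (0 : ℝ)..S, (deriv χ t * (∫ x, φ (x, t) ∂(ν t)) - ∫ x, Ψ t x ∂(ν t))) +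
        χ 0 * (c - ∫ x, φr (x, 0) ∂m₀) := by
    rw [intervalIntegral.integral_sub i1 i2]
    linear_combination hweakΦ
  rw [e3]
  have h1 : ‖∫ t in (0 : ℝ)..S, (deriv χ t * (∫ x, φ (x, t) ∂(ν t)) - ∫ x, Ψ t x ∂(ν t))‖ ≤
      (C₁ * Λ + C₀ * Λ) * κ * |S - 0| :=
    intervalIntegral.norm_integral_le_of_norm_le_const fun t ht => by
      rw [uIoc_of_le hS.le] at ht
      exact hdiff t ⟨ht.1.le, ht.2⟩
  have h2 : |χ 0 * (c - ∫ x, φr (x, 0) ∂m₀)| ≤ C₀ * (Λ * κ) := by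
    rw [abs_mul]
    exact mul_le_mul (hC₀ 0) hcdiff (abs_nonneg _) hC₀0
  rw [sub_zero, abs_of_pos hS, Real.norm_eq_abs] at h1
  refine (abs_add_le _ _).trans ((add_le_add h1 h2).trans_eq ?_)
  rw [hD]; ring

end

/-! ### Uniqueness for the linear transport equation -/

section

theorem intervalIntegral_normed_eq_one {c : ℝ} (b : ContDiffBump c) {l u : ℝ}
    (hl : l ≤ c - b.rOut) (hu : c + b.rOut ≤ u) : ∫ t in l..u, b.normed volume t = 1 := by
  rw [intervalIntegral.integral_eq_integral_of_support_subset, b.integral_normed]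
  rw [b.support_normed_eq, Real.ball_eq_Ioo]
  exact (Ioo_subset_Ioo hl hu).trans Ioo_subset_Ioc_self

theorem normed_eq_zero_of_le {c : ℝ} (b : ContDiffBump c) {t : ℝ} (h : b.rOut ≤ |t - c|) :
    b.normed volume t = 0 := by
  rw [← Function.notMem_support, b.support_normed_eq, Metric.mem_ball, Real.dist_eq]
  exact h.not_gt

theorem intervalIntegral_normed_eq_zero {c : ℝ} (b : ContDiffBump c) {l u : ℝ} (hlu : l ≤ u)
    (h : u ≤ c - b.rOut ∨ c + b.rOut ≤ l) : ∫ t in l..u, b.normed volume t = 0 := by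
  rw [← intervalIntegral.integral_zero (a := l) (b := u) (μ := volume)]
  refine intervalIntegral.integral_congr fun t ht => normed_eq_zero_of_le b ?_
  rw [uIcc_of_le hlu] at ht
  rcases h with h | h
  · rw [abs_sub_comm]; exact le_trans (by linarith [ht.2]) (le_abs_self _)
  · exact le_trans (by linarith [ht.1]) (le_abs_self _)

/-- If the distributional derivative of `m` on `[0, S)` vanishes, and `m` has initial value `c` in
the weak sense, then `m = c` up to time `S`. The time cutoff is the primitive of the difference of a
bump at a negative time and a bump just before `S`. -/
theorem eq_of_forall_weak_deriv {m : ℝ → ℝ} {S c : ℝ} (hS : 0 < S) (hm : ContinuousOn m (Icc 0 S))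
    (h : ∀ χ : ℝ → ℝ, ContDiff ℝ ∞ χ → HasCompactSupport χ → tsupport χ ⊆ Iio S →
      (∫ t in (0 : ℝ)..S, deriv χ t * m t) + χ 0 * c = 0) : m S = c := by
  refine (eq_of_forall_dist_le fun ε hε => ?_)
  obtain ⟨δ, hδ, hmδ⟩ := Metric.continuousWithinAt_iff.1 (hm S (right_mem_Icc.2 hS.le)) ε hε
  -- `b₁` lives at negative times, so on `[0, S]` the derivative of `χ` is `-b₂`, while `χ 0 = 1`;
  -- `b₂` averages over a short interval just before `S`
  set r := min (δ / 4) (S / 4) with hr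
  have hr0 : 0 < r := by positivity
  have hrδ : r ≤ δ / 4 := min_le_left _ _
  have hrS : r ≤ S / 4 := min_le_right _ _
  let b₁ : ContDiffBump (-1 : ℝ) := ⟨1 / 4, 1 / 2, by norm_num, by norm_num⟩
  let b₂ : ContDiffBump (S - 2 * r) := ⟨r / 2, r, by positivity, by linarith⟩
  have hb₁ : b₁.rOut = 1 / 2 := rfl
  have hb₂ : b₂.rOut = r := rfl
  set θ : ℝ → ℝ := fun t => b₁.normed volume t - b₂.normed volume t with hθ
  have hθs : ContDiff ℝ ∞ θ := b₁.contDiff_normed.sub b₂.contDiff_normed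
  have hint : ∀ l u, IntervalIntegrable (b₁.normed volume) volume l u := fun l u =>
    b₁.continuous_normed.intervalIntegrable l u
  have hint2 : ∀ l u, IntervalIntegrable (b₂.normed volume) volume l u := fun l u =>
    b₂.continuous_normed.intervalIntegrable l u
  set χ : ℝ → ℝ := fun t => ∫ s in (-2 : ℝ)..t, θ s with hχ
  have hχe : ∀ t, χ t = (∫ s in (-2 : ℝ)..t, b₁.normed volume s) -
      ∫ s in (-2 : ℝ)..t, b₂.normed volume s := fun t =>
    intervalIntegral.integral_sub (hint _ _) (hint2 _ _)
  have hχd : ∀ t, HasDerivAt χ (θ t) t := fun t =>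
    intervalIntegral.integral_hasDerivAt_right (hθs.continuous.intervalIntegrable _ _)
      (hθs.continuous.stronglyMeasurableAtFilter _ _) hθs.continuous.continuousAt
  have hχd' : deriv χ = θ := funext fun t => (hχd t).deriv
  have hχs : ContDiff ℝ ∞ χ := contDiff_infty_iff_deriv.2
    ⟨fun t => (hχd t).differentiableAt, hχd' ▸ hθs⟩
  have hsupp : Function.support χ ⊆ Icc (-2) (S - r) := by
    intro t ht
    by_contra hcon
    refine ht ?_
    rcases lt_or_ge t (-2) with h2 | h2
    · rw [hχe, intervalIntegral.integral_symm, intervalIntegral.integral_symm t (-2),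
        intervalIntegral_normed_eq_zero b₁ h2.le (Or.inl (by rw [hb₁]; norm_num)),
        intervalIntegral_normed_eq_zero b₂ h2.le (Or.inl (by rw [hb₂]; linarith))]
      simp
    · have h3 : S - r < t := by
        by_contra h3
        exact hcon ⟨h2, not_lt.1 h3⟩
      rw [hχe, intervalIntegral_normed_eq_one b₁ (by rw [hb₁]; norm_num) (by rw [hb₁]; linarith),
        intervalIntegral_normed_eq_one b₂ (by rw [hb₂]; linarith) (by rw [hb₂]; linarith), sub_self]
  have hts : tsupport χ ⊆ Icc (-2) (S - r) := closure_minimal hsupp isClosed_Icc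
  have hχ0 : χ 0 = 1 := by
    rw [hχe, intervalIntegral_normed_eq_one b₁ (by rw [hb₁]; norm_num) (by rw [hb₁]; norm_num),
      intervalIntegral_normed_eq_zero b₂ (by norm_num) (Or.inl (by rw [hb₂]; linarith)), sub_zero]
  have key := h χ hχs (isCompact_Icc.of_isClosed_subset (isClosed_tsupport _) hts)
    (hts.trans fun t ht => lt_of_le_of_lt ht.2 (by linarith))
  have hb₂int : ∫ t in (0 : ℝ)..S, b₂.normed volume t = 1 :=
    intervalIntegral_normed_eq_one b₂ (by rw [hb₂]; linarith) (by rw [hb₂]; linarith)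
  have e1 : ∫ t in (0 : ℝ)..S, deriv χ t * m t = -∫ t in (0 : ℝ)..S, b₂.normed volume t * m t := by
    rw [← intervalIntegral.integral_neg]
    refine intervalIntegral.integral_congr fun t ht => ?_
    rw [uIcc_of_le hS.le] at ht
    simp only [hχd', hθ]
    rw [normed_eq_zero_of_le b₁ (by
      rw [hb₁, sub_neg_eq_add, abs_of_nonneg (by linarith [ht.1])]; linarith [ht.1])]
    ring
  rw [e1, hχ0, one_mul] at key
  have hc : c = ∫ t in (0 : ℝ)..S, b₂.normed volume t * m t := by linarith
  have hi1 : IntervalIntegrable (fun t => b₂.normed volume t * m S) volume 0 S :=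
    (hint2 0 S).mul_const _
  have hi2 : IntervalIntegrable (fun t => b₂.normed volume t * m t) volume 0 S := by
    refine ContinuousOn.intervalIntegrable ?_
    rw [uIcc_of_le hS.le]
    exact b₂.continuous_normed.continuousOn.mul hm
  have e2 : m S - c = ∫ t in (0 : ℝ)..S,
      (b₂.normed volume t * m S - b₂.normed volume t * m t) := by
    rw [intervalIntegral.integral_sub hi1 hi2, intervalIntegral.integral_mul_const, hb₂int, one_mul,
      hc]
  rw [Real.dist_eq, e2, ← Real.norm_eq_abs]
  have e3 : ∫ t in (0 : ℝ)..S, b₂.normed volume t * ε = ε := by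
    rw [intervalIntegral.integral_mul_const, hb₂int, one_mul]
  rw [← e3]
  refine intervalIntegral.norm_integral_le_of_norm_le hS.le (ae_of_all _ fun t ht => ?_)
    ((hint2 0 S).mul_const _)
  rw [← mul_sub, norm_mul, Real.norm_of_nonneg (b₂.nonneg_normed t)]
  by_cases htr : r ≤ |t - (S - 2 * r)|
  · rw [normed_eq_zero_of_le b₂ (by rw [hb₂]; exact htr), zero_mul, zero_mul]
  · refine mul_le_mul_of_nonneg_left ?_ (b₂.nonneg_normed t)
    have htr := abs_lt.1 (not_le.1 htr)
    have := hmδ ⟨ht.1.le, ht.2⟩ (by rw [Real.dist_eq, abs_lt]; constructor <;> linarith)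
    rw [Real.dist_eq, abs_sub_comm] at this
    exact this.le

/-- Two probability measures that agree on smooth compactly supported functions are equal. -/
theorem measure_eq_of_forall_smooth {μ ν : Measure (E d)} [IsProbabilityMeasure μ]
    [IsProbabilityMeasure ν]
    (h : ∀ η : E d → ℝ, ContDiff ℝ ∞ η → HasCompactSupport η → ∫ x, η x ∂μ = ∫ x, η x ∂ν) :
    μ = ν := by
  -- continuous functions with compact support are uniform limits of their mollifications
  refine Measure.ext_of_integral_eq_on_compactlySupported fun f => ?_
  refine eq_of_forall_dist_le fun ε hε => ?_
  have hf : Continuous f := f.continuous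
  have hfc : HasCompactSupport f := f.hasCompactSupport
  obtain ⟨δ, hδ, hfδ⟩ := Metric.uniformContinuous_iff.1
    (hfc.uniformContinuous_of_continuous hf) (ε / 2) (by positivity)
  let b : ContDiffBump (0 : E d) := ⟨δ / 2, δ, by positivity, by linarith⟩
  set η : E d → ℝ := MeasureTheory.convolution (b.normed volume) f
    (ContinuousLinearMap.lsmul ℝ ℝ) volume with hη
  have hηs : ContDiff ℝ ∞ η :=
    b.hasCompactSupport_normed.contDiff_convolution_left _ b.contDiff_normed hf.locallyIntegrable
  have hηc : HasCompactSupport η := b.hasCompactSupport_normed.convolution _ hfc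
  have hclose : ∀ x, dist (η x) (f x) ≤ ε / 2 := fun x =>
    ContDiffBump.dist_normed_convolution_le hf.aestronglyMeasurable fun y hy => (hfδ hy).le
  have hint : ∀ (m : Measure (E d)) [IsProbabilityMeasure m],
      dist (∫ x, η x ∂m) (∫ x, f x ∂m) ≤ ε / 2 := by
    intro m _
    rw [dist_eq_norm, ← integral_sub (hηs.continuous.integrable_of_hasCompactSupport hηc)
      (hf.integrable_of_hasCompactSupport hfc)]
    refine (norm_integral_le_of_norm_le (integrable_const (ε / 2))
      (ae_of_all _ fun x => ?_)).trans_eq (by simp)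
    rw [← dist_eq_norm]
    exact hclose x
  have h1 := hint μ
  have h2 := hint ν
  rw [h η hηs hηc] at h1
  calc dist (∫ x, f x ∂μ) (∫ x, f x ∂ν)
      ≤ dist (∫ x, f x ∂μ) (∫ x, η x ∂ν) + dist (∫ x, η x ∂ν) (∫ x, f x ∂ν) := dist_triangle _ _ _
    _ ≤ ε / 2 + ε / 2 := add_le_add (by rw [dist_comm]; exact h1) h2
    _ = ε := add_halves ε

/-- Uniqueness for the linear transport equation, by duality: a weak solution is the push-forward of
its initial value along the characteristics. The dual solution is a smooth function composed with
the map to the terminal value of the characteristics. -/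
theorem IsWeakTransport.eq_map {v : ℝ → E d → E d} {T S : ℝ} (hS : 0 < S) (hST : S < T)
    (hv : IsField v S) {ν : ℝ → Measure (E d)} {m₀ : Measure (E d)} [IsProbabilityMeasure m₀]
    (hν : ContinuousP1On ν (Icc 0 S)) (hweak : IsWeakTransport v T ν m₀) {R : ℝ}
    (hm₀ : ∀ᵐ x ∂m₀, ‖x‖ ≤ R) {X : E d → E d} (hXm : Measurable X)
    (hX : ∀ x, ‖x‖ ≤ R → ∃ f, f 0 = x ∧ IsSolutionOn v 0 S f ∧ f S = X x) :
    ν S = m₀.map X := by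
  have hνS := (hν.1 S ⟨hS.le, le_rfl⟩).1
  have := Measure.isProbabilityMeasure_map (μ := m₀) hXm.aemeasurable
  refine measure_eq_of_forall_smooth fun η hη hηc => ?_
  obtain ⟨Λη, hΛη⟩ := ContDiff.lipschitzWith_of_hasCompactSupport hηc hη (by simp)
  obtain ⟨ρη, hρη⟩ := hηc.isBounded.subset_closedBall (0 : E d)
  obtain ⟨A, hA, hgr⟩ := hv.growth
  set ρ₀ := max (max ρη R) 0 with hρ₀
  have hρ₀0 : 0 ≤ ρ₀ := le_max_right _ _
  -- characteristics that meet the ball of radius `ρ₀` at some time in `[-1, S]` stay in the ball of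
  -- radius `ρ`, so the cutoff of the field beyond `ρ + 1` is not felt
  set ρ := (1 + ρ₀) * Real.exp (A * (S - (-1))) with hρ
  have hρ0 : 0 ≤ ρ := by positivity
  have hw := hv.continuous_truncField hS.le (ρ + 1)
  obtain ⟨K, hK⟩ := hv.exists_lipschitzWith_truncField hS.le (ρ := ρ + 1) (by positivity)
  have hB := norm_truncField_le' hS.le hA hgr (ρ := ρ + 1) (by positivity)
  have hgrw : ∀ t ∈ Icc (-1) S, ∀ x, ‖truncField v S (ρ + 1) t x‖ ≤ A * (1 + ‖x‖) := fun t _ x =>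
    norm_truncField_le hS.le hgr (ρ + 1) t x
  set w := truncField v S (ρ + 1) with hwdef
  -- the dual solution `η ∘ Z`, with `Z` the terminal map of the truncated field
  obtain ⟨Z, ΛZ, hZ, hZf, hZu⟩ := exists_terminalMap hw hK hB (a := -1) (S := S) (by linarith)
  have h0 : (0 : ℝ) ∈ Icc (-1) S := ⟨by norm_num, hS.le⟩
  have hSm : S ∈ Icc (-1) S := ⟨by linarith, le_rfl⟩
  have hφ : LipschitzWith (Λη * ΛZ) (η ∘ Z) := hΛη.comp hZ
  have hvw : ∀ t ∈ Icc 0 S, ∀ x, ‖x‖ ≤ ρ + 1 → v t x = w t x := fun t ht x hx =>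
    (truncField_eq ht hx).symm
  have hchar : ∀ x s, s ∈ Ico (-1) S → ∃ f, f s = x ∧ IsSolutionOn w s S f ∧
      ∀ t ∈ Icc s S, (η ∘ Z) (f t, t) = (η ∘ Z) (x, s) := by
    intro x s hs
    obtain ⟨f, hf0, hf, -⟩ := hZf x s
    rw [min_eq_right hs.2.le, max_eq_right hs.1] at hf0
    refine ⟨f, hf0, hf.mono hs.1 le_rfl, fun t ht => ?_⟩
    simp only [Function.comp]
    rw [hZu f t ⟨hs.1.trans ht.1, ht.2⟩ (hf.mono (hs.1.trans ht.1) le_rfl), ← hf0,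
      hZu f s ⟨hs.1, hs.2.le⟩ (hf.mono hs.1 le_rfl)]
  have hφρ : ∀ x s, ρ < ‖x‖ → (η ∘ Z) (x, s) = 0 := by
    intro x s hx
    obtain ⟨f, hf0, hf, hfZ⟩ := hZf x s
    have h1 := hf.one_add_norm_le hA hgrw hSm
      (t := max (-1) (min S s)) ⟨le_max_left _ _, max_le (by linarith) (min_le_left _ _)⟩
    rw [hf0] at h1
    simp only [Function.comp]
    rw [hfZ]
    refine image_eq_zero_of_notMem_tsupport fun hm => ?_
    have h2 : ‖f S‖ ≤ ρ₀ := by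
      have := hρη hm
      rw [mem_closedBall_zero_iff] at this
      exact this.trans ((le_max_left _ _).trans (le_max_left _ _))
    have h3 : (1 + ‖f S‖) * Real.exp (A * (S - (-1))) ≤ ρ := by rw [hρ]; gcongr
    linarith
  have hmcont : ContinuousOn (fun t => ∫ x, (η ∘ Z) (x, t) ∂(ν t)) (Icc 0 S) := by
    obtain ⟨C, hC⟩ := hη.continuous.bounded_above_of_compact_support hηc
    have hC0 : 0 ≤ C := (norm_nonneg _).trans (hC 0)
    have := hν.continuousOn_integral (P := ℝ) (Ψ := fun t x => (η ∘ Z) (x, t))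
      (hφ.continuous.comp (by fun_prop : Continuous fun p : ℝ × E d => (p.2, p.1)))
      (fun t₀ => ⟨C, Eventually.of_forall fun t x => (hC _).trans
        (by nlinarith [mul_nonneg hC0 (norm_nonneg x)])⟩)
    exact this.comp (f := fun t => (t, t)) (by fun_prop) (fun t ht => ⟨ht, trivial⟩)
  have key := eq_of_forall_weak_deriv hS hmcont fun χ hχ hχc hχS =>
    hweak.integral_eq hS hST hν hw hB hφ hchar hφρ hvw hχ hχc hχS
  have e1 : ∀ x, (η ∘ Z) (x, S) = η x := by
    intro x
    obtain ⟨f, hf0, hf, hfZ⟩ := hZf x S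
    rw [min_self, max_eq_right hSm.1] at hf0
    simp only [Function.comp]
    rw [hfZ, hf0]
  have e2 : ∀ x, ‖x‖ ≤ R → (η ∘ Z) (x, 0) = η (X x) := by
    intro x hx
    obtain ⟨f, hf0, hf, hfS⟩ := hX x hx
    have hfb : ∀ t ∈ Icc 0 S, ‖f t‖ ≤ ρ + 1 := by
      intro t ht
      have h1 := hf.one_add_norm_le hA hgr ⟨le_rfl, hS.le⟩ ht
      rw [hf0] at h1
      have h2 : (1 + ‖x‖) * Real.exp (A * (S - 0)) ≤ ρ := by
        rw [hρ]
        gcongr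
        · exact hx.trans ((le_max_right _ _).trans (le_max_left _ _))
        · norm_num
      linarith
    have hfw : IsSolutionOn w 0 S f := hf.congr_field fun t ht => hvw t ht _ (hfb t ht)
    simp only [Function.comp]
    rw [← hfS, ← hZu f 0 h0 hfw, hf0]
  simp only [e1] at key
  rw [key, integral_map hXm.aemeasurable hη.continuous.aestronglyMeasurable]
  refine integral_congr_ae ?_
  filter_upwards [hm₀] with x hx using e2 x hx

end

/-! ### The nonlinear flow -/

section

/-- A bounded family of maps, measurable in space and continuous in time: the flows along which the
initial measure is transported. -/
structure IsFlowMap (ρ : ℝ) (u : ℝ → E d → E d) : Prop where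
  measurable : ∀ t, Measurable (u t)
  continuous : ∀ x, Continuous fun t => u t x
  norm_le : ∀ t x, ‖u t x‖ ≤ ρ

theorem IsFlowMap.mono {ρ ρ' : ℝ} {u : ℝ → E d → E d} (hu : IsFlowMap ρ u) (h : ρ ≤ ρ') :
    IsFlowMap ρ' u := ⟨hu.measurable, hu.continuous, fun t x => (hu.norm_le t x).trans h⟩

theorem IsFlowMap.continuousP1On {ρ : ℝ} {u : ℝ → E d → E d} (hu : IsFlowMap ρ u)
    (m : Measure (E d)) [IsProbabilityMeasure m] (I : Set ℝ) :
    ContinuousP1On (fun t => m.map (u t)) I :=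
  continuousP1On_map m hu.measurable hu.continuous hu.norm_le I

theorem IsFlowMap.integrable {ρ : ℝ} {u : ℝ → E d → E d} (hu : IsFlowMap ρ u)
    (m : Measure (E d)) [IsProbabilityMeasure m] (t : ℝ) : Integrable (fun x => ‖u t x‖) m :=
  Integrable.of_bound (hu.measurable t).norm.aestronglyMeasurable ρ
    (ae_of_all _ fun x => by simpa using hu.norm_le t x)

theorem integral_norm_le_of_ae_le {m : Measure (E d)} [IsProbabilityMeasure m] {u : E d → E d}
    {ρ : ℝ} (h : ∀ᵐ x ∂m, ‖u x‖ ≤ ρ) : ∫ x, ‖u x‖ ∂m ≤ ρ := by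
  have := norm_integral_le_of_norm_le (f := fun x => ‖u x‖) (integrable_const ρ) (by simpa using h)
  simp only [integral_const, probReal_univ, one_smul] at this
  exact (le_abs_self _).trans this

variable {α τ : ℝ → ℝ} {F : Measure (E d) → E d → E d} {g : ℝ → Measure (E d)}

/-- Comparison of the velocity fields generated by two flows: the force is Lipschitz in the flow. -/
theorem exists_velocity_map_sub_le (hF : IsForce F) (hD : IsDelay α τ)
    (hg : ContinuousP1On g (Icc (-τ 0) 0)) (m : Measure (E d)) [IsProbabilityMeasure m] (ρ : ℝ) :
    ∃ K, 0 ≤ K ∧ ∀ u u' : ℝ → E d → E d, IsFlowMap ρ u → IsFlowMap ρ u' → ∀ t, 0 ≤ t →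
      ∀ δ, (∀ s ∈ Icc 0 t, ∀ y, ‖u s y - u' s y‖ ≤ δ) → ∀ x,
      ‖velocity α τ F g (fun s => m.map (u s)) t (u t x) -
        velocity α τ F g (fun s => m.map (u' s)) t (u' t x)‖ ≤ K * (2 * δ) := by
  obtain ⟨M, hM0, hM⟩ := hg.exists_moment_le
  obtain ⟨K, hK, hlip⟩ := hF.lipschitz ρ (max M ρ)
  refine ⟨K, hK, fun u u' hu hu' t ht δ hδ x => ?_⟩
  have htm : t ∈ Icc 0 t := ⟨ht, le_rfl⟩
  have hδ0 : 0 ≤ δ := (norm_nonneg _).trans (hδ t htm x)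
  have hx : ‖u t x - u' t x‖ ≤ δ := hδ t htm x
  refine norm_velocity_sub_le hF hD hg (hu.continuousP1On m _) (hu'.continuousP1On m _) htm
    fun s hs => ?_
  have hs' := hD.sub_mem htm hs
  rcases lt_or_ge s 0 with h | h
  · rw [withHistory_of_neg h, withHistory_of_neg h]
    have hmem : s ∈ Icc (-τ 0) 0 := ⟨hs'.1, h.le⟩
    have h1 := hg.1 s hmem
    have hMs := (hM s hmem).trans (le_max_left M ρ)
    have := hlip (g s) id id 0 (u t x) (u' t x) h1.1 measurable_id measurable_id
      h1.integrable_norm h1.integrable_norm hMs hMs (by simp) (hu.norm_le t x) (hu'.norm_le t x)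
    simp only [Measure.map_id, add_zero] at this
    refine this.trans ?_
    gcongr
    linarith
  · rw [withHistory_of_nonneg h, withHistory_of_nonneg h]
    have := hlip m (u s) (u' s) δ (u t x) (u' t x) inferInstance (hu.measurable s)
      (hu'.measurable s) (hu.integrable m s) (hu'.integrable m s)
      ((integral_norm_le_of_ae_le (ae_of_all _ (hu.norm_le s))).trans (le_max_right _ _))
      ((integral_norm_le_of_ae_le (ae_of_all _ (hu'.norm_le s))).trans (le_max_right _ _))
      (ae_of_all _ fun y => hδ s ⟨h, hs.2.le⟩ y) (hu.norm_le t x) (hu'.norm_le t x)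
    refine this.trans ?_
    gcongr
    linarith

/-- Integration in the weight `exp ((4 K + 1) t)` gains a factor `1 / 2`. -/
theorem norm_le_half_exp {f f' : ℝ → E d} {S K N : ℝ} (hN : 0 ≤ N)
    (hf : ∀ t ∈ Icc 0 S, HasDerivWithinAt f (f' t) (Icc 0 S) t) (h0 : f 0 = 0)
    (hb : ∀ t ∈ Icc 0 S, ‖f' t‖ ≤ K * (2 * (N * Real.exp ((4 * K + 1) * t)))) {t : ℝ}
    (ht : t ∈ Icc 0 S) : ‖f t‖ ≤ N / 2 * Real.exp ((4 * K + 1) * t) := by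
  refine image_norm_le_of_norm_deriv_right_le_deriv_boundary
    (B := fun t => N / 2 * Real.exp ((4 * K + 1) * t))
    (B' := fun t => N / 2 * (Real.exp ((4 * K + 1) * t) * (4 * K + 1)))
    (fun t ht => (hf t ht).continuousWithinAt)
    (fun t ht => hasDerivWithinAt_Ici_of_Icc (hf t ⟨ht.1, ht.2.le⟩) ht) ?_ (fun t => ?_)
    (fun t ht => (hb t ⟨ht.1, ht.2.le⟩).trans ?_) ht
  · rw [h0, norm_zero]; positivity
  · have h1 : HasDerivAt (fun t : ℝ => (4 * K + 1) * t) (4 * K + 1) t := by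
      simpa using (hasDerivAt_id t).const_mul (4 * K + 1)
    exact h1.exp.const_mul _
  · have := Real.exp_pos ((4 * K + 1) * t)
    have h2 : 0 ≤ N * Real.exp ((4 * K + 1) * t) := by positivity
    nlinarith

/-- A flow whose velocity is generated by its own transport of `m` is determined by its initial
values. -/
theorem IsFlowMap.eq_of_isSolutionOn (hF : IsForce F) (hD : IsDelay α τ)
    (hg : ContinuousP1On g (Icc (-τ 0) 0)) (m : Measure (E d)) [IsProbabilityMeasure m] {ρ : ℝ}
    {u u' : ℝ → E d → E d} (hu : IsFlowMap ρ u) (hu' : IsFlowMap ρ u') {S : ℝ}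
    (hs : ∀ x, IsSolutionOn (velocity α τ F g fun s => m.map (u s)) 0 S fun t => u t x)
    (hs' : ∀ x, IsSolutionOn (velocity α τ F g fun s => m.map (u' s)) 0 S fun t => u' t x)
    (h0 : ∀ x, u 0 x = u' 0 x) {t : ℝ} (ht : t ∈ Icc 0 S) (x : E d) : u t x = u' t x := by
  obtain ⟨K, hK, hcmp⟩ := exists_velocity_map_sub_le hF hD hg m ρ
  have hρ : 0 ≤ ρ := (norm_nonneg _).trans (hu.norm_le 0 0)
  have key : ∀ n : ℕ, ∀ t ∈ Icc 0 S, ∀ x,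
      ‖u t x - u' t x‖ ≤ 2 * ρ / 2 ^ n * Real.exp ((4 * K + 1) * t) := by
    intro n
    induction n with
    | zero =>
      intro t ht x
      have h1 : 1 ≤ Real.exp ((4 * K + 1) * t) :=
        Real.one_le_exp (mul_nonneg (by positivity) ht.1)
      have h2 := norm_sub_le (u t x) (u' t x)
      have h3 := hu.norm_le t x
      have h4 := hu'.norm_le t x
      rw [pow_zero, div_one]
      nlinarith
    | succ n ih =>
      intro t ht x
      have := norm_le_half_exp (f := fun t => u t x - u' t x)
        (by positivity : 0 ≤ 2 * ρ / 2 ^ n) (fun t ht => (hs x t ht).sub (hs' x t ht))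
        (by simp [h0 x]) (fun t ht => hcmp u u' hu hu' t ht.1 _ (fun s hs y =>
          (ih s ⟨hs.1, hs.2.trans ht.2⟩ y).trans (by gcongr; exact hs.2)) x) ht
      rw [pow_succ, ← div_div]
      exact this
  have hlim : Tendsto (fun n : ℕ => 2 * ρ / 2 ^ n * Real.exp ((4 * K + 1) * t)) atTop (𝓝 0) := by
    have h1 : Tendsto (fun n : ℕ => 2 * ρ * (1 / 2 : ℝ) ^ n * Real.exp ((4 * K + 1) * t)) atTop
        (𝓝 (2 * ρ * 0 * Real.exp ((4 * K + 1) * t))) :=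
      ((tendsto_pow_atTop_nhds_zero_of_lt_one (by norm_num) (by norm_num)).const_mul _).mul_const _
    rw [mul_zero, zero_mul] at h1
    refine h1.congr fun n => ?_
    rw [one_div, inv_pow, div_eq_mul_inv]
  have := ge_of_tendsto' hlim fun n => key n t ht x
  exact sub_eq_zero.1 (norm_le_zero_iff.1 this)

/-- A bounded continuous map that is the identity on the ball of radius `R`. -/
def retract (R : ℝ) (x : E d) : E d := cutoff R x • x

theorem continuous_retract (R : ℝ) : Continuous (retract R : E d → E d) :=
  (continuous_cutoff R).smul continuous_id

theorem retract_eq {R : ℝ} {x : E d} (h : ‖x‖ ≤ R) : retract R x = x := by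
  rw [retract, cutoff_eq_one h, one_smul]

theorem norm_retract_le {R : ℝ} (hR : 0 ≤ R) (x : E d) : ‖retract R x‖ ≤ R + 1 := by
  rw [retract, norm_smul, Real.norm_of_nonneg (cutoff_nonneg _ _)]
  rcases le_total ‖x‖ (R + 1) with h | h
  · exact (mul_le_of_le_one_left (norm_nonneg _) (cutoff_le_one _ _)).trans h
  · rw [cutoff_eq_zero h, zero_mul]; positivity

/-- The set on which Picard's iteration takes place: jointly continuous families of maps, frozen in
time outside `[0, T]`, with an exponential bound that the iteration preserves. -/
structure IsIterate (R C T : ℝ) (u : ℝ → E d → E d) : Prop where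
  continuous : Continuous (Function.uncurry u)
  clamp : ∀ t x, u t x = u (max 0 (min T t)) x
  norm_le : ∀ t ∈ Icc 0 T, ∀ x, ‖u t x‖ ≤ (R + 1) * Real.exp (2 * C * t)

theorem IsIterate.isFlowMap {R C T : ℝ} (hR : 0 ≤ R) (hC : 0 < C) (hT : 0 ≤ T)
    {u : ℝ → E d → E d} (hu : IsIterate R C T u) :
    IsFlowMap ((R + 1) * Real.exp (2 * C * T)) u where
  measurable t := (hu.continuous.comp (by fun_prop : Continuous fun x : E d => (t, x))).measurable
  continuous x := hu.continuous.comp (by fun_prop : Continuous fun t : ℝ => (t, x))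
  norm_le t x := by
    rw [hu.clamp]
    refine (hu.norm_le _ (clamp_mem hT t) x).trans ?_
    gcongr
    exact (clamp_mem hT t).2

/-- One step of Picard's iteration: integration in time of the velocity field generated by `u`,
evaluated along `u`. The rate `2 C` in the bound of `IsIterate` is what makes it invariant: each of
the two terms of the growth condition of the force contributes `C`. -/
theorem IsIterate.exists_next (hF : IsForce F) (hD : IsDelay α τ)
    (hg : ContinuousP1On g (Icc (-τ 0) 0)) (m : Measure (E d)) [IsProbabilityMeasure m]
    {R C T : ℝ} (hR : 0 ≤ R) (hgR : ∀ s ∈ Icc (-τ 0) 0, ∀ᵐ x ∂(g s), ‖x‖ ≤ R) (hT : 0 ≤ T)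
    (hC : 0 < C) (hgr : ∀ μ, IsP1 μ → ∀ x : E d, ‖F μ x‖ ≤ C * (‖x‖ + ∫ y, ‖y‖ ∂μ))
    {u : ℝ → E d → E d} (hu : IsIterate R C T u) :
    ∃ u' : ℝ → E d → E d, IsIterate R C T u' ∧ (∀ x, u' 0 x = retract R x) ∧
      ∀ x, ∀ t ∈ Icc 0 T, HasDerivWithinAt (fun t => u' t x)
        (velocity α τ F g (fun s => m.map (u s)) t (u t x)) (Icc 0 T) t := by
  have hfm := hu.isFlowMap hR hC hT
  have hcurve := hfm.continuousP1On m (Icc 0 T)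
  have hv := isField_velocity hF hD hg hcurve
  set v := velocity α τ F g (fun s => m.map (u s)) with hvdef
  -- frozen in time outside `[0, T]`, the integrand is continuous on the whole space
  let f : E d → ℝ → E d := fun x s => v (max 0 (min T s)) (u (max 0 (min T s)) x)
  have hf : Continuous (Function.uncurry f) := by
    have h1 : Continuous fun p : E d × ℝ => (max 0 (min T p.2), u (max 0 (min T p.2)) p.1) :=
      (by fun_prop : Continuous fun p : E d × ℝ => max 0 (min T p.2)).prodMk
        (hu.continuous.comp
          (by fun_prop : Continuous fun p : E d × ℝ => (max 0 (min T p.2), p.1)))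
    exact hv.continuousOn.comp_continuous h1 fun p => ⟨clamp_mem hT p.2, trivial⟩
  have hfx : ∀ x, Continuous (f x) := fun x =>
    hf.comp (by fun_prop : Continuous fun s : ℝ => (x, s))
  let u' : ℝ → E d → E d := fun t x => retract R x + ∫ s in (0 : ℝ)..max 0 (min T t), f x s
  have h0' : ∀ x, u' 0 x = retract R x := by
    intro x
    simp [u', min_eq_right hT]
  have hderiv : ∀ x, ∀ t ∈ Icc 0 T,
      HasDerivWithinAt (fun t => u' t x) (v t (u t x)) (Icc 0 T) t := by
    intro x t ht
    have h1 : HasDerivAt (fun t => retract R x + ∫ s in (0 : ℝ)..t, f x s) (f x t) t :=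
      (intervalIntegral.integral_hasDerivAt_right ((hfx x).intervalIntegrable _ _)
        ((hfx x).stronglyMeasurableAtFilter _ _) (hfx x).continuousAt).const_add _
    have h2 : f x t = v t (u t x) := by simp only [f, clamp_eq ht]
    rw [h2] at h1
    refine h1.hasDerivWithinAt.congr_of_mem (fun s hs => ?_) ht
    simp only [u', clamp_eq hs]
  refine ⟨u', ⟨?_, ?_, ?_⟩, h0', hderiv⟩
  · have h1 := intervalIntegral.continuous_parametric_primitive_of_continuous (μ := volume)
      (a₀ := (0 : ℝ)) hf
    exact ((continuous_retract R).comp continuous_snd).add (h1.comp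
      (by fun_prop : Continuous fun p : ℝ × E d => (p.2, max 0 (min T p.1))))
  · intro t x
    simp only [u', clamp_eq (clamp_mem hT t)]
  · intro t ht x
    refine image_norm_le_of_norm_deriv_right_le_deriv_boundary
      (B := fun t => (R + 1) * Real.exp (2 * C * t))
      (B' := fun t => (R + 1) * (Real.exp (2 * C * t) * (2 * C)))
      (fun t ht => (hderiv x t ht).continuousWithinAt)
      (fun t ht => hasDerivWithinAt_Ici_of_Icc (hderiv x t ⟨ht.1, ht.2.le⟩) ht) ?_ (fun t => ?_)
      (fun t ht => ?_) ht
    · simpa [h0'] using norm_retract_le hR x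
    · have h1 : HasDerivAt (fun t : ℝ => 2 * C * t) (2 * C) t := by
        simpa using (hasDerivAt_id t).const_mul (2 * C)
      exact h1.exp.const_mul _
    · have ht' : t ∈ Icc 0 T := ⟨ht.1, ht.2.le⟩
      -- both `u t x` and the first moments up to time `t` are at most `(R + 1) exp (2 C t)`
      have hM : ∀ s ∈ Ico (-τ 0) t, ∫ y, ‖y‖ ∂(withHistory g (fun s => m.map (u s)) s) ≤
          (R + 1) * Real.exp (2 * C * t) := by
        intro s hs
        have hexp : 1 ≤ Real.exp (2 * C * t) :=
          Real.one_le_exp (mul_nonneg (by positivity) ht.1)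
        rcases lt_or_ge s 0 with h | h
        · rw [withHistory_of_neg h]
          have := (hg.1 s ⟨hs.1, h.le⟩).1
          have := integral_norm_le_of_ae_le (u := fun x => x) (hgR s ⟨hs.1, h.le⟩)
          nlinarith
        · rw [withHistory_of_nonneg h, integral_map (hfm.measurable s).aemeasurable (by fun_prop)]
          refine integral_norm_le_of_ae_le (ae_of_all _ fun y => ?_)
          refine (hu.norm_le s ⟨h, hs.2.le.trans ht'.2⟩ y).trans ?_
          gcongr
          exact hs.2.le
      refine (norm_velocity_le_of_moment_le hD hg hcurve hC hgr ht' hM _).trans ?_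
      have := hu.norm_le t ht' x
      nlinarith

/-- Existence of a flow whose velocity is generated by its own transport of `m`: Picard's iteration
contracts by `1 / 2` in an exponentially weighted supremum norm. -/
theorem exists_flow (hF : IsForce F) (hD : IsDelay α τ)
    (hg : ContinuousP1On g (Icc (-τ 0) 0)) (m : Measure (E d)) [IsProbabilityMeasure m]
    {R T : ℝ} (hR : 0 ≤ R) (hgR : ∀ s ∈ Icc (-τ 0) 0, ∀ᵐ x ∂(g s), ‖x‖ ≤ R) (hT : 0 ≤ T) :
    ∃ (ρ : ℝ) (u : ℝ → E d → E d), IsFlowMap ρ u ∧ Continuous (Function.uncurry u) ∧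
      (∀ x, u 0 x = retract R x) ∧
      ∀ x, IsSolutionOn (velocity α τ F g fun s => m.map (u s)) 0 T fun t => u t x := by
  obtain ⟨C, hC, hgr⟩ := hF.growth
  set ρ := (R + 1) * Real.exp (2 * C * T) with hρ
  have hρ0 : 0 ≤ ρ := by positivity
  obtain ⟨K, hK, hcmp⟩ := exists_velocity_map_sub_le hF hD hg m ρ
  have hnext := fun (u : ℝ → E d → E d) (hu : IsIterate R C T u) =>
    hu.exists_next hF hD hg m hR hgR hT hC hgr
  choose next hnext_it hnext0 hnextd using hnext
  have h00 : (0 : ℝ) ∈ Icc 0 T := ⟨le_rfl, hT⟩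
  have hbase : IsIterate R C T (fun _ x => retract R x : ℝ → E d → E d) :=
    { continuous := (continuous_retract R).comp continuous_snd
      clamp := fun _ _ => rfl
      norm_le := fun t ht x => (norm_retract_le hR x).trans
        (le_mul_of_one_le_right (by positivity)
          (Real.one_le_exp (mul_nonneg (by positivity) ht.1))) }
  let U : ℕ → {u : ℝ → E d → E d // IsIterate R C T u} := fun n =>
    Nat.rec ⟨_, hbase⟩ (fun _ u => ⟨next u.1 u.2, hnext_it u.1 u.2⟩) n
  have hU : ∀ n, (U (n + 1)).1 = next (U n).1 (U n).2 := fun n => rfl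
  have hU0 : ∀ n x, (U n).1 0 x = retract R x := by
    intro n x
    cases n with
    | zero => rfl
    | succ n => rw [hU]; exact hnext0 _ _ x
  have hUf : ∀ n, IsFlowMap ρ (U n).1 := fun n => (U n).2.isFlowMap hR hC hT
  set lam := 4 * K + 1 with hlam
  -- one application of the step halves a weighted distance
  have hstep : ∀ u u' (hu : IsIterate R C T u) (hu' : IsIterate R C T u') (N : ℝ), 0 ≤ N →
      (∀ t ∈ Icc 0 T, ∀ x, ‖u t x - u' t x‖ ≤ N * Real.exp (lam * t)) →
      ∀ t ∈ Icc 0 T, ∀ x, ‖next u hu t x - next u' hu' t x‖ ≤ N / 2 * Real.exp (lam * t) := by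
    intro u u' hu hu' N hN h t ht x
    refine norm_le_half_exp (f := fun t => next u hu t x - next u' hu' t x) hN
      (fun t ht => (hnextd u hu x t ht).sub (hnextd u' hu' x t ht))
      (by simp [hnext0]) (fun t ht => hcmp u u' (hu.isFlowMap hR hC hT)
        (hu'.isFlowMap hR hC hT) t ht.1 _ (fun s hs y =>
          (h s ⟨hs.1, hs.2.trans ht.2⟩ y).trans (by gcongr; exact hs.2)) x) ht
  have hdist : ∀ n : ℕ, ∀ t ∈ Icc 0 T, ∀ x,
      ‖(U n).1 t x - (U (n + 1)).1 t x‖ ≤ 2 * ρ / 2 ^ n * Real.exp (lam * t) := by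
    intro n
    induction n with
    | zero =>
      intro t ht x
      have h1 : 1 ≤ Real.exp (lam * t) := Real.one_le_exp (mul_nonneg (by positivity) ht.1)
      have h2 := norm_sub_le ((U 0).1 t x) ((U 1).1 t x)
      have h3 := (hUf 0).norm_le t x
      have h4 := (hUf 1).norm_le t x
      rw [pow_zero, div_one, zero_add]
      nlinarith
    | succ n ih =>
      intro t ht x
      rw [pow_succ, ← div_div]
      exact hstep _ _ (U n).2 (U (n + 1)).2 _ (by positivity) ih t ht x
  set N := 2 * ρ * Real.exp (lam * T) with hN
  have hN0 : 0 ≤ N := by positivity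
  have hdist' : ∀ t x n, dist ((U n).1 t x) ((U (n + 1)).1 t x) ≤ N * (1 / 2) ^ n := by
    intro t x n
    rw [dist_eq_norm, (U n).2.clamp, (U (n + 1)).2.clamp]
    refine (hdist n _ (clamp_mem hT t) x).trans ?_
    have h1 : Real.exp (lam * max 0 (min T t)) ≤ Real.exp (lam * T) := by
      gcongr
      exact (clamp_mem hT t).2
    rw [hN, one_div, inv_pow, div_eq_mul_inv, mul_right_comm]
    gcongr
  choose u hu using fun (t : ℝ) (x : E d) => cauchySeq_tendsto_of_complete
    (cauchySeq_of_le_geometric (1 / 2 : ℝ) N (by norm_num) (hdist' t x))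
  have hclose : ∀ t x n, dist ((U n).1 t x) (u t x) ≤ 2 * N * (1 / 2) ^ n := by
    intro t x n
    refine (dist_le_of_le_geometric_of_tendsto (1 / 2 : ℝ) N (by norm_num) (hdist' t x)
      (hu t x) n).trans_eq ?_
    ring
  have hpow : ∀ c : ℝ, Tendsto (fun n : ℕ => c * (1 / 2 : ℝ) ^ n) atTop (𝓝 0) := by
    intro c
    have := (tendsto_pow_atTop_nhds_zero_of_lt_one (r := (1 / 2 : ℝ)) (by norm_num)
      (by norm_num)).const_mul c
    rwa [mul_zero] at this
  have huit : IsIterate R C T u := by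
    refine ⟨?_, fun t x => ?_, fun t ht x => ?_⟩
    · have hun : TendstoUniformly (fun n => Function.uncurry (U n).1) (Function.uncurry u)
          atTop := by
        rw [Metric.tendstoUniformly_iff]
        intro ε hε
        filter_upwards [(hpow (2 * N)).eventually (gt_mem_nhds hε)] with n hn p
        rw [dist_comm]
        exact (hclose p.1 p.2 n).trans_lt hn
      exact hun.continuous (Frequently.of_forall fun n => (U n).2.continuous)
    · refine tendsto_nhds_unique (hu t x) ((hu (max 0 (min T t)) x).congr fun n => ?_)
      exact ((U n).2.clamp t x).symm
    · exact le_of_tendsto (hu t x).norm (Eventually.of_forall fun n => (U n).2.norm_le t ht x)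
  -- the limit is a fixed point
  have hfix : ∀ t ∈ Icc 0 T, ∀ x, next u huit t x = u t x := by
    intro t ht x
    have h1 : ∀ n, dist ((U (n + 1)).1 t x) (next u huit t x) ≤
        (2 * N) / 2 * Real.exp (lam * t) * (1 / 2) ^ n := by
      intro n
      rw [hU, dist_eq_norm]
      refine (hstep _ _ (U n).2 huit (2 * N * (1 / 2) ^ n) (by positivity)
        (fun s hs y => ?_) t ht x).trans_eq (by ring)
      rw [← dist_eq_norm]
      exact (hclose s y n).trans (le_mul_of_one_le_right (by positivity)
        (Real.one_le_exp (mul_nonneg (by positivity) hs.1)))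
    have h2 : Tendsto (fun n => (U (n + 1)).1 t x) atTop (𝓝 (next u huit t x)) :=
      tendsto_iff_dist_tendsto_zero.2 (squeeze_zero (fun _ => dist_nonneg) h1 (hpow _))
    exact tendsto_nhds_unique h2 ((hu t x).comp (tendsto_add_atTop_nat 1))
  refine ⟨ρ, u, huit.isFlowMap hR hC hT, huit.continuous, fun x => ?_, fun x t ht => ?_⟩
  · rw [← hfix 0 h00 x, hnext0]
  · exact (hnextd u huit x t ht).congr_of_mem (fun s hs => (hfix s hs x).symm) ht

end

/-! ### Weak solutions and flows -/

section

/-- The push-forward of a probability measure along the characteristics solves the transport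
equation weakly. -/
theorem IsFlowMap.isWeakTransport {v : ℝ → E d → E d} {T ρ : ℝ} {u : ℝ → E d → E d} (hT : 0 ≤ T)
    (hu : IsFlowMap ρ u) (huc : Continuous (Function.uncurry u)) (hv : IsField v T)
    (hs : ∀ x, IsSolutionOn v 0 T fun t => u t x) (m : Measure (E d)) [IsProbabilityMeasure m] :
    IsWeakTransport v T (fun t => m.map (u t)) (m.map (u 0)) := by
  intro φ hφ
  obtain ⟨hφs, hφc, hφT⟩ := hφ
  have hφd : Differentiable ℝ φ := hφs.differentiable (by simp)
  have hfd : Continuous (fderiv ℝ φ) := hφs.continuous_fderiv (by simp)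
  obtain ⟨C, hC⟩ := hfd.bounded_above_of_compact_support (hφc.fderiv ℝ)
  obtain ⟨A, hA, hgr⟩ := hv.growth
  have hC0 : 0 ≤ C := (norm_nonneg _).trans (hC 0)
  -- the field is frozen outside `[0, T]`, which makes the integrand jointly continuous
  have hvc : Continuous fun p : ℝ × E d => v (max 0 (min T p.1)) (u p.1 p.2) :=
    hv.continuousOn.comp_continuous (f := fun p : ℝ × E d => (max 0 (min T p.1), u p.1 p.2))
      ((by fun_prop : Continuous fun p : ℝ × E d => max 0 (min T p.1)).prodMk huc)
      fun p => ⟨clamp_mem hT p.1, trivial⟩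
  set H : ℝ → E d → ℝ := fun t x => fderiv ℝ φ (u t x, t) (v (max 0 (min T t)) (u t x), 1) with hH
  have hHc : Continuous (Function.uncurry H) :=
    (hfd.comp (huc.prodMk continuous_fst)).clm_apply (hvc.prodMk continuous_const)
  have hHb : ∀ t x, ‖H t x‖ ≤ C * (A * (1 + ρ) + 1) := by
    intro t x
    have h1 : ‖v (max 0 (min T t)) (u t x)‖ ≤ A * (1 + ρ) :=
      (hgr _ (clamp_mem hT t) _).trans (by gcongr; exact hu.norm_le t x)
    have h0 : 0 ≤ A * (1 + ρ) := (norm_nonneg _).trans h1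
    refine (ContinuousLinearMap.le_opNorm _ _).trans (mul_le_mul (hC _) ?_ (norm_nonneg _) hC0)
    rw [Prod.norm_def, norm_one]
    exact max_le (by linarith) (by linarith)
  have e1 : ∀ t ∈ Ioc 0 T, ∫ x, (deriv (fun r => φ (x, r)) t
      + fderiv ℝ (fun y => φ (y, t)) x (v t x)) ∂(m.map (u t)) = ∫ x, H t x ∂m := by
    intro t ht
    have ht' : t ∈ Icc 0 T := ⟨ht.1.le, ht.2⟩
    have hvt : Continuous (v t) := hv.continuousOn.comp_continuous
      (f := fun x : E d => (t, x)) (by fun_prop) fun x => ⟨ht', trivial⟩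
    simp only [deriv_add_fderiv_eq hφd]
    have h1 : Continuous fun x => fderiv ℝ φ (x, t) (v t x, 1) :=
      (hfd.comp (by fun_prop : Continuous fun x : E d => (x, t))).clm_apply
        (hvt.prodMk continuous_const)
    rw [integral_map (hu.measurable t).aemeasurable h1.aestronglyMeasurable]
    simp only [hH, clamp_eq ht']
  have hint : Integrable (Function.uncurry H) ((volume.restrict (Ioc 0 T)).prod m) :=
    Integrable.of_bound hHc.aestronglyMeasurable _ (ae_of_all _ fun p => hHb p.1 p.2)
  have e2 : ∀ x, ∫ t in Ioc 0 T, H t x = -φ (u 0 x, 0) := by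
    intro x
    have hx : Continuous fun t => u t x := hu.continuous x
    have hTz : φ (u T x, T) = 0 :=
      image_eq_zero_of_notMem_tsupport fun hm => lt_irrefl T (hφT hm).2
    have := intervalIntegral.integral_eq_sub_of_hasDerivAt_of_le (f := fun t => φ (u t x, t))
      (f' := fun t => H t x) hT (hφs.continuous.comp (hx.prodMk continuous_id)).continuousOn
      (fun t ht => by
        have ht' : t ∈ Icc 0 T := ⟨ht.1.le, ht.2.le⟩
        have h1 := (hs x t ht').hasDerivAt (Icc_mem_nhds ht.1 ht.2)
        have h2 := (hφd (u t x, t)).hasFDerivAt.comp_hasDerivAt (f := fun s => (u s x, s)) t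
          (h1.prodMk (hasDerivAt_id t))
        simp only [hH, clamp_eq ht']
        exact h2)
      ((hHc.comp (by fun_prop : Continuous fun t : ℝ => (t, x))).intervalIntegrable _ _)
    rw [hTz, zero_sub, intervalIntegral.integral_of_le hT] at this
    exact this
  have hφ0 : Continuous fun x : E d => φ (x, 0) := hφs.continuous.comp (by fun_prop)
  rw [intervalIntegral.integral_of_le hT, setIntegral_congr_fun measurableSet_Ioc e1,
    integral_integral_swap hint,
    integral_map (hu.measurable 0).aemeasurable hφ0.aestronglyMeasurable]
  simp only [e2, integral_neg]
  exact neg_add_cancel _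

variable {α τ : ℝ → ℝ} {F : Measure (E d) → E d → E d} {g : ℝ → Measure (E d)}

/-- A `W1`-continuous curve on `[0, S]` is determined by its values at positive times. -/
theorem ContinuousP1On.eq_zero_of_eqOn_Ioc {μ ν : ℝ → Measure (E d)} {S : ℝ} (hS : 0 < S)
    (hμ : ContinuousP1On μ (Icc 0 S)) (hν : ContinuousP1On ν (Icc 0 S))
    (h : EqOn μ ν (Ioc 0 S)) : μ 0 = ν 0 := by
  have h0 : (0 : ℝ) ∈ Icc 0 S := ⟨le_rfl, hS.le⟩
  have := (hμ.1 0 h0).1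
  have := (hν.1 0 h0).1
  refine measure_eq_of_forall_smooth fun η hη hηc => ?_
  obtain ⟨C, hC⟩ := hη.continuous.bounded_above_of_compact_support hηc
  have hC0 : 0 ≤ C := (norm_nonneg _).trans (hC 0)
  have key : ∀ κ : ℝ → Measure (E d), ContinuousP1On κ (Icc 0 S) →
      Tendsto (fun t => ∫ x, η x ∂(κ t)) (𝓝[Ioc 0 S] 0) (𝓝 (∫ x, η x ∂(κ 0))) := by
    intro κ hκ
    have h1 := hκ.continuousOn_integral (P := Unit) (Ψ := fun _ x => η x)
      (hη.continuous.comp continuous_snd) (fun _ => ⟨C, Eventually.of_forall fun _ x =>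
        (hC x).trans (by nlinarith [mul_nonneg hC0 (norm_nonneg x)])⟩)
    have h2 : ContinuousOn (fun t => ∫ x, η x ∂(κ t)) (Icc 0 S) :=
      h1.comp (f := fun t => (t, ())) (by fun_prop) (fun t ht => ⟨ht, trivial⟩)
    exact (h2 0 h0).mono_left (nhdsWithin_mono _ Ioc_subset_Icc_self)
  have hne : (𝓝[Ioc 0 S] (0 : ℝ)).NeBot := by
    rw [← mem_closure_iff_nhdsWithin_neBot, closure_Ioc hS.ne]
    exact h0
  refine tendsto_nhds_unique (key μ hμ) ((key ν hν).congr' ?_)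
  filter_upwards [self_mem_nhdsWithin] with t ht
  rw [h ht]

/-- Every weak solution is generated, at times before `T`, by a flow that solves the nonlinear
characteristic system. -/
theorem IsWeakSolution.exists_flow (hF : IsForce F) (hD : IsDelay α τ)
    (hg : ContinuousP1On g (Icc (-τ 0) 0)) [IsProbabilityMeasure (g 0)] {R : ℝ} (hR : 0 ≤ R)
    (hgR : ∀ᵐ x ∂(g 0), ‖x‖ ≤ R) {T S : ℝ} (hS : 0 < S) (hST : S < T) {ν : ℝ → Measure (E d)}
    (hν : IsWeakSolution α τ F g T ν) :
    ∃ ρ u, IsFlowMap ρ u ∧ (∀ x, u 0 x = retract R x) ∧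
      (∀ x, IsSolutionOn (velocity α τ F g fun s => (g 0).map (u s)) 0 S fun t => u t x) ∧
      EqOn ν (fun s => (g 0).map (u s)) (Icc 0 S) := by
  have hνS : ContinuousP1On ν (Icc 0 S) :=
    hν.1.mono fun t ht => ⟨ht.1, ht.2.trans_lt hST⟩
  have hv := isField_velocity hF hD hg hνS
  choose X' hX0' hXs' using fun x => hv.exists_isSolutionOn hS.le x
  let X : ℝ → E d → E d := fun t x => X' x t
  have hX0 : ∀ x, X 0 x = x := hX0'
  have hXs : ∀ x, IsSolutionOn (velocity α τ F g ν) 0 S fun t => X t x := hXs'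
  have hXc : ∀ t ∈ Icc 0 S, Continuous (X t) := fun t ht => hv.continuous_flow hX0 hXs ht
  obtain ⟨A, hA, hgr⟩ := hv.growth
  -- composing with `retract R` makes the flow bounded without changing it on the support of
  -- `g 0`
  let u : ℝ → E d → E d := fun t x => X (max 0 (min S t)) (retract R x)
  have hu : IsFlowMap ((1 + (R + 1)) * Real.exp (A * (S - 0))) u :=
    { measurable := fun t => ((hXc _ (clamp_mem hS.le t)).comp (continuous_retract R)).measurable
      continuous := fun x => (hXs (retract R x)).continuousOn.comp_continuous (by fun_prop)
        fun t => clamp_mem hS.le t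
      norm_le := fun t x => by
        have h1 := (hXs (retract R x)).one_add_norm_le hA hgr ⟨le_rfl, hS.le⟩ (clamp_mem hS.le t)
        have h2 : (1 + ‖X 0 (retract R x)‖) * Real.exp (A * (S - 0)) ≤
            (1 + (R + 1)) * Real.exp (A * (S - 0)) := by
          rw [hX0]; gcongr; exact norm_retract_le hR x
        linarith }
  have hu0 : ∀ x, u 0 x = retract R x := fun x => by
    simp only [u, clamp_eq (show (0 : ℝ) ∈ Icc 0 S from ⟨le_rfl, hS.le⟩), hX0]
  have hcurve := hu.continuousP1On (g 0) (Icc 0 S)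
  -- the linear uniqueness theorem applies at positive times; time `0` follows by continuity
  have hpos : EqOn ν (fun s => (g 0).map (u s)) (Ioc 0 S) := by
    intro t ht
    have ht' : t ∈ Icc 0 S := ⟨ht.1.le, ht.2⟩
    have h1 : ν t = (g 0).map (X t) :=
      IsWeakTransport.eq_map ht.1 (ht.2.trans_lt hST) (hv.mono ht.2)
        (hνS.mono (Icc_subset_Icc_right ht.2)) hν.2 hgR (hXc t ht').measurable
        fun x _ => ⟨fun t => X t x, hX0 x, (hXs x).mono le_rfl ht.2, rfl⟩
    rw [h1]
    refine Measure.map_congr ?_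
    filter_upwards [hgR] with x hx
    simp only [u, clamp_eq ht', retract_eq hx]
  have heq : EqOn ν (fun s => (g 0).map (u s)) (Icc 0 S) := by
    intro t ht
    rcases ht.1.eq_or_lt with h | h
    · rw [← h]; exact hνS.eq_zero_of_eqOn_Ioc hS hcurve hpos
    · exact hpos ⟨h, ht.2⟩
  refine ⟨_, u, hu, hu0, fun x t ht => ?_, heq⟩
  have h1 : u t x = X t (retract R x) := by simp only [u, clamp_eq ht]
  rw [← velocity_congr hD ht heq]
  simp only [h1]
  refine (hXs (retract R x) t ht).congr_of_mem (fun s hs => ?_) ht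
  simp only [u, clamp_eq hs]

theorem ae_norm_le_of_support_subset {m : Measure (E d)} {R : ℝ}
    (h : m.support ⊆ Metric.closedBall 0 R) : ∀ᵐ x ∂m, ‖x‖ ≤ R := by
  filter_upwards [Measure.support_mem_ae (μ := m)] with x hx
  simpa using h hx

/-- Positivity of `h` is inherited from `τmin`, since `τmin ≤ τ t` and `α` is nonnegative. -/
theorem isDelay {τmin : ℝ} (hτmin : 0 < τmin) (hτ_ge : ∀ t, 0 ≤ t → τmin ≤ τ t)
    (hτ_lip : ∀ T : ℝ, 0 < T → ∃ K : ℝ≥0, LipschitzOnWith K τ (Icc 0 T))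
    (hτ_deriv : ∀ᵐ t ∂(volume.restrict (Ici (0 : ℝ))), deriv τ t ≤ 0)
    (hα_nonneg : ∀ s ∈ Icc 0 (τ 0), 0 ≤ α s)
    (hα_int : IntegrableOn α (Icc 0 (τ 0))) (hα_pos : 0 < ∫ s in (0 : ℝ)..τmin, α s) :
    IsDelay α τ := by
  have hanti := antitoneOn_of_ae_deriv_nonpos hτ_lip hτ_deriv
  have hle : ∀ t, 0 ≤ t → τ t ≤ τ 0 := fun t ht => hanti (mem_Ici.2 le_rfl) (mem_Ici.2 ht) ht
  refine ⟨fun t ht => ?_, fun t ht => hτmin.trans_le (hτ_ge t ht), hle, hα_nonneg, hα_int,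
    fun t ht => ?_⟩
  · obtain ⟨K, hK⟩ := hτ_lip (t + 1) (by linarith [mem_Ici.1 ht])
    have h1 := hK.continuousOn t ⟨ht, by linarith⟩
    refine h1.mono_of_mem_nhdsWithin ?_
    filter_upwards [self_mem_nhdsWithin, mem_nhdsWithin_of_mem_nhds (Iio_mem_nhds (lt_add_one t))]
      with s hs hs' using ⟨hs, (mem_Iio.1 hs').le⟩
  · have hsub : ∀ {a b : ℝ}, 0 ≤ a → a ≤ b → b ≤ τ 0 → IntervalIntegrable α volume a b := by
      intro a b ha hab hb
      rw [intervalIntegrable_iff_integrableOn_Icc_of_le hab]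
      exact hα_int.mono_set (Icc_subset_Icc ha hb)
    have h1 := intervalIntegral.integral_add_adjacent_intervals
      (hsub le_rfl hτmin.le ((hτ_ge t ht).trans (hle t ht)))
      (hsub hτmin.le (hτ_ge t ht) (hle t ht))
    have h2 : 0 ≤ ∫ s in τmin..τ t, α s := intervalIntegral.integral_nonneg (hτ_ge t ht)
      fun s hs => hα_nonneg s ⟨hτmin.le.trans hs.1, hs.2.trans (hle t ht)⟩
    rw [h, ← h1]
    linarith

end

end DelayedTransport

end

open DelayedTransport in
theorem mainTheorem2 (d : ℕ)
    -- the delay: in `W^{1,∞}([0,T])` for every `T > 0`, bounded below, with `τ' ≤ 0`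
    (τ : ℝ → ℝ) (τmin : ℝ) (hτmin : 0 < τmin) (hτ_ge : ∀ t, 0 ≤ t → τmin ≤ τ t)
    (hτ_lip : ∀ T : ℝ, 0 < T → ∃ K : ℝ≥0, LipschitzOnWith K τ (Icc 0 T))
    (hτ_deriv : ∀ᵐ t ∂(volume.restrict (Ici (0 : ℝ))), deriv τ t ≤ 0)
    -- the weight
    (α : ℝ → ℝ) (hα_nonneg : ∀ s ∈ Icc 0 (τ 0), 0 ≤ α s)
    (hα_int : IntegrableOn α (Icc 0 (τ 0))) (hα_pos : 0 < ∫ s in (0 : ℝ)..τmin, α s)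
    -- the influence function
    (ψ : ℝ → ℝ) (hψ_pos : ∀ r, 0 ≤ r → 0 < ψ r) (hψ_anti : AntitoneOn ψ (Ici 0))
    (L : ℝ≥0) (hψ_lip : LipschitzOnWith L ψ (Ici 0))
    -- the interaction
    (F : Measure (DelayedTransport.E d) → DelayedTransport.E d → DelayedTransport.E d)
    (hF : F = DelayedTransport.forceSymm ψ ∨ F = DelayedTransport.forceNonsymm ψ)
    -- the initial history
    (g : ℝ → Measure (DelayedTransport.E d))
    (hg : DelayedTransport.ContinuousP1On g (Icc (-τ 0) 0))
    (R : ℝ) (hR : 0 < R) (hg_supp : ∀ s ∈ Icc (-τ 0) 0, (g s).support ⊆ Metric.closedBall 0 R)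
    (T : ℝ) (hT : 0 < T) :
    ∃ μ : ℝ → Measure (DelayedTransport.E d),
      DelayedTransport.IsWeakSolution α τ F g T μ ∧
      -- uniqueness on `[0,T)`
      (∀ ν : ℝ → Measure (DelayedTransport.E d),
        DelayedTransport.IsWeakSolution α τ F g T ν → EqOn ν μ (Ico 0 T)) ∧
      μ 0 = g 0 ∧
      -- uniformly compact support
      (∃ K : Set (DelayedTransport.E d), IsCompact K ∧ ∀ t ∈ Ico 0 T, (μ t).support ⊆ K) ∧
      -- push-forward along the unique solution of the characteristic system
      ∃ X : ℝ → DelayedTransport.E d → DelayedTransport.E d,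
        DelayedTransport.IsCharacteristicFlow (DelayedTransport.velocity α τ F g μ) T X ∧
        (∀ Y : ℝ → DelayedTransport.E d → DelayedTransport.E d,
          DelayedTransport.IsCharacteristicFlow (DelayedTransport.velocity α τ F g μ) T Y →
            EqOn Y X (Ico 0 T)) ∧
        ∀ t ∈ Ico 0 T, Measurable (X t) ∧ μ t = (μ 0).map (X t) := by

  have hFF : IsForce F := by
    rcases hF with rfl | rfl
    · exact isForce_forceSymm hψ_pos hψ_anti hψ_lip
    · exact isForce_forceNonsymm hψ_pos hψ_anti hψ_lip
  have hD := isDelay hτmin hτ_ge hτ_lip hτ_deriv hα_nonneg hα_int hα_pos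
  have hgR : ∀ s ∈ Icc (-τ 0) 0, ∀ᵐ x ∂(g s), ‖x‖ ≤ R := fun s hs =>
    ae_norm_le_of_support_subset (hg_supp s hs)
  have h0 : (0 : ℝ) ∈ Icc (-τ 0) 0 := ⟨by linarith [hD.pos 0 le_rfl], le_rfl⟩
  have := (hg.1 0 h0).1
  obtain ⟨ρ, u, hu, huc, hu0, hus⟩ := exists_flow hFF hD hg (g 0) hR.le hgR hT.le
  set μ : ℝ → Measure (E d) := fun t => (g 0).map (u t) with hμ
  have hμ0 : (g 0).map (u 0) = g 0 := by
    rw [Measure.map_congr (g := id) (by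
      filter_upwards [hgR 0 h0] with x hx using (hu0 x).trans (retract_eq hx)), Measure.map_id]
  have hcurve : ∀ I, ContinuousP1On μ I := hu.continuousP1On (g 0)
  have hv := isField_velocity hFF hD hg (hcurve (Icc 0 T))
  -- `u` starts from `retract R`; the characteristic flow `X` starts from the identity on the whole
  -- space, and agrees with `u` on the ball that carries `g 0`
  choose X' hX0' hXs' using fun x => hv.exists_isSolutionOn hT.le x
  let X : ℝ → E d → E d := fun t x => X' x t
  have hX0 : ∀ x, X 0 x = x := hX0'
  have hXs : ∀ x, IsSolutionOn (velocity α τ F g μ) 0 T fun t => X t x := hXs'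
  refine ⟨μ, ⟨hcurve _, fun φ hφ => ?_⟩, fun ν hν t ht => ?_, hμ0, ?_, X, fun x => ⟨hX0 x, ?_⟩,
    fun Y hY t ht => ?_, fun t ht => ?_⟩
  · have := hu.isWeakTransport hT.le huc hv hus (g 0) φ hφ
    rwa [hμ0] at this
  · -- both curves are generated by flows up to the time `S ∈ (t, T)`; the flows agree
    obtain ⟨S, htS, hST⟩ := exists_between ht.2
    obtain ⟨ρ', u', hu', hu0', hus', heq⟩ := hν.exists_flow hFF hD hg hR.le (hgR 0 h0)
      (ht.1.trans_lt htS) hST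
    have htm : t ∈ Icc 0 S := ⟨ht.1, htS.le⟩
    rw [heq htm]
    refine Measure.map_congr (ae_of_all _ fun x => ?_)
    exact (hu'.mono (le_max_left ρ' ρ)).eq_of_isSolutionOn hFF hD hg (g 0)
      (hu.mono (le_max_right ρ' ρ)) hus' (fun x => (hus x).mono le_rfl hST.le)
      (fun x => (hu0' x).trans (hu0 x).symm) htm x
  · refine ⟨Metric.closedBall 0 ρ, isCompact_closedBall _ _, fun t _ => ?_⟩
    refine Measure.support_subset_of_isClosed Metric.isClosed_closedBall ?_
    refine (ae_map_iff (hu.measurable t).aemeasurable Metric.isClosed_closedBall.measurableSet).2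
      (ae_of_all _ fun x => ?_)
    simpa using hu.norm_le t x
  · exact fun t ht => (hXs x t ⟨ht.1, ht.2.le⟩).mono Ico_subset_Icc_self
  · funext x
    have htm : t ∈ Icc 0 t := ⟨ht.1, le_rfl⟩
    refine (hv.mono ht.2.le).eqOn (f := fun s => Y s x) (f' := fun s => X s x) (fun s hs => ?_)
      ((hXs x).mono le_rfl ht.2.le) ((hY x).1.trans (hX0 x).symm) htm
    exact ((hY x).2 s ⟨hs.1, hs.2.trans_lt ht.2⟩).mono fun r hr => ⟨hr.1, hr.2.trans_lt ht.2⟩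
  · have ht' : t ∈ Icc 0 T := ⟨ht.1, ht.2.le⟩
    refine ⟨(hv.continuous_flow hX0 hXs ht').measurable, ?_⟩
    change (g 0).map (u t) = ((g 0).map (u 0)).map (X t)
    rw [hμ0]
    refine Measure.map_congr ?_
    filter_upwards [hgR 0 h0] with x hx
    exact hv.eqOn (hus x) (hXs x) (by rw [hu0, hX0, retract_eq hx]) ht'
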